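/- **Model.** Let $n\ge 3$. A *1-interval connected ring with a landmark* has nodes $v_i$ ($i\in\mathbb Z/n$), edges $\{v_i,v_{i+1}\}$, one distinguished node (the landmark, recognisable by the agents; the other nodes are indistinguishable), and in every round $t=0,1,2,\dots$ at most one edge, chosen by an adversary, is absent. Two anonymous agents run the same deterministic protocol, which does not depend on $n$. Each has a private, consistent orientation left/right; the two orientations may coincide or be opposite (*no chirality*). Both start in the landmark node, off the ports. In every round each agent (*Look*) sees whether it and the other agent, if at the same node, are on a port (and which), and whether the node is the landmark, and knows whether its last attempt to move succeeded; (*Compute*) it decides, from everything it has seen, to try to move left or right, to stay, or to terminate; (*Move*) an agent that wants to move must get hold of the corresponding port. Agents first leave ports they do not request; a port holds at most one agent; an agent already on the requested port keeps it; a competition is otherwise resolved by the adversary; an agent that is denied access remains in the node. An agent that holds a port crosses the edge if it is present and otherwise waits on the port. An agent that stays or terminates is in the node, off the ports. The agents *catch* each other when, at a Look, they are at the same node, exactly one of them being on a port. **Algorithm.** Let $Ttime$ be the number of completed rounds. An agent *knows $n$* once it returns to the landmark with non-zero net displacement since the start. Put $T(n)=32(3\lceil\log_2 n\rceil+3)\cdot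 5n$. As long as the agents have not caught each other, an agent does the following. * It moves left until it knows $n$ or is blocked on a port. When first blocked it sets $r_1=Ttime$ and moves right, until it knows $n$ or is blocked on a port a second time. When in this period it first enters the landmark, $r_3$ is set to the number of rounds since $r_1$ ($r_3=0$ if this does not happen); if the other agent is at the landmark in that round, it stays for one round, and terminates if they are then still together. * If it learns $n$ in this period, it keeps its direction and terminates as soon as $Ttime\ge T(n)+1$. * If it is blocked a second time, it sets $r_2=Ttime-\max(r_1,r_3)$, its *ID* is the number obtained by interleaving the bits of $r_1,r_2,r_3$, and it then moves in the direction $direction(ID,Ttime)$. If it knows $n$ when it computes its ID or when the scheduled direction changes, it keeps the direction of that round and terminates as soon as $Ttime\ge T(n)$. Here $direction(ID,r)$ is as follows. Let $b(ID)$ be the binary representation of $ID$ and $S=10\circ b(ID)\circ 0$; let $\bar\jmath$ be minimal with $2^{\bar\jmath}\ge|S|$, and pad $S$ with leading zeros to length $2^{\bar\jmath}$. Phase $j$ consists of the rounds $2^j,\dots,2^{j+1}-1$. In a phase $j>\bar\jmath$, each character of the padded string is repeated $2^{j-\bar\jmath}$ times, and the $k$-th round of the phase has direction left or right according as the $k$-th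 character is $0$ or $1$. For $j\le\bar\jmath$ the direction is left. When the agents catch each other, they have distinct roles and a common orientation (that of the occupied port), and from that round on they follow a procedure $K$ for agents with chirality. **Theorem.** There are a procedure $K$ (independent of $n$) and a constant $C$ such that for every $n\ge 3$, every landmark, all private orientations and every behaviour of the adversary: 1. both agents terminate within $C\,n\log n$ rounds; 2. when an agent has terminated, every node of the ring has been visited by some agent; 3. once the agents have caught each other, both terminate within $C\,n$ further rounds; 4. every computed ID has at most $C\log n$ bits; 5. if both agents compute an ID, the two IDs are distinct, and there are $5n$ consecutive rounds, after both IDs have been computed and before round $T(n)$, in which the two schedules prescribe the same direction along the ring. -/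

import Mathlib

/-! # Two agents on a 1-interval connected ring with a landmark (fully synchronous model) -/

namespace DynamicRing

/-! ## Sides, agents, snapshots, protocols -/

/-- The two sides of a node.  It is used both for an agent's private labels and, in configurations,
for the global labels of the two ports of a node (`left` leads from `i` to `i - 1`, `right` from
`i` to `i + 1`); agents only ever see private labels. -/
inductive Side
  | left
  | right
  deriving DecidableEq

/-- The opposite side. -/
def Side.opp : Side → Side
  | .left => .right
  | .right => .left

/-- The displacement of one step: `-1` to the left, `+1` to the right. -/
def Side.sign : Side → ℤ
  | .left => -1
  | .right => 1

/-- Translation between global and private labels for an agent whose private orientation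
is the global one (`flipped = false`) or the reverse one (`flipped = true`). -/
def Side.relabel (flipped : Bool) (s : Side) : Side :=
  if flipped then s.opp else s

/-- The names of the two agents; they are not accessible to the agents. -/
abbrev Agent := Bool

/-- What an agent perceives at the beginning of a round, in its private labels. -/
structure Snapshot where
  /-- The port on which the agent is, if any. -/
  myPos : Option Side
  /-- `none` if the other agent is at another node; otherwise `some p`, where `p` is the port
  on which the other agent is, if any. -/
  other : Option (Option Side)
  /-- Whether the node is the landmark. -/
  isLandmark : Bool
  /-- Whether the agent moved to this node in the previous round. -/
  moved : Bool

/-- Whether the other agent is at the same node. -/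
def Snapshot.together (o : Snapshot) : Bool := o.other.isSome

/-- The agents catch each other: they are at the same node, exactly one of them is on a port.
The one in the node `catches`, the one on the port is `catched`. -/
def Snapshot.isCatch (o : Snapshot) : Bool :=
  match o.myPos, o.other with
  | none, some (some _) => true
  | some _, some none => true
  | _, _ => false

/-- The result of a `Compute`. -/
inductive Act
  /-- try to leave through the port with the given private label -/
  | move (s : Side)
  /-- stay in the node, off the ports -/
  | stay
  /-- terminate: stay in the node, off the ports, for ever -/
  | terminate

/-- A deterministic protocol: the next action as a function of all snapshots taken so far,
in chronological order, including the present one.  Both agents run the same protocol, and the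
protocol does not depend on the ring size. -/
abbrev Protocol := List Snapshot → Act

/-! ## Executions -/

/-- Everything that the agents do not control, for a ring with node set `ZMod n`: the landmark, the
private orientations, the edge that is absent in each round (edge `i` joins `i` and `i + 1`),
and the agent that obtains a port for which both compete. -/
structure Environment (n : ℕ) where
  landmark : ZMod n
  flipped : Agent → Bool
  missing : ℕ → Option (ZMod n)
  priority : ℕ → Agent

/-- The situation of one agent at the beginning of a round (`port` with its global label). -/
structure AgentState (n : ℕ) where
  node : ZMod n
  port : Option Side
  moved : Bool
  terminated : Bool
  history : List Snapshot

/-- The situation of both agents. -/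
abbrev Config (n : ℕ) := Agent → AgentState n

/-- Both agents are initially in the landmark node, off the ports. -/
def initialConfig {n : ℕ} (E : Environment n) : Config n := fun _ =>
  { node := E.landmark, port := none, moved := false, terminated := false, history := [] }

/-- `Look`. -/
def look {n : ℕ} (E : Environment n) (c : Config n) (a : Agent) : Snapshot where
  myPos := (c a).port.map (Side.relabel (E.flipped a))
  other := if (c (!a)).node = (c a).node
    then some ((c (!a)).port.map (Side.relabel (E.flipped a))) else none
  isLandmark := decide ((c a).node = E.landmark)
  moved := (c a).moved

/-- `Compute`: the chosen action. -/
def compute {n : ℕ} (P : Protocol) (E : Environment n) (c : Config n) (a : Agent) : Act :=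
  if (c a).terminated then .terminate else P ((c a).history ++ [look E c a])

/-- The port (global label) that an agent wants to use, if any. -/
def request {n : ℕ} (P : Protocol) (E : Environment n) (c : Config n) (a : Agent) : Option Side :=
  match compute P E c a with
  | .move s => some (s.relabel (E.flipped a))
  | _ => none

/-- Whether the agent has access to the port that it requests in round `t`.  Agents first leave the
ports that they do not request; a port is held by at most one agent; an agent
that already is on the requested port keeps it; otherwise the environment decides a competition. -/
def gainsAccess {n : ℕ} (P : Protocol) (E : Environment n) (t : ℕ) (c : Config n)
    (a : Agent) : Bool :=
  if (c (!a)).node = (c a).node ∧ request P E c (!a) = request P E c a then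
    if (c a).port = request P E c a then true
    else if (c (!a)).port = request P E c a then false
    else decide (E.priority t = a)
  else true

/-- The edge behind a port. -/
def edgeAt {n : ℕ} (v : ZMod n) : Side → ZMod n
  | .left => v - 1
  | .right => v

/-- The situation of an agent after round `t`. -/
def nextState {n : ℕ} (P : Protocol) (E : Environment n) (t : ℕ) (c : Config n)
    (a : Agent) : AgentState n :=
  let base : AgentState n :=
    { node := (c a).node
      port := none
      moved := false
      terminated := match compute P E c a with
        | .terminate => true
        | _ => false
      history := (c a).history ++ [look E c a] }
  match request P E c a with
  | none => base
  | some s =>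
    if gainsAccess P E t c a then
      if E.missing t = some (edgeAt (c a).node s) then { base with port := some s }
      else { base with node := (c a).node + (s.sign : ZMod n), moved := true }
    else base

/-- The configuration after `t` rounds. -/
def execution {n : ℕ} (P : Protocol) (E : Environment n) : ℕ → Config n
  | 0 => initialConfig E
  | t + 1 => nextState P E t (execution P E t)

/-- By time `t` every node has been visited by an agent. -/
def ExploredBy {n : ℕ} (P : Protocol) (E : Environment n) (t : ℕ) : Prop :=
  ∀ v : ZMod n, ∃ s ≤ t, ∃ a : Agent, (execution P E s a).node = v

/-! ## Identifiers and the direction schedule -/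

/-- The number whose base-8 digits are the binary digits of `x`. -/
def spread (x : ℕ) : ℕ := Nat.ofDigits 8 (Nat.digits 2 x)

/-- The identifier made of the interleaved bits of `r₁`, `r₂`, `r₃`. -/
def interleave (r₁ r₂ r₃ : ℕ) : ℕ := spread r₁ + 2 * spread r₂ + 4 * spread r₃

/-- The string `10 ∘ b(ID) ∘ 0`, with `b(ID)` the minimal binary representation of `ID`,
most significant bit first. -/
def idString (ID : ℕ) : List Bool := [true, false] ++ (Nat.bits ID).reverse ++ [false]

/-- The least `j` such that `2 ^ j` is at least the length of `idString ID`. -/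
def basePhase (ID : ℕ) : ℕ := Nat.clog 2 (idString ID).length

/-- `idString ID` padded with leading zeros to length `2 ^ basePhase ID`. -/
def paddedString (ID : ℕ) : List Bool :=
  List.replicate (2 ^ basePhase ID - (idString ID).length) false ++ idString ID

/-- Repeat each character `k` times. -/
def dup (S : List Bool) (k : ℕ) : List Bool := S.flatMap (List.replicate k)

/-- The direction, in the private orientation, of an agent with identifier `ID` in round `r`.
Phase `j` consists of the `2 ^ j` rounds `2 ^ j, …, 2 ^ (j + 1) - 1`; in a phase
`j > basePhase ID` the string `dup (paddedString ID) (2 ^ (j - basePhase ID))`, which has one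
character for each round of the phase, is followed (`0` is left, `1` is right).
In the earlier phases the direction is left. -/
def direction (ID r : ℕ) : Side :=
  let j := Nat.log 2 r
  if basePhase ID < j ∧
      (dup (paddedString ID) (2 ^ (j - basePhase ID))).getD (r - 2 ^ j) false = true
  then .right else .left

/-- The time bound used for termination once the ring size `n` is known. -/
def timeout (n : ℕ) : ℕ := 32 * ((3 * Nat.clog 2 n + 3) * 5 * n)

/-! ## The algorithm -/

/-- The states of the algorithm.  `waitL` is the round of waiting in the state `atLandmarkL`;
the flag of `reverse` records whether the ring size was known when the state was (re-)entered;
`caught` is entered when the agents catch each other. -/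
inductive Phase
  | initL
  | happy
  | firstBlockL
  | atLandmarkL
  | waitL
  | reverse (known : Bool)
  | caught
  | terminated

/-- The local variables of an agent. -/
structure Memory where
  phase : Phase
  /-- the direction of the last attempted move -/
  dir : Side
  /-- rounds since the beginning -/
  tTime : ℕ
  /-- rounds since the present exploration procedure was called -/
  eTime : ℕ
  /-- right moves minus left moves since the start at the landmark -/
  pos : ℤ
  /-- the ring size, once a full loop around the ring has been made -/
  size : Option ℕ
  r₁ : ℕ
  r₂ : ℕ
  r₃ : ℕ
  /-- the identifier, once computed -/
  ID : Option ℕ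
  /-- the action chosen in the present round -/
  act : Act

/-- The initial values. -/
def Memory.init : Memory :=
  { phase := .initL, dir := .left, tTime := 0, eTime := 0, pos := 0, size := none,
    r₁ := 0, r₂ := 0, r₃ := 0, ID := none, act := .stay }

namespace Memory

/-- Update of the distance from the landmark and detection of a full loop. -/
def track (m : Memory) (o : Snapshot) : Memory :=
  let p := if o.moved then m.pos + m.dir.sign else m.pos
  { m with
    pos := p
    size := if m.size.isNone ∧ o.isLandmark ∧ p ≠ 0 then some p.natAbs else m.size }

/-- Continue the present exploration procedure: try to move in the direction `dir`. -/
def continue_ (m : Memory) : Memory := { m with act := .move m.dir }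

/-- Enter the state `p` and call its exploration procedure with direction `d`; the first attempt to
move takes place in the same round. -/
def enter (m : Memory) (p : Phase) (d : Side) : Memory :=
  { m with phase := p, dir := d, eTime := 0, act := .move d }

/-- Enter the state `terminated`. -/
def halt (m : Memory) : Memory := { m with phase := .terminated, act := .terminate }

/-- Enter the state `reverse` with identifier `ID`. -/
def enterReverse (m : Memory) (ID : ℕ) : Memory :=
  m.enter (.reverse m.size.isSome) (direction ID m.tTime)

/-- The state `Ready`: compute the identifier, then process the state `reverse`. -/
def ready (m : Memory) : Memory :=
  let r₂ := m.tTime - max m.r₁ m.r₃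
  let ID := interleave m.r₁ r₂ m.r₃
  enterReverse { m with r₂ := r₂, ID := some ID } ID

/-- One `Compute`, for the variables `m` and the snapshot `o`.  An agent has been waiting in a queue
exactly if it is on a port at the beginning of the round. -/
def compute (m₀ : Memory) (o : Snapshot) : Memory :=
  let m := m₀.track o
  let blocked : Bool := o.myPos.isSome
  match m.phase with
  | .caught => m
  | .terminated => m.halt
  | phase =>
    if o.isCatch then { m with phase := .caught } else
    match phase with
    | .initL =>
      if m.size.isSome then m.enter .happy m.dir
      else if blocked then { m with r₁ := m.tTime }.enter .firstBlockL .right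
      else m.continue_
    | .happy =>
      match m.size with
      | some n => if timeout n + 1 ≤ m.tTime then m.halt else m.continue_
      | none => m.continue_
    | .firstBlockL =>
      if m.size.isSome then m.enter .happy m.dir
      else if o.isLandmark && o.moved then
        let m' := { m with r₃ := m.eTime }
        if o.together then { m' with phase := .waitL, act := .stay }
        else m'.enter .atLandmarkL m.dir
      else if blocked then m.ready
      else m.continue_
    | .waitL => if o.together then m.halt else m.enter .atLandmarkL m.dir
    | .atLandmarkL =>
      if m.size.isSome then m.enter .happy m.dir
      else if blocked then m.ready
      else m.continue_
    | .reverse known =>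
      match known, m.size, m.ID with
      | true, some n, _ => if timeout n ≤ m.tTime then m.halt else m.continue_
      | false, _, some ID =>
        if direction ID m.tTime ≠ direction ID (m.tTime - 1) then m.enterReverse ID
        else m.continue_
      | _, _, _ => m.continue_
    | .caught => m
    | .terminated => m

/-- The clocks advance at the end of the round. -/
def tick (m : Memory) : Memory := { m with tTime := m.tTime + 1, eTime := m.eTime + 1 }

end Memory

/-- The local variables of an agent after it has processed the given snapshots. -/
def memory (h : List Snapshot) : Memory :=
  h.foldl (fun m o => (m.compute o).tick) Memory.init

/-- The algorithm for two agents without chirality that start at the landmark.  As long as the agents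
have not caught each other it is given by `Memory.compute`; from the round in which they catch each
other on, when they have distinct roles and a common orientation (that of the occupied port), it
follows the procedure `afterCatch`. -/
def startFromLandmarkNoChirality (afterCatch : Protocol) : Protocol := fun h =>
  match (memory h).phase with
  | .caught => afterCatch h
  | _ => (memory h).act

/-- The global direction of agent `a` in round `r` if it follows the schedule of `ID`. -/
def globalDirection {n : ℕ} (E : Environment n) (a : Agent) (ID r : ℕ) : Side :=
  (direction ID r).relabel (E.flipped a)

/-- The local variables of agent `a` after `t` rounds. -/
def memoryAt {n : ℕ} (P : Protocol) (E : Environment n) (t : ℕ) (a : Agent) : Memory :=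
  memory (execution P E t a).history

end DynamicRing

namespace DynamicRing

/-! ### Identifiers -/

/-! Before a catch, everything rests on two facts about uncaught agents: when they are together both
are off the ports, and a round in which both request the same side never leaves them together
(`Uncaught.not_together`). A denied access therefore presupposes a meeting and is followed by a
separation, so an amortised count bounds all phases before the identifier linearly
(`Uncaught.time_le`). In the phases before the return to the landmark only round 0 can bring a
denial, so displacements are exact functions of time (`disp_initL`, `disp_firstBlockL`).

Distinct identifiers (`ID_ne`): equal values of r₁, r₂, r₃ force simultaneous events. Agents that
wait simultaneously are at the two ends of the one missing edge, and the exact displacements turn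
this into a congruence modulo n. A common first block in round r gives opposite orientations and n =
2r - 1; a common second block before the landmark is then impossible; a common return to the
landmark makes both agents wait and terminate, rightly, since they have seen the whole ring
(`explored_of_waitL`).

Schedules: two distinct padded strings, stretched to the same length, have a position where they
differ and one where they agree, so for any orientations some block prescribes the same global
direction (`exists_agreement`). If both agents request one direction for 5n rounds without a catch,
at most one of them is blocked at a time and neither can pass the other, so both complete a loop
(`size_known_of_run`). Thus by time T(n) the agents have caught each other, have both terminated, or
both know n; in the last case they stop within 5 T(n) rounds (`terminated_of_uncaught`).

After a catch, one agent walks forward and the other bounces backward and returns. Their positions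
are lifted to the integers. A lifted gap of n - 1 means that the ring is explored; until then every
round of a bounce widens the gap, which gives the bouncer a credit, a lower bound for the gap. A
meeting with positive credit reveals that the gap has wrapped around. The potential posW + 4 posB +
3 credit grows in each round of the return, while positions stay within 2n of their start as long as
n is unknown; this bounds the time. The stages are invariants (`JointState.Stage`) preserved until
both agents terminate in the same round (`Joint.step`). -/

theorem spread_zero : spread 0 = 0 := by simp [spread]

theorem spread_eq (x : ℕ) : spread x = x % 2 + 8 * spread (x / 2) := by
  rcases Nat.eq_zero_or_pos x with rfl | hx
  · simp [spread]
  · unfold spread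
    rw [Nat.digits_def' (by norm_num) hx, Nat.ofDigits_cons]

/-- The extreme case consists of m binary ones, with image (8 ^ m - 1) / 7. The factor 7 = 1 + 2 + 4
is the total weight in `interleave`. -/
theorem spread_lt (m x : ℕ) (h : x < 2 ^ m) : 7 * spread x < 8 ^ m := by
  induction m generalizing x with
  | zero =>
    obtain rfl : x = 0 := by simpa using h
    simp [spread_zero]
  | succ m ih =>
    rw [spread_eq]
    have := ih (x / 2) (by rw [pow_succ] at h; omega)
    rw [pow_succ]
    omega

theorem interleave_lt {m r₁ r₂ r₃ : ℕ} (h₁ : r₁ < 2 ^ m) (h₂ : r₂ < 2 ^ m) (h₃ : r₃ < 2 ^ m) :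
    interleave r₁ r₂ r₃ < 8 ^ m := by
  have := spread_lt m _ h₁
  have := spread_lt m _ h₂
  have := spread_lt m _ h₃
  unfold interleave
  omega

theorem size_interleave_le {m r₁ r₂ r₃ : ℕ} (h₁ : r₁ < 2 ^ m) (h₂ : r₂ < 2 ^ m)
    (h₃ : r₃ < 2 ^ m) : Nat.size (interleave r₁ r₂ r₃) ≤ 3 * m := by
  rw [Nat.size_le, pow_mul]
  exact interleave_lt h₁ h₂ h₃

/-- The last octal digit of the interleaving encodes the last bits of the three numbers, so these
can be compared and halved away. -/
theorem interleave_inj {r₁ r₂ r₃ s₁ s₂ s₃ : ℕ} (h : interleave r₁ r₂ r₃ = interleave s₁ s₂ s₃) :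
    r₁ = s₁ ∧ r₂ = s₂ ∧ r₃ = s₃ := by
  induction hN : r₁ + r₂ + r₃ + s₁ + s₂ + s₃ using Nat.strong_induction_on
    generalizing r₁ r₂ r₃ s₁ s₂ s₃ with
  | _ N ih =>
  by_cases h0 : N = 0
  · omega
  · unfold interleave at h ih
    rw [spread_eq r₁, spread_eq r₂, spread_eq r₃, spread_eq s₁, spread_eq s₂, spread_eq s₃] at h
    have key := ih _ (by omega : r₁ / 2 + r₂ / 2 + r₃ / 2 + s₁ / 2 + s₂ / 2 + s₃ / 2 < N)
      (by omega : spread (r₁ / 2) + 2 * spread (r₂ / 2) + 4 * spread (r₃ / 2) =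
        spread (s₁ / 2) + 2 * spread (s₂ / 2) + 4 * spread (s₃ / 2)) rfl
    omega

theorem spread_pos {x : ℕ} (h : 0 < x) : 0 < spread x := by
  induction x using Nat.strong_induction_on with
  | _ x ih =>
    rw [spread_eq]
    by_cases h2 : x / 2 = 0
    · omega
    · have := ih (x / 2) (by omega) (by omega)
      omega

theorem interleave_pos {r₁ r₂ r₃ : ℕ} (h : 0 < r₁) : 0 < interleave r₁ r₂ r₃ := by
  have := spread_pos h
  unfold interleave
  omega

/-! ### The padded strings -/

theorem length_idString (ID : ℕ) : (idString ID).length = Nat.size ID + 3 := by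
  simp [idString, Nat.size_eq_bits_len]

theorem length_idString_le (ID : ℕ) : Nat.size ID + 3 ≤ 2 ^ basePhase ID := by
  rw [← length_idString]
  exact Nat.le_pow_clog (by norm_num) _

theorem two_pow_basePhase_lt (ID : ℕ) : 2 ^ basePhase ID < 2 * (Nat.size ID + 3) := by
  have h := Nat.pow_pred_clog_lt_self (b := 2) (by norm_num) (x := (idString ID).length)
    (by rw [length_idString]; omega)
  have hpos : 0 < basePhase ID :=
    Nat.clog_pos (by norm_num) (by rw [length_idString]; omega)
  rw [length_idString] at h
  have : 2 ^ basePhase ID = 2 * 2 ^ (basePhase ID).pred := by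
    conv_lhs => rw [← Nat.succ_pred_eq_of_pos hpos, pow_succ]
    ring
  unfold basePhase at this ⊢
  rw [length_idString] at this ⊢
  omega

theorem length_paddedString (ID : ℕ) : (paddedString ID).length = 2 ^ basePhase ID := by
  have := length_idString_le ID
  simp only [paddedString, List.length_append, List.length_replicate, length_idString]
  omega

theorem bits_injective {a b : ℕ} (h : Nat.bits a = Nat.bits b) : a = b := by
  apply Nat.eq_of_testBit_eq
  intro i
  rw [Nat.testBit_eq_inth, Nat.testBit_eq_inth, h]

theorem idString_injective {a b : ℕ} (h : idString a = idString b) : a = b := by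
  simp only [idString, List.cons_append, List.nil_append, List.cons.injEq, true_and] at h
  exact bits_injective (by simpa using List.append_cancel_right h)

/-- Since `idString` begins with a 1, deleting the leading zeros undoes the padding. -/
theorem paddedString_injective {a b : ℕ} (h : paddedString a = paddedString b) : a = b := by
  have key : ∀ ID, (paddedString ID).dropWhile (fun c => !c) = idString ID := by
    intro ID
    unfold paddedString
    rw [List.dropWhile_append_of_pos (by intro x hx; simp [List.eq_of_mem_replicate hx])]
    simp [idString]
  exact idString_injective (by rw [← key a, ← key b, h])

/-- The position of the first `1` of the padded string. -/
def firstOne (ID : ℕ) : ℕ := 2 ^ basePhase ID - (Nat.size ID + 3)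

theorem paddedString_getD_of_lt {ID c : ℕ} (h : c < firstOne ID) :
    (paddedString ID).getD c false = false := by
  unfold firstOne at h
  unfold paddedString
  rw [List.getD_append _ _ _ _ (by simpa [length_idString] using h)]
  simp

theorem paddedString_getD_add (ID c : ℕ) :
    (paddedString ID).getD (firstOne ID + c) false = (idString ID).getD c false := by
  unfold paddedString
  rw [List.getD_append_right _ _ _ _ (by simp [length_idString, firstOne])]
  simp [length_idString, firstOne]

/-- Three features of the padded string carry the schedule argument: its first 1, the 0 right after
it, and the 0 at the end. -/
theorem paddedString_firstOne (ID : ℕ) : (paddedString ID).getD (firstOne ID) false = true := by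
  have := paddedString_getD_add ID 0
  simpa [idString] using this

theorem paddedString_firstOne_succ (ID : ℕ) :
    (paddedString ID).getD (firstOne ID + 1) false = false := by
  have := paddedString_getD_add ID 1
  simpa [idString] using this

theorem paddedString_last (ID : ℕ) :
    (paddedString ID).getD (2 ^ basePhase ID - 1) false = false := by
  have h := paddedString_getD_add ID (Nat.size ID + 2)
  have h1 := length_idString_le ID
  have e : firstOne ID + (Nat.size ID + 2) = 2 ^ basePhase ID - 1 := by unfold firstOne; omega
  rw [e] at h
  rw [h]
  unfold idString
  rw [List.getD_append_right _ _ _ _ (by simp [Nat.size_eq_bits_len])]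
  simp [Nat.size_eq_bits_len]

theorem firstOne_succ_lt (ID : ℕ) : firstOne ID + 1 < 2 ^ basePhase ID := by
  have h1 := length_idString_le ID
  unfold firstOne
  omega

/-! ### The direction schedule -/

theorem dup_getD (S : List Bool) {k : ℕ} (hk : 0 < k) (q : ℕ) :
    (dup S k).getD q false = S.getD (q / k) false := by
  induction S generalizing q with
  | nil => simp [dup]
  | cons a S ih =>
    have e : dup (a :: S) k = List.replicate k a ++ dup S k := by simp [dup]
    rw [e]
    by_cases hq : q < k
    · rw [List.getD_append _ _ _ _ (by simpa using hq), List.getD_replicate _ hq,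
        Nat.div_eq_of_lt hq]
      simp
    · push Not at hq
      rw [List.getD_append_right _ _ _ _ (by simpa using hq), List.length_replicate, ih]
      have : q / k = (q - k) / k + 1 := by
        rw [Nat.div_eq_sub_div hk hq]
      rw [this]
      simp

/-- The side encoded by a character. -/
def charSide (c : Bool) : Side := if c then .right else .left

theorem direction_eq {ID j c k q : ℕ} (hj : basePhase ID < j) (hk : k = 2 ^ (j - basePhase ID))
    (hc : c < 2 ^ basePhase ID) (hq : q / k = c) :
    direction ID (2 ^ j + q) = charSide ((paddedString ID).getD c false) := by
  have hkpos : 0 < k := by rw [hk]; positivity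
  have hkk : 2 ^ basePhase ID * k = 2 ^ j := by
    rw [hk, ← pow_add]
    congr 1
    omega
  have hq' : q < 2 ^ j := by
    rw [← hkk]
    exact (Nat.div_lt_iff_lt_mul hkpos).1 (hq ▸ hc)
  have hlog : Nat.log 2 (2 ^ j + q) = j := by
    rw [Nat.log_eq_iff (Or.inr ⟨by norm_num, by have := Nat.two_pow_pos j; omega⟩)]
    constructor
    · omega
    · rw [pow_succ]; omega
  unfold direction
  simp only [hlog, Nat.add_sub_cancel_left, ← hk, dup_getD _ hkpos, hq, hj, true_and]
  rfl

/-- In each phase after the base phase, each direction is followed during a whole block. -/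
theorem exists_block (ID j : ℕ) (hj : basePhase ID < j) (s : Side) :
    ∃ u, 2 ^ j ≤ u ∧ u + 2 ^ (j - basePhase ID) ≤ 2 ^ (j + 1) ∧
      ∀ r, u ≤ r → r < u + 2 ^ (j - basePhase ID) → direction ID r = s := by
  set k := 2 ^ (j - basePhase ID) with hk
  have hkpos : 0 < k := by rw [hk]; positivity
  have hkk : 2 ^ basePhase ID * k = 2 ^ j := by
    rw [hk, ← pow_add]
    congr 1
    omega
  obtain ⟨c, hc, hcs⟩ : ∃ c < 2 ^ basePhase ID, charSide ((paddedString ID).getD c false) = s := by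
    have := firstOne_succ_lt ID
    cases s with
    | left => exact ⟨firstOne ID + 1, this, by rw [paddedString_firstOne_succ]; rfl⟩
    | right => exact ⟨firstOne ID, by omega, by rw [paddedString_firstOne]; rfl⟩
  refine ⟨2 ^ j + c * k, by omega, ?_, fun r h1 h2 => ?_⟩
  · have : (c + 1) * k ≤ 2 ^ basePhase ID * k := Nat.mul_le_mul_right _ hc
    rw [pow_succ]
    nlinarith
  · obtain ⟨q, rfl⟩ := Nat.exists_eq_add_of_le (show 2 ^ j ≤ r by omega)
    rw [direction_eq hj hk hc _, hcs]
    exact Nat.div_eq_of_lt_le (by omega) (by rw [Nat.succ_mul]; omega)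

/-- For equal base phases this is injectivity of the padding. Otherwise each character of `a` covers
B ≥ 2 characters of `b`, and the first 1 of `b`, which stands between zeros or at the start, is a
run of length one that cannot fill such a group. -/
theorem exists_ne_char {a b : ℕ} (hne : a ≠ b) (hab : basePhase a ≤ basePhase b) :
    ∃ c < 2 ^ basePhase b, (paddedString b).getD c false ≠
      (paddedString a).getD (c / 2 ^ (basePhase b - basePhase a)) false := by
  rcases hab.eq_or_lt with he | hlt
  · by_contra! hcon
    apply hne
    apply paddedString_injective
    apply List.ext_getElem
    · rw [length_paddedString, length_paddedString, he]
    · intro i h1 h2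
      have := hcon i (by rwa [length_paddedString] at h2)
      rw [he, Nat.sub_self, pow_zero, Nat.div_one] at this
      rw [List.getD_eq_getElem _ _ h1, List.getD_eq_getElem _ _ h2] at this
      exact this.symm
  · by_contra! hcon
    set B := 2 ^ (basePhase b - basePhase a) with hB
    have hB2 : 2 ≤ B := by
      rw [hB]
      calc 2 = 2 ^ 1 := by norm_num
        _ ≤ _ := Nat.pow_le_pow_right (by norm_num) (by omega)
    have hp := firstOne_succ_lt b
    have h0 := hcon (firstOne b) (by omega)
    have h1 := hcon (firstOne b + 1) hp
    rw [paddedString_firstOne] at h0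
    rw [paddedString_firstOne_succ] at h1
    by_cases hd : (firstOne b + 1) / B = firstOne b / B
    · rw [hd, ← h0] at h1
      simp at h1
    -- The 1 and the following 0 lie in different groups, so the 1 ends its group; since B ≥ 2, the
    -- preceding 0 lies in the same group.
    · have hdvd : B ∣ firstOne b + 1 := by
        by_contra hnd
        apply hd
        rw [Nat.succ_div_of_not_dvd hnd]
      obtain ⟨m, hm⟩ := hdvd
      have hmpos : 0 < m := by
        rcases Nat.eq_zero_or_pos m with rfl | h
        · simp at hm
        · exact h
      obtain ⟨m, rfl⟩ := Nat.exists_eq_add_of_le' hmpos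
      rw [Nat.mul_add, Nat.mul_one] at hm
      have e1 : firstOne b / B = m :=
        Nat.div_eq_of_lt_le (by rw [Nat.mul_comm]; omega)
          (by rw [Nat.succ_mul, Nat.mul_comm]; omega)
      have e2 : (firstOne b - 1) / B = m :=
        Nat.div_eq_of_lt_le (by rw [Nat.mul_comm]; omega)
          (by rw [Nat.succ_mul, Nat.mul_comm]; omega)
      have h2 := hcon (firstOne b - 1) (by omega)
      rw [paddedString_getD_of_lt (by omega), e2, ← e1, ← h0] at h2
      simp at h2

/-- Both strings end in 0, and the last character of the longer one falls under the last character
of the shorter one. -/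
theorem exists_eq_char {a b : ℕ} (hab : basePhase a ≤ basePhase b) :
    ∃ c < 2 ^ basePhase b, (paddedString b).getD c false =
      (paddedString a).getD (c / 2 ^ (basePhase b - basePhase a)) false := by
  have h := Nat.two_pow_pos (basePhase b)
  refine ⟨2 ^ basePhase b - 1, by omega, ?_⟩
  rw [paddedString_last]
  have hb : 2 ^ basePhase b = 2 ^ basePhase a * 2 ^ (basePhase b - basePhase a) := by
    rw [← pow_add]
    congr 1
    omega
  have ha := Nat.two_pow_pos (basePhase a)
  have hB := Nat.two_pow_pos (basePhase b - basePhase a)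
  have : (2 ^ basePhase b - 1) / 2 ^ (basePhase b - basePhase a) = 2 ^ basePhase a - 1 := by
    apply Nat.div_eq_of_lt_le
    · rw [hb, Nat.sub_mul, Nat.one_mul]
      omega
    · rw [hb, Nat.sub_add_cancel ha]
      have := Nat.mul_pos ha hB
      omega
  rw [this, paddedString_last]

theorem Side.relabel_relabel (f : Bool) (s : Side) : (s.relabel f).relabel f = s := by
  cases f <;> cases s <;> rfl

theorem relabel_charSide_eq_iff (f g c d : Bool) :
    (charSide c).relabel f = (charSide d).relabel g ↔ (c = d ↔ f = g) := by
  revert f g c d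
  decide

/-- In each phase after the base phases, the schedules of different identifiers prescribe the same
global direction during a block, whatever the orientations are. -/
theorem exists_agreement_of_le {a b : ℕ} (hne : a ≠ b) (hab : basePhase a ≤ basePhase b)
    (f g : Bool)
    {j : ℕ} (hj : basePhase b < j) :
    ∃ u, 2 ^ j ≤ u ∧ u + 2 ^ (j - basePhase b) ≤ 2 ^ (j + 1) ∧ ∃ s : Side,
      ∀ r, u ≤ r → r < u + 2 ^ (j - basePhase b) →
        (direction a r).relabel f = s ∧ (direction b r).relabel g = s := by
  set k := 2 ^ (j - basePhase b) with hk
  set B := 2 ^ (basePhase b - basePhase a) with hB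
  have hBpos : 0 < B := Nat.two_pow_pos _
  have hkpos : 0 < k := by rw [hk]; positivity
  have hkk : 2 ^ basePhase b * k = 2 ^ j := by
    rw [hk, ← pow_add]
    congr 1
    omega
  have hkB : k * B = 2 ^ (j - basePhase a) := by
    rw [hk, hB, ← pow_add]
    congr 1
    omega
  have hb : 2 ^ basePhase b = 2 ^ basePhase a * B := by
    rw [hB, ← pow_add]
    congr 1
    omega
  obtain ⟨c, hc, hcs⟩ : ∃ c < 2 ^ basePhase b,
      (charSide ((paddedString a).getD (c / B) false)).relabel f =
        (charSide ((paddedString b).getD c false)).relabel g := by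
    simp only [relabel_charSide_eq_iff]
    -- Equal orientations need equal characters, opposite orientations need different ones.
    by_cases hfg : f = g
    · obtain ⟨c, hc, h⟩ := exists_eq_char hab
      exact ⟨c, hc, by simp only [hfg, iff_true]; exact h.symm⟩
    · obtain ⟨c, hc, h⟩ := exists_ne_char hne hab
      exact ⟨c, hc, by simp only [hfg, iff_false]; exact fun e => h e.symm⟩
  refine ⟨2 ^ j + c * k, by omega, ?_,
    (charSide ((paddedString a).getD (c / B) false)).relabel f, fun r h1 h2 => ⟨?_, ?_⟩⟩
  · have : (c + 1) * k ≤ 2 ^ basePhase b * k := Nat.mul_le_mul_right _ hc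
    rw [pow_succ]
    nlinarith
  all_goals
    obtain ⟨q, rfl⟩ := Nat.exists_eq_add_of_le (show 2 ^ j ≤ r by omega)
    have hq : q / k = c := Nat.div_eq_of_lt_le (by omega) (by rw [Nat.succ_mul]; omega)
  · rw [direction_eq (c := c / B) (hab.trans_lt hj) rfl]
    · rw [hb] at hc
      exact (Nat.div_lt_iff_lt_mul hBpos).2 hc
    · rw [← hkB, ← Nat.div_div_eq_div_mul, hq]
  · rw [direction_eq hj hk hc hq, hcs]

/-! ### The first phase with long blocks -/

/-- Here J stands for the base phase of an identifier with m bits, and e for the number of further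
doublings that make the blocks at least 5n long. The bound 20n puts the phase after the computation
of the identifiers; the last bound leaves room for one more phase before the timeout. -/
theorem blocks_fit {n m J : ℕ} (hn : 3 ≤ n) (hm : m ≤ 3 * (Nat.clog 2 n + 3)) (h4 : 4 ≤ 2 ^ J)
    (hJ : 2 ^ J < 2 * (m + 3)) :
    ∃ e, 5 * n ≤ 2 ^ e ∧ 20 * n ≤ 2 ^ (J + e) ∧ 2 ^ (J + e + 2) ≤ timeout n := by
  have hc : 2 ≤ Nat.clog 2 n := by
    have := Nat.clog_mono_right 2 hn
    have h3 : Nat.clog 2 3 = 2 := by decide +kernel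
    omega
  have h1 : 5 * n ≤ 2 ^ Nat.clog 2 (5 * n) := Nat.le_pow_clog (by norm_num) _
  have h2 : 2 ^ (Nat.clog 2 (5 * n)).pred < 5 * n :=
    Nat.pow_pred_clog_lt_self (by norm_num) (by omega)
  have h3 : 2 ^ Nat.clog 2 (5 * n) = 2 * 2 ^ (Nat.clog 2 (5 * n)).pred := by
    have hpos : 0 < Nat.clog 2 (5 * n) := Nat.clog_pos (by norm_num) (by omega)
    conv_lhs => rw [← Nat.succ_pred_eq_of_pos hpos, pow_succ]
    ring
  refine ⟨Nat.clog 2 (5 * n), h1, ?_, ?_⟩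
  · rw [pow_add]
    nlinarith
  · rw [pow_add, pow_add, h3]
    unfold timeout
    have a1 : 2 ^ J ≤ 2 * (3 * Nat.clog 2 n + 11) + 1 := by omega
    have hev : 2 ^ J ≤ 2 * (3 * Nat.clog 2 n + 11) := by
      have : 2 ∣ 2 ^ J := dvd_pow_self 2 (by rintro rfl; norm_num at h4)
      omega
    -- The decisive comparison is 3c + 11 ≤ 2 (3c + 3) for c = `Nat.clog 2 n`, which holds since n ≥
    -- 3 gives c ≥ 2.
    calc 2 ^ J * (2 * 2 ^ (Nat.clog 2 (5 * n)).pred) * 2 ^ 2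
        ≤ (2 * (3 * Nat.clog 2 n + 11)) * (2 * (5 * n)) * 2 ^ 2 := by gcongr
      _ = 16 * (3 * Nat.clog 2 n + 11) * (5 * n) := by ring
      _ ≤ 32 * (3 * Nat.clog 2 n + 3) * (5 * n) := Nat.mul_le_mul_right _ (by omega)
      _ = _ := by ring

end DynamicRing

namespace DynamicRing

/-! ### One round of an execution -/

section Rounds

variable {n : ℕ} (P : Protocol) (E : Environment n)

/-- The node of an agent after `t` rounds. -/
abbrev nodeAt (t : ℕ) (a : Agent) : ZMod n := (execution P E t a).node

/-- The port held by an agent after `t` rounds. -/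
abbrev portAt (t : ℕ) (a : Agent) : Option Side := (execution P E t a).port

/-- Whether an agent moved in the round before time `t`. -/
abbrev movedAt (t : ℕ) (a : Agent) : Bool := (execution P E t a).moved

/-- The port requested by an agent in round `t`. -/
abbrev requestAt (t : ℕ) (a : Agent) : Option Side := request P E (execution P E t) a

variable {P E}

theorem intCast_eq_zero_iff {n : ℕ} (k : ℤ) : ((k : ℤ) : ZMod n) = 0 ↔ (n : ℤ) ∣ k :=
  ZMod.intCast_zmod_eq_zero_iff_dvd k n

theorem sign_ne_zero (hn : 3 ≤ n) (s : Side) : ((s.sign : ℤ) : ZMod n) ≠ 0 := by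
  rw [Ne, intCast_eq_zero_iff]
  intro h
  have := Int.le_of_dvd (by cases s <;> decide) ((Int.dvd_natAbs).2 h)
  cases s <;> simp [Side.sign] at this <;> omega

theorem edgeAt_injective {s : Side} {v w : ZMod n} (h : edgeAt v s = edgeAt w s) : v = w := by
  cases s <;> simpa [edgeAt] using h

theorem edgeAt_opp {s : Side} {v w : ZMod n} (h : edgeAt v s = edgeAt w s.opp) :
    w = v + (s.sign : ℤ) := by
  cases s <;> simp [edgeAt, Side.opp, Side.sign] at h ⊢
  · rw [← h]; ring
  · rw [h]; ring

theorem edgeAt_opp_iff {s : Side} {v w : ZMod n} :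
    edgeAt v s = edgeAt w s.opp ↔ w = v + (s.sign : ℤ) := by
  refine ⟨edgeAt_opp, ?_⟩
  rintro rfl
  cases s <;> simp [edgeAt, Side.opp, Side.sign, sub_eq_add_neg]

theorem Side.sign_opp (s : Side) : s.opp.sign = -s.sign := by cases s <;> rfl

theorem Side.eq_or_eq_opp (s s' : Side) : s' = s ∨ s' = s.opp := by
  cases s <;> cases s' <;> simp [Side.opp]

theorem Side.opp_ne (s : Side) : s.opp ≠ s := by cases s <;> simp [Side.opp]

theorem step_none {t : ℕ} {a : Agent} (h : requestAt P E t a = none) :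
    nodeAt P E (t + 1) a = nodeAt P E t a ∧ portAt P E (t + 1) a = none ∧
      movedAt P E (t + 1) a = false := by
  simp only [nodeAt, portAt, movedAt, execution, nextState]
  simp only [requestAt] at h
  rw [h]
  exact ⟨rfl, rfl, rfl⟩

/-- The outcomes of an attempt to move: success, waiting on the port, denied access. -/
theorem step_some {t : ℕ} {a : Agent} {s : Side} (h : requestAt P E t a = some s) :
    (gainsAccess P E t (execution P E t) a = true ∧
      E.missing t ≠ some (edgeAt (nodeAt P E t a) s) ∧
      nodeAt P E (t + 1) a = nodeAt P E t a + (s.sign : ℤ) ∧ portAt P E (t + 1) a = none ∧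
      movedAt P E (t + 1) a = true) ∨
    (gainsAccess P E t (execution P E t) a = true ∧
      E.missing t = some (edgeAt (nodeAt P E t a) s) ∧
      nodeAt P E (t + 1) a = nodeAt P E t a ∧ portAt P E (t + 1) a = some s ∧
      movedAt P E (t + 1) a = false) ∨
    (gainsAccess P E t (execution P E t) a = false ∧
      nodeAt P E (t + 1) a = nodeAt P E t a ∧ portAt P E (t + 1) a = none ∧
      movedAt P E (t + 1) a = false) := by
  simp only [nodeAt, portAt, movedAt, execution, nextState]
  simp only [requestAt] at h
  rw [h]
  by_cases hg : gainsAccess P E t (execution P E t) a = true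
  · by_cases hm : E.missing t = some (edgeAt (execution P E t a).node s)
    · right; left
      simp [hg, hm]
    · left
      simp [hg, hm]
  · right; right
    simp [hg]

theorem gainsAccess_of_not {t : ℕ} {a : Agent}
    (h : ¬ (nodeAt P E t (!a) = nodeAt P E t a ∧ requestAt P E t (!a) = requestAt P E t a)) :
    gainsAccess P E t (execution P E t) a = true := by
  unfold gainsAccess
  rw [if_neg h]

theorem of_portAt_succ {t : ℕ} {a : Agent} {s : Side} (h : portAt P E (t + 1) a = some s) :
    requestAt P E t a = some s ∧ gainsAccess P E t (execution P E t) a = true ∧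
      E.missing t = some (edgeAt (nodeAt P E t a) s) ∧
      nodeAt P E (t + 1) a = nodeAt P E t a ∧ movedAt P E (t + 1) a = false := by
  rcases hr : requestAt P E t a with _ | s'
  · have := (step_none hr).2.1
    rw [this] at h
    cases h
  · rcases step_some hr with h' | h' | h'
    · rw [h'.2.2.2.1] at h; cases h
    · rw [h'.2.2.2.1] at h
      cases h
      exact ⟨rfl, h'.1, h'.2.1, h'.2.2.1, h'.2.2.2.2⟩
    · rw [h'.2.2.1] at h; cases h

theorem of_movedAt_succ {t : ℕ} {a : Agent} (h : movedAt P E (t + 1) a = true) :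
    ∃ s, requestAt P E t a = some s ∧ gainsAccess P E t (execution P E t) a = true ∧
      E.missing t ≠ some (edgeAt (nodeAt P E t a) s) ∧
      nodeAt P E (t + 1) a = nodeAt P E t a + (s.sign : ℤ) ∧ portAt P E (t + 1) a = none := by
  rcases hr : requestAt P E t a with _ | s'
  · have := (step_none hr).2.2
    rw [this] at h
    cases h
  · rcases step_some hr with h' | h' | h'
    · exact ⟨s', rfl, h'.1, h'.2.1, h'.2.2.1, h'.2.2.2.1⟩
    · rw [h'.2.2.2.2] at h; cases h
    · rw [h'.2.2.2] at h; cases h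

/-- Agents at the same node that request the same port do not both obtain it. -/
theorem not_both_gain_aux {t : ℕ} {a : Agent}
    (hp : ¬ (portAt P E t a = requestAt P E t a ∧ portAt P E t (!a) = requestAt P E t a))
    (hnode : nodeAt P E t (!a) = nodeAt P E t a)
    (hreq : requestAt P E t (!a) = requestAt P E t a) :
    gainsAccess P E t (execution P E t) a = !(gainsAccess P E t (execution P E t) (!a)) := by
  simp only [nodeAt, portAt, requestAt] at hp hnode hreq
  simp only [gainsAccess, hnode, hreq, Bool.not_not, and_self, if_true]
  by_cases h1 : (execution P E t a).port = request P E (execution P E t) a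
  · have h2 : ¬ (execution P E t (!a)).port = request P E (execution P E t) a :=
      fun h2 => hp ⟨h1, h2⟩
    simp [h1, h2]
  · by_cases h2 : (execution P E t (!a)).port = request P E (execution P E t) a
    · simp [h1, h2]
    · simp only [h1, h2, if_false]
      generalize E.priority t = p
      revert p a
      intro a
      cases a <;> simp

/-- A port is held by at most one agent. -/
theorem port_exclusive (t : ℕ) (a : Agent) (s : Side) (hnode : nodeAt P E t (!a) = nodeAt P E t a)
    (h₁ : portAt P E t a = some s) (h₂ : portAt P E t (!a) = some s) : False := by
  -- Two holders at time t + 1 both had access in round t, which `not_both_gain_aux` excludes unless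
  -- both already held the port at time t.
  induction t with
  | zero => cases h₁
  | succ t ih =>
    obtain ⟨r₁, g₁, m₁, n₁, -⟩ := of_portAt_succ h₁
    obtain ⟨r₂, g₂, m₂, n₂, -⟩ := of_portAt_succ h₂
    have hn' : nodeAt P E t (!a) = nodeAt P E t a := by rw [← n₁, ← n₂]; exact hnode
    have := not_both_gain_aux (fun h => ih hn' (h.1.trans r₁) (h.2.trans r₁)) hn'
      (r₂.trans r₁.symm)
    rw [g₁, g₂] at this
    cases this

theorem not_both_gain {t : ℕ} {a : Agent} {s : Side}
    (hnode : nodeAt P E t (!a) = nodeAt P E t a)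
    (h₁ : requestAt P E t a = some s) (h₂ : requestAt P E t (!a) = some s) :
    gainsAccess P E t (execution P E t) a = !(gainsAccess P E t (execution P E t) (!a)) :=
  not_both_gain_aux (fun h => port_exclusive t a s hnode (h.1.trans h₁) (h.2.trans h₁)) hnode
    (h₂.trans h₁.symm)

/-- Agents that wait at the same time are at the two ends of the missing edge. -/
theorem of_both_on_port {t : ℕ} {a : Agent} {s s' : Side} (h₁ : portAt P E t a = some s)
    (h₂ : portAt P E t (!a) = some s') :
    s' = s.opp ∧ nodeAt P E t (!a) = nodeAt P E t a + (s.sign : ℤ) := by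
  cases t with
  | zero => cases h₁
  | succ t =>
    obtain ⟨r₁, g₁, m₁, n₁, -⟩ := of_portAt_succ h₁
    obtain ⟨r₂, g₂, m₂, n₂, -⟩ := of_portAt_succ h₂
    have he : edgeAt (nodeAt P E t a) s = edgeAt (nodeAt P E t (!a)) s' := by
      rw [m₁] at m₂
      exact Option.some.inj m₂
    rcases Side.eq_or_eq_opp s s' with rfl | rfl
    · exfalso
      have hn' := edgeAt_injective he
      exact port_exclusive (t + 1) a _ (by rw [n₁, n₂, hn']) h₁ h₂
    · exact ⟨rfl, by rw [n₁, n₂]; exact edgeAt_opp he⟩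

/-- Two waiting agents are at the two ends of the missing edge, which are distinct nodes. -/
theorem not_both_on_port (hn : 3 ≤ n) {t : ℕ} {a : Agent}
    (hnode : nodeAt P E t (!a) = nodeAt P E t a) :
    portAt P E t a = none ∨ portAt P E t (!a) = none := by
  rcases h₁ : portAt P E t a with _ | s
  · exact Or.inl rfl
  · rcases h₂ : portAt P E t (!a) with _ | s'
    · exact Or.inr rfl
    · have := (of_both_on_port h₁ h₂).2
      rw [hnode] at this
      exact absurd (left_eq_add.1 this) (sign_ne_zero hn s)

/-- After a round in which both agents tried to move in the same direction, they are not
together in the interior of a node. -/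
theorem not_together_of_request_eq (hn : 3 ≤ n) {t : ℕ} {a : Agent} {s : Side}
    (h₁ : requestAt P E t a = some s) (h₂ : requestAt P E t (!a) = some s)
    (hnode : nodeAt P E (t + 1) (!a) = nodeAt P E (t + 1) a)
    (p₁ : portAt P E (t + 1) a = none) (p₂ : portAt P E (t + 1) (!a) = none) : False := by
  have hs := sign_ne_zero hn s
  -- From a common node exactly one agent gets the port, and then leaves or holds it. From distinct
  -- nodes both get their ports, and if neither is blocked they are translated alike.
  by_cases hnode' : nodeAt P E t (!a) = nodeAt P E t a
  · have hg := not_both_gain hnode' h₁ h₂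
    rcases step_some h₁ with h | h | h <;> rcases step_some h₂ with h' | h' | h'
    · rw [h.1, h'.1] at hg; cases hg
    · rw [h.1, h'.1] at hg; cases hg
    · rw [h.2.2.1, h'.2.1, hnode'] at hnode
      exact hs (left_eq_add.1 hnode)
    · rw [h.2.2.2.1] at p₁; cases p₁
    · rw [h.2.2.2.1] at p₁; cases p₁
    · rw [h.2.2.2.1] at p₁; cases p₁
    · rw [h.2.1, h'.2.2.1, hnode'] at hnode
      exact hs (left_eq_add.1 hnode.symm)
    · rw [h'.2.2.2.1] at p₂; cases p₂
    · rw [h.1, h'.1] at hg; cases hg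
  · have g₁ : gainsAccess P E t (execution P E t) a = true :=
      gainsAccess_of_not fun h => hnode' h.1
    have g₂ : gainsAccess P E t (execution P E t) (!a) = true :=
      gainsAccess_of_not fun h => hnode' (by rw [Bool.not_not] at h; exact h.1.symm)
    rcases step_some h₁ with h | h | h <;> rcases step_some h₂ with h' | h' | h'
    · rw [h.2.2.1, h'.2.2.1] at hnode
      exact hnode' (add_right_cancel hnode)
    · rw [h'.2.2.2.1] at p₂; cases p₂
    · rw [h'.1] at g₂; cases g₂
    · rw [h.2.2.2.1] at p₁; cases p₁
    · rw [h.2.2.2.1] at p₁; cases p₁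
    · rw [h.2.2.2.1] at p₁; cases p₁
    · rw [h.1] at g₁; cases g₁
    · rw [h.1] at g₁; cases g₁
    · rw [h.1] at g₁; cases g₁

/-- An agent can be denied access only by the other agent, which then holds the port or has left. -/
theorem of_denied (hn : 3 ≤ n) {t : ℕ} {a : Agent} {s : Side} (h₁ : requestAt P E t a = some s)
    (hg : gainsAccess P E t (execution P E t) a = false) :
    nodeAt P E t (!a) = nodeAt P E t a ∧ requestAt P E t (!a) = some s ∧
      gainsAccess P E t (execution P E t) (!a) = true ∧
      (portAt P E (t + 1) (!a) = some s ∨ nodeAt P E (t + 1) (!a) ≠ nodeAt P E (t + 1) a) := by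
  have h : nodeAt P E t (!a) = nodeAt P E t a ∧ requestAt P E t (!a) = requestAt P E t a := by
    by_contra h
    rw [gainsAccess_of_not h] at hg
    cases hg
  have h₂ := h.2.trans h₁
  have hg' := not_both_gain h.1 h₁ h₂
  rw [hg] at hg'
  have hg'' : gainsAccess P E t (execution P E t) (!a) = true := by simpa using hg'.symm
  refine ⟨h.1, h₂, hg'', ?_⟩
  rcases step_some h₁ with h' | h' | h'
  · rw [hg] at h'; cases h'.1
  · rw [hg] at h'; cases h'.1
  · rcases step_some h₂ with h3 | h3 | h3
    · right
      rw [h'.2.1, h3.2.2.1, h.1]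
      exact fun e => sign_ne_zero hn s (left_eq_add.1 e.symm)
    · exact Or.inl h3.2.2.2.1
    · rw [hg''] at h3; cases h3.1

theorem history_succ (t : ℕ) (a : Agent) : (execution P E (t + 1) a).history =
    (execution P E t a).history ++ [look E (execution P E t) a] := by
  simp only [execution, nextState]
  split
  · rfl
  · split
    · split <;> rfl
    · rfl

theorem terminated_succ (t : ℕ) (a : Agent) : (execution P E (t + 1) a).terminated = true ↔
    compute P E (execution P E t) a = .terminate := by
  simp only [execution, nextState]
  split
  · simp only
    split <;> simp_all
  · split
    · split
      · simp only
        split <;> simp_all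
      · simp only
        split <;> simp_all
    · simp only
      split <;> simp_all

theorem terminated_mono_succ {t : ℕ} {a : Agent} (h : (execution P E t a).terminated = true) :
    (execution P E (t + 1) a).terminated = true := by
  rw [terminated_succ, compute, if_pos h]

theorem terminated_mono {t t' : ℕ} (htt : t ≤ t') {a : Agent}
    (h : (execution P E t a).terminated = true) : (execution P E t' a).terminated = true := by
  induction htt with
  | refl => exact h
  | step _ ih => exact terminated_mono_succ ih

theorem ExploredBy.mono {t t' : ℕ} (htt : t ≤ t') (h : ExploredBy P E t) : ExploredBy P E t' := by
  intro v
  obtain ⟨s, hs, a, ha⟩ := h v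
  exact ⟨s, hs.trans htt, a, ha⟩

end Rounds

end DynamicRing

namespace DynamicRing

/-! ### One `Compute` of the algorithm -/

namespace Memory

@[simp] theorem track_phase (m : Memory) (o : Snapshot) : (m.track o).phase = m.phase := rfl
@[simp] theorem track_dir (m : Memory) (o : Snapshot) : (m.track o).dir = m.dir := rfl
@[simp] theorem track_tTime (m : Memory) (o : Snapshot) : (m.track o).tTime = m.tTime := rfl
@[simp] theorem track_eTime (m : Memory) (o : Snapshot) : (m.track o).eTime = m.eTime := rfl
@[simp] theorem track_r₁ (m : Memory) (o : Snapshot) : (m.track o).r₁ = m.r₁ := rfl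
@[simp] theorem track_r₃ (m : Memory) (o : Snapshot) : (m.track o).r₃ = m.r₃ := rfl
@[simp] theorem track_ID (m : Memory) (o : Snapshot) : (m.track o).ID = m.ID := rfl

variable {m : Memory} {o : Snapshot}

theorem compute_caught (hp : m.phase = .caught) : m.compute o = m.track o := by
  simp [compute, hp]

theorem compute_terminated (hp : m.phase = .terminated) : m.compute o = (m.track o).halt := by
  simp [compute, hp]

theorem compute_catch (h₁ : m.phase ≠ .caught) (h₂ : m.phase ≠ .terminated)
    (hc : o.isCatch = true) : m.compute o = { m.track o with phase := .caught } := by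
  rcases hp : m.phase <;> simp_all [compute]

theorem compute_firstBlockL (hp : m.phase = .firstBlockL) (hc : o.isCatch = false) :
    m.compute o = if (m.track o).size.isSome then (m.track o).enter .happy m.dir
      else if o.isLandmark && o.moved then
        if o.together then { m.track o with r₃ := m.eTime, phase := .waitL, act := .stay }
        else { m.track o with r₃ := m.eTime }.enter .atLandmarkL m.dir
      else if o.myPos.isSome then (m.track o).ready
      else (m.track o).continue_ := by
  simp [compute, hp, hc]

theorem compute_waitL (hp : m.phase = .waitL) (hc : o.isCatch = false) :
    m.compute o = if o.together then (m.track o).halt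
      else (m.track o).enter .atLandmarkL m.dir := by
  simp [compute, hp, hc]

theorem compute_happy (hp : m.phase = .happy) (hc : o.isCatch = false) {n : ℕ}
    (hs : (m.track o).size = some n) :
    m.compute o = if timeout n + 1 ≤ m.tTime then (m.track o).halt
      else (m.track o).continue_ := by
  simp [compute, hp, hc, hs]

theorem compute_reverse_true (hp : m.phase = .reverse true) (hc : o.isCatch = false) {n : ℕ}
    (hs : (m.track o).size = some n) :
    m.compute o = if timeout n ≤ m.tTime then (m.track o).halt
      else (m.track o).continue_ := by
  simp only [compute, track_phase, hp, hc, hs, track_tTime, Bool.false_eq_true, if_false]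
  rfl

theorem compute_reverse_false (hp : m.phase = .reverse false) (hc : o.isCatch = false) {i : ℕ}
    (hi : m.ID = some i) :
    m.compute o = if direction i m.tTime ≠ direction i (m.tTime - 1) then
        (m.track o).enterReverse i
      else (m.track o).continue_ := by
  simp only [compute, track_phase, hp, hc, track_ID, hi, track_tTime, Bool.false_eq_true, if_false]
  rfl

@[simp] theorem track_compute_pos : (m.compute o).pos = (m.track o).pos := by
  unfold compute
  simp only [enter, halt, continue_, ready, enterReverse, track_phase]
  repeat' first | rfl | split

@[simp] theorem track_compute_size : (m.compute o).size = (m.track o).size := by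
  unfold compute
  simp only [enter, halt, continue_, ready, enterReverse, track_phase]
  repeat' first | rfl | split

@[simp] theorem compute_tTime : (m.compute o).tTime = m.tTime := by
  unfold compute
  simp only [enter, halt, continue_, ready, enterReverse, track_phase]
  repeat' first | rfl | split

/-- The action chosen by an agent that has not been caught. -/
theorem compute_act (h : (m.compute o).phase ≠ .caught) :
    ((m.compute o).phase ≠ .terminated ∧ (m.compute o).phase ≠ .waitL ∧
      (m.compute o).act = .move (m.compute o).dir) ∨
    ((m.compute o).phase = .terminated ∧ (m.compute o).act = .terminate) ∨
    ((m.compute o).phase = .waitL ∧ (m.compute o).act = .stay) := by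
  revert h
  unfold compute
  simp only [enter, halt, continue_, ready, enterReverse, track_phase]
  repeat' split
  all_goals simp_all

theorem compute_phase_ne_caught (h : (m.compute o).phase ≠ .caught) :
    m.phase ≠ .caught ∧ (m.phase = .terminated ∨ o.isCatch = false) := by
  by_cases h₁ : m.phase = .caught
  · rw [compute_caught h₁] at h
    exact absurd h₁ h
  · refine ⟨h₁, ?_⟩
    by_contra hcon
    push Not at hcon
    have hc : o.isCatch = true := by simpa using hcon.2
    rw [compute_catch h₁ hcon.1 hc] at h
    exact h rfl

@[simp] theorem tick_phase : m.tick.phase = m.phase := rfl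
@[simp] theorem tick_dir : m.tick.dir = m.dir := rfl
@[simp] theorem tick_tTime : m.tick.tTime = m.tTime + 1 := rfl
@[simp] theorem tick_eTime : m.tick.eTime = m.eTime + 1 := rfl
@[simp] theorem tick_pos : m.tick.pos = m.pos := rfl
@[simp] theorem tick_size : m.tick.size = m.size := rfl
@[simp] theorem tick_r₁ : m.tick.r₁ = m.r₁ := rfl
@[simp] theorem tick_r₃ : m.tick.r₃ = m.r₃ := rfl
@[simp] theorem tick_ID : m.tick.ID = m.ID := rfl
@[simp] theorem tick_act : m.tick.act = m.act := rfl

end Memory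

/-! ### Executions of the algorithm: actions, dead reckoning and the discovery of the ring size. -/

section Run

variable {n : ℕ} (K : Protocol) (E : Environment n)

/-- The protocol that follows `K` once the agents have caught each other. -/
local notation "Alg" => startFromLandmarkNoChirality

/-- The memory of an agent after `t` rounds. -/
abbrev mem (t : ℕ) (a : Agent) : Memory := memoryAt (Alg K) E t a

/-- What an agent sees in round `t`. -/
abbrev view (t : ℕ) (a : Agent) : Snapshot := look E (execution (Alg K) E t) a

/-- The displacement of an agent after `t` rounds, in its private orientation. -/
def disp (t : ℕ) (a : Agent) : ℤ := ((mem K E t a).track (view K E t a)).pos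

/-- The sign of the private orientation. -/
def orient (a : Agent) : ℤ := (Side.right.relabel (E.flipped a)).sign

variable {K E}

theorem mem_zero (a : Agent) : mem K E 0 a = Memory.init := rfl

theorem mem_succ (t : ℕ) (a : Agent) :
    mem K E (t + 1) a = ((mem K E t a).compute (view K E t a)).tick := by
  simp only [mem, memoryAt, memory]
  rw [history_succ, List.foldl_append]
  rfl

/-- The stored position lags by a round: a move is entered only by the `Compute` after the next
`Look`, which `disp` anticipates. -/
theorem mem_succ_pos (t : ℕ) (a : Agent) : (mem K E (t + 1) a).pos = disp K E t a := by
  rw [mem_succ]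
  simp [disp]

theorem mem_tTime (t : ℕ) (a : Agent) : (mem K E t a).tTime = t := by
  induction t with
  | zero => rfl
  | succ t ih => rw [mem_succ]; simp [ih]

theorem disp_eq (t : ℕ) (a : Agent) : disp K E t a =
    (mem K E t a).pos + if movedAt (Alg K) E t a then (mem K E t a).dir.sign else 0 := by
  change (if movedAt (Alg K) E t a = true then _ else _) = _
  split <;> simp

theorem size_succ (t : ℕ) (a : Agent) : (mem K E (t + 1) a).size =
    if (mem K E t a).size = none ∧ nodeAt (Alg K) E t a = E.landmark ∧ disp K E t a ≠ 0
    then some (disp K E t a).natAbs else (mem K E t a).size := by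
  rw [mem_succ]
  simp only [Memory.tick_size, Memory.track_compute_size, disp]
  simp only [Memory.track, view, look, nodeAt, Option.isNone_iff_eq_none, decide_eq_true_eq]

theorem phase_ne_caught_of_succ {t : ℕ} {a : Agent} (h : (mem K E (t + 1) a).phase ≠ .caught) :
    (mem K E t a).phase ≠ .caught := by
  rw [mem_succ, Memory.tick_phase] at h
  exact (Memory.compute_phase_ne_caught h).1

theorem phase_ne_caught_of_le {t t' : ℕ} (htt : t ≤ t') {a : Agent}
    (h : (mem K E t' a).phase ≠ .caught) : (mem K E t a).phase ≠ .caught := by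
  induction htt with
  | refl => exact h
  | step _ ih => exact ih (phase_ne_caught_of_succ h)

theorem isCatch_eq_false {t : ℕ} {a : Agent} (h : (mem K E (t + 1) a).phase ≠ .caught)
    (ht : (mem K E t a).phase ≠ .terminated) : (view K E t a).isCatch = false := by
  rw [mem_succ, Memory.tick_phase] at h
  exact (Memory.compute_phase_ne_caught h).2.resolve_left ht

theorem compute_eq {t : ℕ} {a : Agent} (h : (mem K E (t + 1) a).phase ≠ .caught)
    (hT : (execution (Alg K) E t a).terminated = false) :
    compute (Alg K) E (execution (Alg K) E t) a = (mem K E (t + 1) a).act := by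
  have hm : memory ((execution (Alg K) E t a).history ++ [look E (execution (Alg K) E t) a]) =
      mem K E (t + 1) a := by
    rw [mem, memoryAt, history_succ]
  unfold compute
  rw [hT]
  simp only [Bool.false_eq_true, if_false, startFromLandmarkNoChirality, hm]

theorem terminated_iff {t : ℕ} {a : Agent} (h : (mem K E t a).phase ≠ .caught) :
    (execution (Alg K) E t a).terminated = true ↔ (mem K E t a).phase = .terminated := by
  induction t with
  | zero => simp [execution, initialConfig, mem_zero, Memory.init]
  | succ t ih =>
    have ih' := ih (phase_ne_caught_of_succ h)
    by_cases hT : (execution (Alg K) E t a).terminated = true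
    · have := ih'.1 hT
      simp only [terminated_mono_succ hT, true_iff]
      rw [mem_succ, Memory.tick_phase, Memory.compute_terminated this]
      rfl
    · rw [terminated_succ, compute_eq h (by simpa using hT)]
      rw [mem_succ] at h ⊢
      rcases Memory.compute_act (m := mem K E t a) (o := view K E t a) h with h' | h' | h' <;>
        simp [h'.1, h'.2]

theorem request_of_phase {t : ℕ} {a : Agent} (h : (mem K E (t + 1) a).phase ≠ .caught)
    (h₁ : (mem K E (t + 1) a).phase ≠ .terminated) (h₂ : (mem K E (t + 1) a).phase ≠ .waitL) :
    requestAt (Alg K) E t a = some ((mem K E (t + 1) a).dir.relabel (E.flipped a)) := by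
  have hT : ¬ (execution (Alg K) E t a).terminated = true :=
    fun hT => h₁ ((terminated_iff h).1 (terminated_mono_succ hT))
  simp only [requestAt, request]
  rw [compute_eq h (by simpa using hT)]
  rw [mem_succ] at h h₁ h₂ ⊢
  rcases Memory.compute_act (m := mem K E t a) (o := view K E t a) h with h' | h' | h'
  · simp only [Memory.tick_act, h'.2.2, Memory.tick_dir]
  · exact absurd h'.1 h₁
  · exact absurd h'.1 h₂

theorem request_eq_none {t : ℕ} {a : Agent} (h : (mem K E (t + 1) a).phase ≠ .caught)
    (h₁ : (mem K E (t + 1) a).phase = .terminated ∨ (mem K E (t + 1) a).phase = .waitL) :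
    requestAt (Alg K) E t a = none := by
  simp only [requestAt, request]
  by_cases hT : (execution (Alg K) E t a).terminated = true
  · simp [compute, hT]
  · rw [compute_eq h (by simpa using hT)]
    rw [mem_succ] at h h₁ ⊢
    rcases Memory.compute_act (m := mem K E t a) (o := view K E t a) h with h' | h' | h'
    · exact absurd h₁ (by simp [h'.1, h'.2.1])
    · simp [h'.2]
    · simp [h'.2]

theorem of_request_eq_some {t : ℕ} {a : Agent} {s : Side}
    (h : (mem K E (t + 1) a).phase ≠ .caught) (hr : requestAt (Alg K) E t a = some s) :
    s = (mem K E (t + 1) a).dir.relabel (E.flipped a) ∧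
      (mem K E (t + 1) a).phase ≠ .terminated ∧ (mem K E (t + 1) a).phase ≠ .waitL := by
  have h₁ : ¬ ((mem K E (t + 1) a).phase = .terminated ∨ (mem K E (t + 1) a).phase = .waitL) := by
    intro h₁
    rw [request_eq_none h h₁] at hr
    cases hr
  push Not at h₁
  rw [request_of_phase h h₁.1 h₁.2] at hr
  exact ⟨(Option.some.inj hr).symm, h₁⟩

theorem sign_relabel (s : Side) (a : Agent) :
    (s.relabel (E.flipped a)).sign = orient E a * s.sign := by
  unfold orient
  cases E.flipped a <;> cases s <;> rfl

theorem orient_sq (a : Agent) : orient E a * orient E a = 1 := by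
  unfold orient
  cases E.flipped a <;> rfl

theorem orient_cast_sq (a : Agent) : ((orient E a : ℤ) : ZMod n) * (orient E a : ℤ) = 1 := by
  have := congrArg (Int.cast : ℤ → ZMod n) (orient_sq (E := E) a)
  simpa using this

/-- The port that an agent holds is the one through which it tries to leave. -/
theorem port_eq {t : ℕ} {a : Agent} (h : (mem K E t a).phase ≠ .caught) {g : Side}
    (hg : portAt (Alg K) E t a = some g) : g = (mem K E t a).dir.relabel (E.flipped a) := by
  cases t with
  | zero => cases hg
  | succ t =>
    exact (of_request_eq_some h (of_portAt_succ hg).1).1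

theorem disp_succ {t : ℕ} {a : Agent} : disp K E (t + 1) a = disp K E t a +
    if movedAt (Alg K) E (t + 1) a then (mem K E (t + 1) a).dir.sign else 0 := by
  rw [disp_eq, mem_succ_pos]

/-- Dead reckoning is correct. -/
theorem node_eq {t : ℕ} {a : Agent} (h : (mem K E t a).phase ≠ .caught) :
    nodeAt (Alg K) E t a = E.landmark + ((orient E a * disp K E t a : ℤ) : ZMod n) := by
  induction t with
  | zero =>
    simp [disp_eq, mem_zero, Memory.init, nodeAt, movedAt, execution, initialConfig]
  | succ t ih =>
    have ih' := ih (phase_ne_caught_of_succ h)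
    rw [disp_succ]
    by_cases hm : movedAt (Alg K) E (t + 1) a = true
    · obtain ⟨s, hr, -, -, hnode, -⟩ := of_movedAt_succ hm
      rw [hnode, ih', (of_request_eq_some h hr).1, sign_relabel, if_pos hm]
      push_cast
      ring
    · rw [if_neg hm, add_zero, ← ih']
      rcases hr : requestAt (Alg K) E t a with _ | s
      · exact (step_none hr).1
      · rcases step_some hr with h' | h' | h'
        · exact absurd h'.2.2.2.2 hm
        · exact h'.2.2.1
        · exact h'.2.1

/-- A discrete intermediate value argument: the displacement starts at 0 and changes by at most one
per round. -/
theorem disp_visited {t : ℕ} {a : Agent} (h : (mem K E t a).phase ≠ .caught) (k : ℤ)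
    (hk : (0 ≤ k ∧ k ≤ disp K E t a) ∨ (disp K E t a ≤ k ∧ k ≤ 0)) :
    ∃ s ≤ t, nodeAt (Alg K) E s a = E.landmark + ((orient E a * k : ℤ) : ZMod n) := by
  induction t with
  | zero =>
    have h0 : disp K E 0 a = 0 := by
      simp [disp_eq, mem_zero, Memory.init, movedAt, execution, initialConfig]
    rw [h0] at hk
    obtain rfl : k = 0 := by omega
    exact ⟨0, le_rfl, by rw [node_eq h, h0]⟩
  | succ t ih =>
    by_cases he : k = disp K E (t + 1) a
    · exact ⟨t + 1, le_rfl, by rw [node_eq h, he]⟩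
    · have hd : disp K E (t + 1) a = disp K E t a ∨ disp K E (t + 1) a = disp K E t a + 1 ∨
          disp K E (t + 1) a = disp K E t a - 1 := by
        rw [disp_succ]
        split
        · cases (mem K E (t + 1) a).dir
          · exact Or.inr (Or.inr rfl)
          · exact Or.inr (Or.inl rfl)
        · left; simp
      obtain ⟨s, hs, hs'⟩ := ih (phase_ne_caught_of_succ h) (by omega)
      exact ⟨s, by omega, hs'⟩

/-- Every residue has a representative in every interval of length `n`. -/
theorem exists_int_rep (hn : 3 ≤ n) (x : ZMod n) (lo : ℤ) :
    ∃ k : ℤ, lo ≤ k ∧ k < lo + n ∧ ((k : ℤ) : ZMod n) = x := by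
  have : NeZero n := ⟨by omega⟩
  refine ⟨lo + (x - lo).val, by omega, ?_, ?_⟩
  · have := ZMod.val_lt (x - (lo : ZMod n))
    omega
  · push_cast
    rw [ZMod.natCast_zmod_val]
    ring

theorem node_eq_landmark_iff {t : ℕ} {a : Agent} (h : (mem K E t a).phase ≠ .caught) :
    nodeAt (Alg K) E t a = E.landmark ↔ (n : ℤ) ∣ disp K E t a := by
  rw [node_eq h, add_eq_left, intCast_eq_zero_iff]
  constructor
  · intro hd
    have := hd.mul_left (orient E a)
    rwa [← mul_assoc, orient_sq, one_mul] at this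
  · exact fun hd => hd.mul_left _

/-- The landmark lies at the multiples of n. The displacement, changing by unit steps, would have to
pass through n or -n, where the ring size is recorded. -/
theorem abs_disp_lt (hn : 3 ≤ n) {t : ℕ} {a : Agent} (h : (mem K E t a).phase ≠ .caught)
    (hs : (mem K E (t + 1) a).size = none) : |disp K E t a| < n := by
  induction t with
  | zero => simp [disp_eq, mem_zero, Memory.init, movedAt, execution, initialConfig]; omega
  | succ t ih =>
    rw [size_succ] at hs
    split at hs
    · cases hs
    · rename_i hc
      have ih' := ih (phase_ne_caught_of_succ h) hs
      have hle : |disp K E (t + 1) a| ≤ n := by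
        rw [disp_succ]
        rw [abs_lt] at ih'
        rw [abs_le]
        split
        · cases (mem K E (t + 1) a).dir <;> simp only [Side.sign] <;> omega
        · omega
      rw [node_eq_landmark_iff h] at hc
      refine lt_of_le_of_ne hle fun he => hc ⟨hs, ?_, ?_⟩
      · rw [← dvd_abs, he]
      · intro h0
        rw [h0] at he
        simp at he
        omega

/-- Until the discovery the displacement is less than n in absolute value, so the first non-zero
multiple of n that it reaches is n or -n. All displacements between 0 and this value have then
occurred, which covers the ring. -/
theorem size_eq (hn : 3 ≤ n) {t : ℕ} {a : Agent} (h : (mem K E t a).phase ≠ .caught) {s : ℕ}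
    (hs : (mem K E (t + 1) a).size = some s) : s = n ∧ ExploredBy (Alg K) E t := by
  induction t with
  | zero =>
    rw [size_succ] at hs
    simp [disp_eq, mem_zero, Memory.init, movedAt, execution, initialConfig] at hs
  | succ t ih =>
    rw [size_succ] at hs
    split at hs
    · rename_i hc
      have hlt := abs_disp_lt hn (phase_ne_caught_of_succ h) hc.1
      have hle : |disp K E (t + 1) a| ≤ n := by
        rw [disp_succ]
        rw [abs_lt] at hlt
        rw [abs_le]
        split
        · cases (mem K E (t + 1) a).dir <;> simp only [Side.sign] <;> omega
        · omega
      have hdvd := (node_eq_landmark_iff h).1 hc.2.1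
      have habs : |disp K E (t + 1) a| = n :=
        le_antisymm hle (Int.le_of_dvd (abs_pos.2 hc.2.2) ((dvd_abs _ _).2 hdvd))
      refine ⟨?_, fun v => ?_⟩
      · have := Option.some.inj hs
        have := (Int.natCast_natAbs _).trans habs
        omega
      · obtain ⟨k, h1, h2, h3⟩ := exists_int_rep hn
          (((orient E a : ℤ) : ZMod n) * (v - E.landmark)) (min 0 (disp K E (t + 1) a))
        obtain ⟨s, hs, hs'⟩ := disp_visited h k (by
          rcases abs_cases (disp K E (t + 1) a) with h' | h' <;> omega)
        refine ⟨s, hs, a, ?_⟩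
        rw [show (execution (Alg K) E s a).node = nodeAt (Alg K) E s a from rfl, hs']
        push_cast
        rw [h3, ← mul_assoc, orient_cast_sq]
        ring
    · have := ih (phase_ne_caught_of_succ h) hs
      exact ⟨this.1, this.2.mono (Nat.le_succ t)⟩

theorem size_mono {t t' : ℕ} (htt : t ≤ t') {a : Agent} (hs : (mem K E t' a).size = none) :
    (mem K E t a).size = none := by
  induction htt with
  | refl => exact hs
  | step _ ih =>
    apply ih
    rw [size_succ] at hs
    split at hs
    · cases hs
    · exact hs

end Run

end DynamicRing

namespace DynamicRing

/-! ### Backward analysis of `Compute`: the phases from which a phase can be entered, and the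
invariants of the variables. -/

namespace Memory

variable {m : Memory} {o : Snapshot}

theorem into_initL (h : (m.compute o).phase = .initL) :
    m.phase = .initL ∧ o.myPos = none ∧ m.compute o = (m.track o).continue_ ∧
      (m.compute o).size = none := by
  have hc := (compute_phase_ne_caught (m := m) (o := o) (by rw [h]; simp)).2
  rcases hp : m.phase with _ | _ | _ | _ | _ | k | _ | _
  all_goals
    simp only [track_compute_size]
    simp only [compute, track_phase, hp] at h hc ⊢
    try simp only [ready, enterReverse, enter, halt, continue_] at h ⊢
    repeat' first | contradiction | split at h
    all_goals simp_all [Option.isSome_iff_ne_none]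

theorem into_firstBlockL (h : (m.compute o).phase = .firstBlockL) :
    (m.phase = .initL ∧ o.myPos ≠ none ∧ (m.compute o).size = none ∧
      m.compute o = { m.track o with r₁ := m.tTime }.enter .firstBlockL .right) ∨
    (m.phase = .firstBlockL ∧ o.myPos = none ∧ (o.isLandmark && o.moved) = false ∧
      (m.compute o).size = none ∧ m.compute o = (m.track o).continue_) := by
  have hc := (compute_phase_ne_caught (m := m) (o := o) (by rw [h]; simp)).2
  rcases hp : m.phase with _ | _ | _ | _ | _ | k | _ | _
  all_goals
    simp only [track_compute_size]
    simp only [compute, track_phase, hp] at h hc ⊢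
    try simp only [ready, enterReverse, enter, halt, continue_] at h ⊢
    repeat' first | contradiction | split at h
    all_goals simp_all [Option.isSome_iff_ne_none]

theorem into_waitL (h : (m.compute o).phase = .waitL) :
    m.phase = .firstBlockL ∧ o.isLandmark = true ∧ o.moved = true ∧ o.together = true ∧
      (m.compute o).size = none ∧
      m.compute o = { m.track o with r₃ := m.eTime, phase := .waitL, act := .stay } := by
  have hc := (compute_phase_ne_caught (m := m) (o := o) (by rw [h]; simp)).2
  rcases hp : m.phase with _ | _ | _ | _ | _ | k | _ | _
  all_goals
    simp only [track_compute_size]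
    simp only [compute, track_phase, hp] at h hc ⊢
    try simp only [ready, enterReverse, enter, halt, continue_] at h ⊢
    repeat' first | contradiction | split at h
    all_goals simp_all [Option.isSome_iff_ne_none]

theorem into_atLandmarkL (h : (m.compute o).phase = .atLandmarkL) :
    (m.phase = .firstBlockL ∧ o.isLandmark = true ∧ o.moved = true ∧ o.together = false ∧
      (m.compute o).size = none ∧
      m.compute o = { m.track o with r₃ := m.eTime }.enter .atLandmarkL m.dir) ∨
    (m.phase = .waitL ∧ o.together = false ∧ m.compute o = (m.track o).enter .atLandmarkL m.dir) ∨
    (m.phase = .atLandmarkL ∧ o.myPos = none ∧ (m.compute o).size = none ∧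
      m.compute o = (m.track o).continue_) := by
  have hc := (compute_phase_ne_caught (m := m) (o := o) (by rw [h]; simp)).2
  rcases hp : m.phase with _ | _ | _ | _ | _ | k | _ | _
  all_goals
    simp only [track_compute_size]
    simp only [compute, track_phase, hp] at h hc ⊢
    try simp only [ready, enterReverse, enter, halt, continue_] at h ⊢
    repeat' first | contradiction | split at h
    all_goals simp_all [Option.isSome_iff_ne_none]

theorem into_happy (h : (m.compute o).phase = .happy) :
    ((m.phase = .initL ∨ m.phase = .firstBlockL ∨ m.phase = .atLandmarkL) ∧
      (m.compute o).size.isSome = true ∧ m.compute o = (m.track o).enter .happy m.dir) ∨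
    (m.phase = .happy ∧ m.compute o = (m.track o).continue_) := by
  have hc := (compute_phase_ne_caught (m := m) (o := o) (by rw [h]; simp)).2
  rcases hp : m.phase with _ | _ | _ | _ | _ | k | _ | _
  all_goals
    simp only [track_compute_size]
    simp only [compute, track_phase, hp] at h hc ⊢
    try simp only [ready, enterReverse, enter, halt, continue_] at h ⊢
    repeat' first | contradiction | split at h
    all_goals simp_all [Option.isSome_iff_ne_none]

theorem into_reverse {k : Bool} (h : (m.compute o).phase = .reverse k) :
    ((m.phase = .firstBlockL ∨ m.phase = .atLandmarkL) ∧ o.myPos ≠ none ∧ k = false ∧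
      (m.phase = .firstBlockL → (o.isLandmark && o.moved) = false) ∧
      (m.compute o).size = none ∧ m.compute o = (m.track o).ready) ∨
    (m.phase = .reverse false ∧ k = (m.compute o).size.isSome ∧ ∃ i, m.ID = some i ∧
      direction i m.tTime ≠ direction i (m.tTime - 1) ∧ m.compute o = (m.track o).enterReverse i) ∨
    (m.phase = .reverse k ∧ m.compute o = (m.track o).continue_ ∧
      (k = false → ∀ i, m.ID = some i → direction i m.tTime = direction i (m.tTime - 1))) := by
  have hc := (compute_phase_ne_caught (m := m) (o := o) (by rw [h]; simp)).2
  rcases hp : m.phase with _ | _ | _ | _ | _ | k' | _ | _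
  all_goals
    simp only [track_compute_size]
    simp only [compute, track_phase, hp] at h hc ⊢
    try simp only [ready, enterReverse, enter, halt, continue_] at h ⊢
    repeat' first | contradiction | split at h
    all_goals simp_all [Option.isSome_iff_ne_none]

theorem into_terminated (h : (m.compute o).phase = .terminated) :
    m.phase = .terminated ∨
    (m.phase = .happy ∧ ∃ s, (m.compute o).size = some s ∧ timeout s + 1 ≤ m.tTime) ∨
    (m.phase = .reverse true ∧ ∃ s, (m.compute o).size = some s ∧ timeout s ≤ m.tTime) ∨
    (m.phase = .waitL ∧ o.together = true) := by
  have hc := (compute_phase_ne_caught (m := m) (o := o) (by rw [h]; simp)).2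
  rcases hp : m.phase with _ | _ | _ | _ | _ | k | _ | _
  all_goals
    simp only [track_compute_size]
    simp only [compute, track_phase, hp] at h hc ⊢
    try simp only [ready, enterReverse, enter, halt, continue_] at h ⊢
    repeat' first | contradiction | split at h
    all_goals simp_all [Option.isSome_iff_ne_none]

/-- What is true of the variables in each phase. -/
def WellFormed (m : Memory) : Prop :=
  match m.phase with
  | .initL => m.dir = .left ∧ m.size = none ∧ m.ID = none ∧ m.r₃ = 0
  | .firstBlockL => m.dir = .right ∧ m.size = none ∧ m.ID = none ∧ m.r₃ = 0 ∧ 1 ≤ m.r₁ ∧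
      m.r₁ + m.eTime = m.tTime ∧ 1 ≤ m.eTime
  | .waitL => m.dir = .right ∧ m.size = none ∧ m.ID = none ∧ 1 ≤ m.r₁ ∧ 1 ≤ m.r₃ ∧
      m.r₁ + m.r₃ + 1 = m.tTime ∧ m.pos = 0
  | .atLandmarkL => m.dir = .right ∧ m.size = none ∧ m.ID = none ∧ 1 ≤ m.r₁ ∧ 1 ≤ m.r₃ ∧
      m.r₁ + m.r₃ + 1 ≤ m.tTime
  | .happy => m.size.isSome = true ∧ m.ID = none
  | .reverse true => m.size.isSome = true ∧ m.ID.isSome = true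
  | .reverse false => ∃ i, m.ID = some i ∧ m.dir = direction i (m.tTime - 1)
  | _ => True

theorem size_isSome_compute (h : m.size.isSome = true) : (m.compute o).size.isSome = true := by
  obtain ⟨s, hs⟩ := Option.isSome_iff_exists.1 h
  rw [track_compute_size]
  simp [track, hs]

/-- At the landmark a non-zero position would have been recorded as the ring size. -/
theorem pos_compute_eq_zero (h : (m.compute o).size = none) (ho : o.isLandmark = true) :
    (m.compute o).pos = 0 := by
  rw [track_compute_size] at h
  rw [track_compute_pos]
  simp only [track] at h ⊢
  by_contra h0
  simp only [ho, ne_eq, h0, not_false_eq_true, and_true, Option.isNone_iff_eq_none] at h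
  split at h <;> simp_all

end Memory

/-! ### What an agent sees, and the invariants along an execution. -/

section Run

variable {n : ℕ} {K : Protocol} {E : Environment n}

local notation "Alg" => startFromLandmarkNoChirality

theorem view_myPos_eq_none {t : ℕ} {a : Agent} :
    (view K E t a).myPos = none ↔ portAt (Alg K) E t a = none := by
  simp [view, look]

theorem view_isLandmark {t : ℕ} {a : Agent} :
    (view K E t a).isLandmark = true ↔ nodeAt (Alg K) E t a = E.landmark := by
  simp [view, look]

theorem view_moved {t : ℕ} {a : Agent} :
    (view K E t a).moved = movedAt (Alg K) E t a := rfl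

theorem view_together {t : ℕ} {a : Agent} : (view K E t a).together = true ↔
    nodeAt (Alg K) E t (!a) = nodeAt (Alg K) E t a := by
  simp only [Snapshot.together, view, look]
  split <;> simp_all

theorem view_together_eq_false {t : ℕ} {a : Agent} : (view K E t a).together = false ↔
    nodeAt (Alg K) E t (!a) ≠ nodeAt (Alg K) E t a := by
  rw [Ne, ← view_together, Bool.not_eq_true]

theorem view_isCatch {t : ℕ} {a : Agent} : (view K E t a).isCatch = true ↔
    nodeAt (Alg K) E t (!a) = nodeAt (Alg K) E t a ∧
      ((portAt (Alg K) E t a = none ∧ portAt (Alg K) E t (!a) ≠ none) ∨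
       (portAt (Alg K) E t a ≠ none ∧ portAt (Alg K) E t (!a) = none)) := by
  by_cases h : (execution (Alg K) E t (!a)).node = (execution (Alg K) E t a).node
  · rcases h1 : (execution (Alg K) E t a).port with _ | s <;>
      rcases h2 : (execution (Alg K) E t (!a)).port with _ | s' <;>
      simp [Snapshot.isCatch, view, look, h, h1, h2]
  · simp [Snapshot.isCatch, view, look, h]

theorem view_isCatch_not {t : ℕ} {a : Agent} :
    (view K E t (!a)).isCatch = true ↔ (view K E t a).isCatch = true := by
  rw [view_isCatch, view_isCatch, Bool.not_not]
  constructor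
  · rintro ⟨h, h'⟩; exact ⟨h.symm, by tauto⟩
  · rintro ⟨h, h'⟩; exact ⟨h.symm, by tauto⟩

theorem wellFormed_mem {t : ℕ} {a : Agent} (h : (mem K E t a).phase ≠ .caught) :
    (mem K E t a).WellFormed := by
  induction t with
  | zero => rw [mem_zero]; simp [Memory.WellFormed, Memory.init]
  | succ t ih =>
    have ih' := ih (phase_ne_caught_of_succ h)
    have ht := mem_tTime (K := K) (E := E) t a
    -- No agent is on a port at time 0. This yields r₁ ≥ 1, and later the positivity of identifiers.
    have hport0 : (view K E t a).myPos ≠ none → 1 ≤ t := by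
      intro h1
      rcases Nat.eq_zero_or_pos t with rfl | h2
      · exact absurd rfl h1
      · exact h2
    -- A waiting agent does not move, so its position remains 0 and the ring size remains unknown.
    have hwait : (mem K E t a).phase = .waitL → (view K E t a).moved = false := by
      intro hw
      rw [view_moved]
      cases t with
      | zero => rfl
      | succ t => exact (step_none (request_eq_none (phase_ne_caught_of_succ h) (Or.inr hw))).2.2
    rw [mem_succ] at h ⊢
    generalize mem K E t a = m at *
    generalize view K E t a = o at *
    unfold Memory.WellFormed at ih' ⊢
    simp only [Memory.tick_phase] at h ⊢
    rcases hp : (m.compute o).phase with _ | _ | _ | _ | _ | k | _ | _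
    · obtain ⟨h1, h2, h3, h4⟩ := Memory.into_initL hp
      rw [h1] at ih'
      simp only [Memory.tick_size, h3]
      simp_all [Memory.continue_]
    · rcases Memory.into_happy hp with ⟨h1, h2, h3⟩ | ⟨h1, h2⟩
      · simp only [Memory.tick_size, h2]
        rw [h3]
        rcases h1 with h1 | h1 | h1 <;> rw [h1] at ih' <;> simp_all [Memory.enter]
      · rw [h1] at ih'
        refine ⟨Memory.size_isSome_compute ih'.1, ?_⟩
        rw [h2]
        simp_all [Memory.continue_]
    · rcases Memory.into_firstBlockL hp with ⟨h1, h2, h3, h4⟩ | ⟨h1, h2, h3, h4, h5⟩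
      · rw [h1] at ih'
        have := hport0 h2
        simp only [Memory.tick_size, h3]
        rw [h4]
        simp_all [Memory.enter]
      · rw [h1] at ih'
        rw [Memory.tick_size, h4]
        rw [h5]
        simp_all [Memory.continue_]
        omega
    · rcases Memory.into_atLandmarkL hp with ⟨h1, h2, h3, h4, h5, h6⟩ | ⟨h1, h2, h3⟩ |
        ⟨h1, h2, h3, h4⟩
      · rw [h1] at ih'
        simp only [Memory.tick_size, h5]
        rw [h6]
        simp_all [Memory.enter]
      · rw [h1] at ih'
        have h4 : (m.compute o).size = none := by
          rw [Memory.track_compute_size]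
          simp [Memory.track, hwait h1, ih'.2.1, ih'.2.2.2.2.2.2]
        rw [Memory.tick_size, h4]
        rw [h3]
        simp_all [Memory.enter]
      · rw [h1] at ih'
        simp only [Memory.tick_size, h3]
        rw [h4]
        simp_all [Memory.continue_]
        omega
    · obtain ⟨h1, h2, h3, h4, h5, h6⟩ := Memory.into_waitL hp
      rw [h1] at ih'
      have h7 := Memory.pos_compute_eq_zero h5 h2
      simp only [Memory.tick_size, h5, Memory.tick_pos, h7]
      rw [h6]
      simp_all
    · rcases Memory.into_reverse hp with ⟨h1, h2, h3, h4, h5, h6⟩ | ⟨h1, h2, i, h3, h4, h5⟩ |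
        ⟨h1, h2, h3⟩
      · subst h3
        rw [h6]
        simp [Memory.ready, Memory.enterReverse, Memory.enter]
      · rcases k with _ | _
        · rw [h5]
          simp [Memory.enterReverse, Memory.enter, h3]
        · refine ⟨h2.symm, ?_⟩
          rw [h5]
          simp [Memory.enterReverse, Memory.enter, h3]
      · rw [h1] at ih'
        rcases k with _ | _
        · obtain ⟨i, h4, h5⟩ := ih'
          refine ⟨i, by rw [h2]; exact h4, ?_⟩
          have := h3 rfl i h4
          rw [h2]
          simp [Memory.continue_, this, h5]
        · refine ⟨Memory.size_isSome_compute ih'.1, ?_⟩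
          rw [h2]
          exact ih'.2
    · trivial
    · trivial

end Run

end DynamicRing

namespace DynamicRing

section Run

variable {n : ℕ} {K : Protocol} {E : Environment n}

local notation "Alg" => startFromLandmarkNoChirality

/-! ### Before the agents catch each other -/

variable (K E) in
/-- No agent has been caught within the first `t` rounds. -/
def Uncaught (t : ℕ) : Prop := ∀ a, (mem K E t a).phase ≠ .caught

theorem Uncaught.of_le {t t' : ℕ} (h : Uncaught K E t') (htt : t ≤ t') : Uncaught K E t :=
  fun a => phase_ne_caught_of_le htt (h a)

theorem uncaught_zero : Uncaught K E 0 := fun a => by simp [mem_zero, Memory.init]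

theorem phase_terminated_succ {t : ℕ} {a : Agent} (h : (mem K E t a).phase = .terminated) :
    (mem K E (t + 1) a).phase = .terminated := by
  rw [mem_succ, Memory.tick_phase, Memory.compute_terminated h]
  rfl

theorem phase_terminated_of_le {t t' : ℕ} (htt : t ≤ t') {a : Agent}
    (h : (mem K E t a).phase = .terminated) : (mem K E t' a).phase = .terminated := by
  induction htt with
  | refl => exact h
  | step _ ih => exact phase_terminated_succ ih

theorem phase_caught_succ {t : ℕ} {a : Agent} (h : (mem K E t a).phase = .caught) :
    (mem K E (t + 1) a).phase = .caught := by
  rw [mem_succ, Memory.tick_phase, Memory.compute_caught h]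
  exact h

theorem phase_caught_of_isCatch {t : ℕ} {a : Agent} (h₁ : (mem K E t a).phase ≠ .terminated)
    (h : (view K E t a).isCatch = true) : (mem K E (t + 1) a).phase = .caught := by
  by_cases h₂ : (mem K E t a).phase = .caught
  · exact phase_caught_succ h₂
  · rw [mem_succ, Memory.tick_phase, Memory.compute_catch h₂ h₁ h]

theorem isCatch_of_phase_caught {t : ℕ} {a : Agent} (h : (mem K E (t + 1) a).phase = .caught)
    (h₁ : (mem K E t a).phase ≠ .caught) :
    (mem K E t a).phase ≠ .terminated ∧ (view K E t a).isCatch = true := by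
  have ht : (mem K E t a).phase ≠ .terminated := by
    intro ht
    rw [phase_terminated_succ ht] at h
    cases h
  refine ⟨ht, ?_⟩
  by_contra hc
  rw [mem_succ, Memory.tick_phase] at h
  have hc' : (view K E t a).isCatch = false := by simpa using hc
  revert h
  generalize mem K E t a = m at *
  generalize view K E t a = o at *
  intro h
  unfold Memory.compute at h
  simp only [Memory.enter, Memory.halt, Memory.continue_, Memory.ready, Memory.enterReverse,
    Memory.track_phase] at h
  repeat' first | contradiction | split at h

/-- As long as an agent is active, neither has been caught. -/
theorem uncaught_of_active {t : ℕ} {a : Agent} (h₁ : (mem K E t a).phase ≠ .caught)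
    (h₂ : (mem K E t a).phase ≠ .terminated) : Uncaught K E t := by
  induction t with
  | zero => exact uncaught_zero
  | succ t ih =>
    have h₂' : (mem K E t a).phase ≠ .terminated := fun h => h₂ (phase_terminated_succ h)
    have hU := ih (phase_ne_caught_of_succ h₁) h₂'
    intro b
    by_cases hb : b = a
    · rw [hb]; exact h₁
    · obtain rfl : b = !a := by cases a <;> cases b <;> simp_all
      intro hc
      obtain ⟨-, hcatch⟩ := isCatch_of_phase_caught hc (hU _)
      -- A catch is seen by both agents in the same round, so the active agent would have been
      -- caught as well.
      rw [view_isCatch_not] at hcatch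
      exact h₁ (phase_caught_of_isCatch h₂' hcatch)

theorem portAt_of_terminated {t : ℕ} {a : Agent} (h : (mem K E t a).phase = .terminated) :
    portAt (Alg K) E t a = none := by
  cases t with
  | zero => rfl
  | succ t =>
    exact (step_none (request_eq_none (by rw [h]; simp) (Or.inl h))).2.1

/-- At a common node at most one agent is on a port. Such an agent has not terminated, so it would
see a catch. -/
theorem Uncaught.ports_of_together (hn : 3 ≤ n) {t : ℕ} (hU : Uncaught K E (t + 1)) {a : Agent}
    (h : nodeAt (Alg K) E t (!a) = nodeAt (Alg K) E t a) :
    portAt (Alg K) E t a = none ∧ portAt (Alg K) E t (!a) = none := by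
  have key : ∀ b : Agent, nodeAt (Alg K) E t (!b) = nodeAt (Alg K) E t b →
      portAt (Alg K) E t b ≠ none → False := by
    intro b hb hp
    have h1 : (mem K E t b).phase ≠ .terminated := fun h1 => hp (portAt_of_terminated h1)
    have h2 := (not_both_on_port hn hb).resolve_left hp
    exact hU b (phase_caught_of_isCatch h1 (view_isCatch.2 ⟨hb, Or.inr ⟨hp, h2⟩⟩))
  constructor
  · by_contra hp
    exact key a h hp
  · by_contra hp
    exact key (!a) (by rw [Bool.not_not]; exact h.symm) hp

/-- If both agents tried to move in the same direction, they are not together afterwards. -/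
theorem Uncaught.not_together (hn : 3 ≤ n) {t : ℕ} (hU : Uncaught K E (t + 2)) {a : Agent}
    {s : Side} (h₁ : requestAt (Alg K) E t a = some s) (h₂ : requestAt (Alg K) E t (!a) = some s) :
    nodeAt (Alg K) E (t + 1) (!a) ≠ nodeAt (Alg K) E (t + 1) a := fun h =>
  not_together_of_request_eq hn h₁ h₂ h (hU.ports_of_together hn h).1 (hU.ports_of_together hn h).2

/-- The outcomes of an attempt to move, as seen by the agent. -/
theorem disp_step {t : ℕ} {a : Agent} (h : (mem K E (t + 1) a).phase ≠ .caught)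
    (h₁ : (mem K E (t + 1) a).phase ≠ .terminated) (h₂ : (mem K E (t + 1) a).phase ≠ .waitL) :
    (movedAt (Alg K) E (t + 1) a = true ∧ portAt (Alg K) E (t + 1) a = none ∧
      disp K E (t + 1) a = disp K E t a + (mem K E (t + 1) a).dir.sign) ∨
    (movedAt (Alg K) E (t + 1) a = false ∧ portAt (Alg K) E (t + 1) a ≠ none ∧
      disp K E (t + 1) a = disp K E t a) ∨
    (movedAt (Alg K) E (t + 1) a = false ∧ portAt (Alg K) E (t + 1) a = none ∧
      disp K E (t + 1) a = disp K E t a ∧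
      gainsAccess (Alg K) E t (execution (Alg K) E t) a = false) := by
  rw [disp_succ]
  rcases step_some (request_of_phase h h₁ h₂) with h' | h' | h'
  · left
    exact ⟨h'.2.2.2.2, h'.2.2.2.1, by rw [if_pos h'.2.2.2.2]⟩
  · right; left
    exact ⟨h'.2.2.2.2, by rw [h'.2.2.2.1]; simp, by rw [h'.2.2.2.2]; simp⟩
  · right; right
    exact ⟨h'.2.2.2, h'.2.2.1, by rw [h'.2.2.2]; simp, h'.1⟩

theorem disp_stay {t : ℕ} {a : Agent} (h : (mem K E (t + 1) a).phase ≠ .caught)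
    (h₁ : (mem K E (t + 1) a).phase = .terminated ∨ (mem K E (t + 1) a).phase = .waitL) :
    movedAt (Alg K) E (t + 1) a = false ∧ portAt (Alg K) E (t + 1) a = none ∧
      disp K E (t + 1) a = disp K E t a := by
  have := step_none (request_eq_none h h₁)
  rw [disp_succ, this.2.2]
  exact ⟨rfl, this.2.1, by simp⟩

/-- A denial requires the agents to be together and leaves them apart. Hence no two consecutive
attempts are denied, which drives the amortised time bounds. -/
theorem Uncaught.of_denied (hn : 3 ≤ n) {t : ℕ} (hU : Uncaught K E (t + 2)) {a : Agent}
    (h₁ : (mem K E (t + 1) a).phase ≠ .terminated) (h₂ : (mem K E (t + 1) a).phase ≠ .waitL)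
    (hg : gainsAccess (Alg K) E t (execution (Alg K) E t) a = false) :
    nodeAt (Alg K) E t (!a) = nodeAt (Alg K) E t a ∧
      requestAt (Alg K) E t (!a) = requestAt (Alg K) E t a ∧
      nodeAt (Alg K) E (t + 1) (!a) ≠ nodeAt (Alg K) E (t + 1) a := by
  have hr := request_of_phase ((hU.of_le (Nat.le_succ _)) a) h₁ h₂
  obtain ⟨h3, h4, h5, h6⟩ := DynamicRing.of_denied hn hr hg
  exact ⟨h3, h4.trans hr.symm, hU.not_together hn hr h4⟩

/-! ### Bounds for the time before the identifiers are computed -/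

/-- The phases before the identifier is computed, after the first block. -/
def Phase.IsMiddle (p : Phase) : Prop := p = .firstBlockL ∨ p = .waitL ∨ p = .atLandmarkL

/-- Amortisation with two rounds allotted to each move. The phase ends after one round on a port,
and a denial uses up one unit of slack that only a move restores; the three bounds record how much
slack is left. -/
theorem Uncaught.time_initL (hn : 3 ≤ n) {t : ℕ} {a : Agent} (hU : Uncaught K E (t + 1))
    (hp : (mem K E t a).phase = .initL) :
    (t : ℤ) ≤ -2 * disp K E t a + 2 ∧
    (portAt (Alg K) E t a = none → (t : ℤ) ≤ -2 * disp K E t a + 1) ∧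
    (portAt (Alg K) E t a = none → nodeAt (Alg K) E t (!a) = nodeAt (Alg K) E t a →
      (t : ℤ) ≤ -2 * disp K E t a) := by
  induction t with
  | zero =>
    have : disp K E 0 a = 0 := by
      simp [disp_eq, mem_zero, Memory.init, movedAt, execution, initialConfig]
    simp [this]
  | succ t ih =>
    have hp' := hp
    rw [mem_succ, Memory.tick_phase] at hp'
    obtain ⟨h1, h2, h3, h4⟩ := Memory.into_initL hp'
    have hc := hU.of_le (Nat.le_succ _) a
    obtain ⟨i1, i2, i3⟩ := ih (hU.of_le (Nat.le_succ _)) h1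
    have i2' := i2 (view_myPos_eq_none.1 h2)
    have hw : (mem K E (t + 1) a).dir = .left := by
      have := wellFormed_mem hc
      rw [Memory.WellFormed, hp] at this
      exact this.1
    rcases disp_step hc (by rw [hp]; simp) (by rw [hp]; simp) with h | h | h
    · rw [hw] at h
      simp only [Side.sign] at h
      push_cast
      refine ⟨by omega, fun _ => by omega, fun _ _ => by omega⟩
    · push_cast
      refine ⟨by omega, fun h' => absurd h' h.2.1, fun h' => absurd h' h.2.1⟩
    · obtain ⟨g1, g2, g3⟩ := hU.of_denied hn (by rw [hp]; simp) (by rw [hp]; simp) h.2.2.2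
      have := i3 (view_myPos_eq_none.1 h2) g1
      push_cast
      refine ⟨by omega, fun _ => by omega, fun _ h' => absurd h' g3⟩

/-- The same amortisation for moves to the right. The round of waiting is paid by the move that
brought the agent to the landmark. -/
theorem Uncaught.time_middle (hn : 3 ≤ n) {t : ℕ} {a : Agent} (hU : Uncaught K E (t + 1))
    (hp : (mem K E t a).phase.IsMiddle) :
    (t : ℤ) ≤ 2 * disp K E t a + 4 * n + 2 ∧
    (portAt (Alg K) E t a = none → (t : ℤ) ≤ 2 * disp K E t a + 4 * n + 1) ∧
    (movedAt (Alg K) E t a = true → (t : ℤ) ≤ 2 * disp K E t a + 4 * n) ∧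
    (portAt (Alg K) E t a = none → nodeAt (Alg K) E t (!a) = nodeAt (Alg K) E t a →
      (mem K E t a).phase ≠ .waitL → (t : ℤ) ≤ 2 * disp K E t a + 4 * n) := by
  induction t with
  | zero => simp [mem_zero, Memory.init, Phase.IsMiddle] at hp
  | succ t ih =>
    have hc := hU.of_le (Nat.le_succ _) a
    have hU' := hU.of_le (Nat.le_succ _)
    have hw : (mem K E (t + 1) a).dir = .right := by
      have := wellFormed_mem hc
      rw [Memory.WellFormed] at this
      rcases hp with hp | hp | hp <;> rw [hp] at this <;> exact this.1
    -- the entering bound for an attempt to move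
    have step : (mem K E (t + 1) a).phase ≠ .waitL → (mem K E (t + 1) a).phase ≠ .terminated →
        (t : ℤ) ≤ 2 * disp K E t a + 4 * n + 1 →
        (nodeAt (Alg K) E t (!a) = nodeAt (Alg K) E t a → (t : ℤ) ≤ 2 * disp K E t a + 4 * n) →
        ((t + 1 : ℕ) : ℤ) ≤ 2 * disp K E (t + 1) a + 4 * n + 2 ∧
        (portAt (Alg K) E (t + 1) a = none →
          ((t + 1 : ℕ) : ℤ) ≤ 2 * disp K E (t + 1) a + 4 * n + 1) ∧
        (movedAt (Alg K) E (t + 1) a = true →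
          ((t + 1 : ℕ) : ℤ) ≤ 2 * disp K E (t + 1) a + 4 * n) ∧
        (portAt (Alg K) E (t + 1) a = none →
          nodeAt (Alg K) E (t + 1) (!a) = nodeAt (Alg K) E (t + 1) a →
          (mem K E (t + 1) a).phase ≠ .waitL →
          ((t + 1 : ℕ) : ℤ) ≤ 2 * disp K E (t + 1) a + 4 * n) := by
      intro hp1 hp2 b1 b2
      rcases disp_step hc hp2 hp1 with h | h | h
      · rw [hw] at h
        simp only [Side.sign] at h
        push_cast
        refine ⟨by omega, fun _ => by omega, fun _ => by omega, fun _ _ _ => by omega⟩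
      · push_cast
        refine ⟨by omega, fun h' => absurd h' h.2.1, fun h' => ?_, fun h' => absurd h' h.2.1⟩
        rw [h.1] at h'
        cases h'
      · obtain ⟨g1, g2, g3⟩ := hU.of_denied hn hp2 hp1 h.2.2.2
        have := b2 g1
        push_cast
        refine ⟨by omega, fun _ => by omega, fun h' => ?_, fun _ h' => absurd h' g3⟩
        rw [h.1] at h'
        cases h'
    rcases hp with hp | hp | hp
    · have hp' := hp
      rw [mem_succ, Memory.tick_phase] at hp'
      rcases Memory.into_firstBlockL hp' with ⟨h1, h2, h3, h4⟩ | ⟨h1, h2, h3, h4, h5⟩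
      -- The offset 4n reverses the sign of the displacement: it is at least -(n - 1), so -2 disp +
      -- 2 ≤ 2 disp + 4n.
      · have hi := hU'.time_initL hn h1
        have hd := abs_disp_lt hn (a := a) (t := t) (by rw [h1]; simp) (by rw [mem_succ]; exact h3)
        rw [abs_lt] at hd
        exact step (by rw [hp]; simp) (by rw [hp]; simp) (by omega) (fun _ => by omega)
      · obtain ⟨i1, i2, i3, i4⟩ := ih hU' (Or.inl h1)
        have hport := view_myPos_eq_none.1 h2
        exact step (by rw [hp]; simp) (by rw [hp]; simp) (i2 hport)
          (fun h => i4 hport h (by rw [h1]; simp))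
    · have hp' := hp
      rw [mem_succ, Memory.tick_phase] at hp'
      obtain ⟨h1, h2, h3, h4, h5, h6⟩ := Memory.into_waitL hp'
      obtain ⟨i1, i2, i3, i4⟩ := ih hU' (Or.inl h1)
      have hs := disp_stay hc (Or.inr hp)
      have := i3 h3
      rw [hs.2.2]
      push_cast
      refine ⟨by omega, fun _ => by omega, fun h => ?_, fun _ _ h => absurd hp h⟩
      rw [hs.1] at h
      cases h
    · have hp' := hp
      rw [mem_succ, Memory.tick_phase] at hp'
      rcases Memory.into_atLandmarkL hp' with ⟨h1, h2, h3, h4, h5, h6⟩ | ⟨h1, h2, h3⟩ |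
        ⟨h1, h2, h3, h4⟩
      · obtain ⟨i1, i2, i3, i4⟩ := ih hU' (Or.inl h1)
        have := i3 h3
        exact step (by rw [hp]; simp) (by rw [hp]; simp) (by omega) (fun _ => this)
      · obtain ⟨i1, i2, i3, i4⟩ := ih hU' (Or.inr (Or.inl h1))
        have hport : portAt (Alg K) E t a = none := by
          cases t with
          | zero => rfl
          | succ t => exact (disp_stay (by rw [h1]; simp) (Or.inr h1)).2.1
        -- The agent leaves this state only when it is alone, so it is not denied access and needs
        -- no slack.
        exact step (by rw [hp]; simp) (by rw [hp]; simp) (i2 hport)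
          (fun h => absurd h (view_together_eq_false.1 h2))
      · obtain ⟨i1, i2, i3, i4⟩ := ih hU' (Or.inr (Or.inr h1))
        have hport := view_myPos_eq_none.1 h2
        exact step (by rw [hp]; simp) (by rw [hp]; simp) (i2 hport)
          (fun h => i4 hport h (by rw [h1]; simp))

theorem abs_disp_le (hn : 3 ≤ n) {t : ℕ} {a : Agent} (h : (mem K E t a).phase ≠ .caught)
    (hs : (mem K E t a).size = none) : |disp K E t a| ≤ n := by
  cases t with
  | zero => simp [disp_eq, mem_zero, Memory.init, movedAt, execution, initialConfig]
  | succ t =>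
    have := abs_disp_lt hn (phase_ne_caught_of_succ h) hs
    rw [disp_succ]
    rw [abs_lt] at this
    rw [abs_le]
    split
    · cases (mem K E (t + 1) a).dir <;> simp only [Side.sign] <;> omega
    · omega

/-- The phases before the identifier is computed end within `O(n)` rounds. -/
theorem Uncaught.time_le (hn : 3 ≤ n) {t : ℕ} {a : Agent} (hU : Uncaught K E (t + 1))
    (hp : (mem K E t a).phase = .initL ∨ (mem K E t a).phase.IsMiddle) : t ≤ 6 * n + 2 := by
  have hc := hU.of_le (Nat.le_succ _) a
  have hs : (mem K E t a).size = none := by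
    have := wellFormed_mem hc
    rw [Memory.WellFormed] at this
    rcases hp with hp | hp | hp | hp <;> rw [hp] at this <;> exact this.2.1
  have hd := abs_disp_le hn hc hs
  rw [abs_le] at hd
  rcases hp with hp | hp
  · have := (hU.time_initL hn hp).1
    omega
  · have := (hU.time_middle hn hp).1
    omega

end Run

end DynamicRing

namespace DynamicRing

theorem Memory.compute_ID {m : Memory} {o : Snapshot} : (m.compute o).ID = m.ID ∨
    ((m.phase = .firstBlockL ∨ m.phase = .atLandmarkL) ∧
      (m.compute o).phase = .reverse false ∧ m.compute o = (m.track o).ready) := by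
  by_cases hc : m.phase = .caught
  · left; rw [Memory.compute_caught hc]; rfl
  by_cases ht : m.phase = .terminated
  · left; rw [Memory.compute_terminated ht]; rfl
  by_cases hC : o.isCatch = true
  · left; rw [Memory.compute_catch hc ht hC]; rfl
  have hC' : o.isCatch = false := by simpa using hC
  rcases hp : (m.compute o).phase with _ | _ | _ | _ | _ | k | _ | _
  · left; rw [(Memory.into_initL hp).2.2.1]; rfl
  · rcases Memory.into_happy hp with h | h
    · left; rw [h.2.2]; rfl
    · left; rw [h.2]; rfl
  · rcases Memory.into_firstBlockL hp with h | h
    · left; rw [h.2.2.2]; rfl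
    · left; rw [h.2.2.2.2]; rfl
  · rcases Memory.into_atLandmarkL hp with h | h | h
    · left; rw [h.2.2.2.2.2]; rfl
    · left; rw [h.2.2]; rfl
    · left; rw [h.2.2.2]; rfl
  · left; rw [(Memory.into_waitL hp).2.2.2.2.2]; rfl
  · rcases Memory.into_reverse hp with h | h | h
    · right; exact ⟨h.1, by rw [h.2.2.1], h.2.2.2.2.2⟩
    · obtain ⟨-, -, i, hi, -, h⟩ := h
      left; rw [h, hi]
      exact hi
    · left; rw [h.2.1]; rfl
  · have : m.phase ≠ .caught := hc
    exfalso
    revert hp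
    unfold Memory.compute
    simp only [Memory.enter, Memory.halt, Memory.continue_, Memory.ready, Memory.enterReverse,
      Memory.track_phase]
    intro hp
    repeat' first | contradiction | split at hp
  · left
    rcases Memory.into_terminated hp with h | ⟨h, s, h', h''⟩ | ⟨h, s, h', h''⟩ | ⟨h, h'⟩
    · exact absurd h ht
    · rw [Memory.track_compute_size] at h'
      rw [Memory.compute_happy h hC' h']
      split <;> rfl
    · rw [Memory.track_compute_size] at h'
      rw [Memory.compute_reverse_true h hC' h']
      split <;> rfl
    · rw [Memory.compute_waitL h hC', if_pos h']
      rfl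

section Run

variable {n : ℕ} {K : Protocol} {E : Environment n}

local notation "Alg" => startFromLandmarkNoChirality

/-! ### The history of an agent before it computes its identifier -/

theorem trace_initL {t : ℕ} {a : Agent} (h : (mem K E t a).phase = .initL) :
    ∀ s ≤ t, (mem K E s a).phase = .initL ∧ (s < t → portAt (Alg K) E s a = none) := by
  induction t with
  | zero => intro s hs; obtain rfl : s = 0 := by omega
            exact ⟨h, fun h => by omega⟩
  | succ t ih =>
    have hp' := h
    rw [mem_succ, Memory.tick_phase] at hp'
    obtain ⟨h1, h2, h3, h4⟩ := Memory.into_initL hp'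
    intro s hs
    rcases Nat.lt_or_ge s t with hst | hst
    · exact ⟨(ih h1 s hst.le).1, fun _ => (ih h1 s hst.le).2 hst⟩
    · rcases Nat.lt_or_ge s (t + 1) with hst' | hst'
      · obtain rfl : s = t := by omega
        exact ⟨h1, fun _ => view_myPos_eq_none.1 h2⟩
      · obtain rfl : s = t + 1 := by omega
        exact ⟨h, fun h => by omega⟩

theorem trace_firstBlockL {t : ℕ} {a : Agent} (h : (mem K E t a).phase = .firstBlockL) :
    (mem K E t a).r₁ < t ∧ (mem K E (mem K E t a).r₁ a).phase = .initL ∧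
      portAt (Alg K) E (mem K E t a).r₁ a ≠ none ∧
      ∀ s, (mem K E t a).r₁ < s → s ≤ t → (mem K E s a).phase = .firstBlockL ∧
        (mem K E s a).r₁ = (mem K E t a).r₁ ∧ (s < t → portAt (Alg K) E s a = none) := by
  induction t with
  | zero => simp [mem_zero, Memory.init] at h
  | succ t ih =>
    have hp' := h
    rw [mem_succ, Memory.tick_phase] at hp'
    rcases Memory.into_firstBlockL hp' with ⟨h1, h2, h3, h4⟩ | ⟨h1, h2, h3, h4, h5⟩
    · have hr : (mem K E (t + 1) a).r₁ = t := by
        rw [mem_succ, h4]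
        exact mem_tTime t a
      rw [hr]
      refine ⟨Nat.lt_succ_self t, h1, fun h => h2 (view_myPos_eq_none.2 h), fun s hs hs' => ?_⟩
      obtain rfl : s = t + 1 := by omega
      exact ⟨h, hr, fun h => by omega⟩
    · have hr : (mem K E (t + 1) a).r₁ = (mem K E t a).r₁ := by
        rw [mem_succ, h5]
        rfl
      obtain ⟨i1, i2, i3, i4⟩ := ih h1
      rw [hr]
      refine ⟨by omega, i2, i3, fun s hs hs' => ?_⟩
      rcases Nat.lt_or_ge s t with hst | hst
      · exact ⟨(i4 s hs hst.le).1, (i4 s hs hst.le).2.1, fun _ => (i4 s hs hst.le).2.2 hst⟩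
      · rcases Nat.lt_or_ge s (t + 1) with hst' | hst'
        · obtain rfl : s = t := by omega
          exact ⟨h1, rfl, fun _ => view_myPos_eq_none.1 h2⟩
        · obtain rfl : s = t + 1 := by omega
          exact ⟨h, hr, fun h => by omega⟩

/-- The round in which an agent entered the landmark after its first block. -/
theorem trace_landmark {t : ℕ} {a : Agent}
    (h : (mem K E t a).phase = .waitL ∨ (mem K E t a).phase = .atLandmarkL) :
    ∃ u, u = (mem K E t a).r₁ + (mem K E t a).r₃ ∧ u < t ∧ (mem K E u a).phase = .firstBlockL ∧
      (mem K E u a).r₁ = (mem K E t a).r₁ ∧ movedAt (Alg K) E u a = true ∧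
      nodeAt (Alg K) E u a = E.landmark ∧ (mem K E (u + 1) a).size = none := by
  induction t with
  | zero => simp [mem_zero, Memory.init] at h
  | succ t ih =>
    have enter : (mem K E t a).phase = .firstBlockL → (view K E t a).isLandmark = true →
        (view K E t a).moved = true → (mem K E (t + 1) a).size = none →
        (mem K E (t + 1) a).r₁ = (mem K E t a).r₁ → (mem K E (t + 1) a).r₃ = (mem K E t a).eTime →
        ∃ u, u = (mem K E (t + 1) a).r₁ + (mem K E (t + 1) a).r₃ ∧ u < t + 1 ∧
          (mem K E u a).phase = .firstBlockL ∧ (mem K E u a).r₁ = (mem K E (t + 1) a).r₁ ∧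
          movedAt (Alg K) E u a = true ∧
          nodeAt (Alg K) E u a = E.landmark ∧ (mem K E (u + 1) a).size = none := by
      intro h1 h2 h3 h4 h5 h6
      have hw := wellFormed_mem (K := K) (E := E) (t := t) (a := a) (by rw [h1]; simp)
      rw [Memory.WellFormed, h1, mem_tTime] at hw
      refine ⟨t, by rw [h5, h6]; exact hw.2.2.2.2.2.1.symm, Nat.lt_succ_self t, h1, h5.symm, h3,
        view_isLandmark.1 h2, h4⟩
    have keep : ((mem K E t a).phase = .waitL ∨ (mem K E t a).phase = .atLandmarkL) →
        (mem K E (t + 1) a).r₁ = (mem K E t a).r₁ → (mem K E (t + 1) a).r₃ = (mem K E t a).r₃ →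
        ∃ u, u = (mem K E (t + 1) a).r₁ + (mem K E (t + 1) a).r₃ ∧ u < t + 1 ∧
          (mem K E u a).phase = .firstBlockL ∧ (mem K E u a).r₁ = (mem K E (t + 1) a).r₁ ∧
          movedAt (Alg K) E u a = true ∧
          nodeAt (Alg K) E u a = E.landmark ∧ (mem K E (u + 1) a).size = none := by
      intro h1 h2 h3
      obtain ⟨u, e1, e2, e3, e4, e5⟩ := ih h1
      exact ⟨u, by rw [h2, h3]; exact e1, by omega, e3, by rw [h2]; exact e4, e5⟩
    rcases h with h | h
    · have hp' := h
      rw [mem_succ, Memory.tick_phase] at hp'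
      obtain ⟨h1, h2, h3, h4, h5, h6⟩ := Memory.into_waitL hp'
      exact enter h1 h2 h3 (by rw [mem_succ]; exact h5) (by rw [mem_succ, h6]; rfl)
        (by rw [mem_succ, h6]; rfl)
    · have hp' := h
      rw [mem_succ, Memory.tick_phase] at hp'
      rcases Memory.into_atLandmarkL hp' with ⟨h1, h2, h3, h4, h5, h6⟩ | ⟨h1, h2, h3⟩ |
        ⟨h1, h2, h3, h4⟩
      · exact enter h1 h2 h3 (by rw [mem_succ]; exact h5) (by rw [mem_succ, h6]; rfl)
          (by rw [mem_succ, h6]; rfl)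
      · exact keep (Or.inl h1) (by rw [mem_succ, h3]; rfl) (by rw [mem_succ, h3]; rfl)
      · exact keep (Or.inr h1) (by rw [mem_succ, h4]; rfl) (by rw [mem_succ, h4]; rfl)

theorem ID_succ {t : ℕ} {a : Agent} {i : ℕ} (h : (mem K E t a).ID = some i) :
    (mem K E (t + 1) a).ID = some i := by
  rw [mem_succ, Memory.tick_ID]
  rcases Memory.compute_ID (m := mem K E t a) (o := view K E t a) with h' | h'
  · rw [h', h]
  · exfalso
    have hw := wellFormed_mem (K := K) (E := E) (t := t) (a := a)
      (by rcases h'.1 with h1 | h1 <;> rw [h1] <;> simp)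
    rw [Memory.WellFormed] at hw
    rcases h'.1 with h1 | h1 <;> rw [h1] at hw
    · rw [hw.2.2.1] at h; cases h
    · rw [hw.2.2.1] at h; cases h

theorem ID_of_le {t t' : ℕ} (htt : t ≤ t') {a : Agent} {i : ℕ} (h : (mem K E t a).ID = some i) :
    (mem K E t' a).ID = some i := by
  induction htt with
  | refl => exact h
  | step _ ih => exact ID_succ ih

/-- The round in which the identifier was computed. -/
theorem trace_ID {t : ℕ} {a : Agent} {i : ℕ} (h : (mem K E t a).ID = some i) :
    ∃ T < t, (mem K E (T + 1) a).phase = .reverse false ∧ (mem K E (T + 1) a).ID = some i ∧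
      Uncaught K E (T + 1) ∧ portAt (Alg K) E T a ≠ none ∧ (mem K E (T + 1) a).size = none ∧
      ((mem K E T a).phase = .firstBlockL ∨ (mem K E T a).phase = .atLandmarkL) ∧
      i = interleave (mem K E T a).r₁ (T - max (mem K E T a).r₁ (mem K E T a).r₃)
        (mem K E T a).r₃ := by
  induction t with
  | zero => simp [mem_zero, Memory.init] at h
  | succ t ih =>
    rcases hi : (mem K E t a).ID with _ | j
    · have h' := h
      rw [mem_succ, Memory.tick_ID] at h'
      rcases Memory.compute_ID (m := mem K E t a) (o := view K E t a) with h1 | ⟨h1, h2, h3⟩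
      · rw [h1, hi] at h'; cases h'
      · have h2' : (mem K E (t + 1) a).phase = .reverse false := by rw [mem_succ]; exact h2
        rcases Memory.into_reverse h2 with h4 | h4 | h4
        · refine ⟨t, Nat.lt_succ_self t, h2', h, uncaught_of_active (a := a) (by rw [h2']; simp)
            (by rw [h2']; simp), fun h5 => h4.2.1 (view_myPos_eq_none.2 h5), ?_, h1, ?_⟩
          · rw [mem_succ]; exact h4.2.2.2.2.1
          · rw [h3] at h'
            have := Option.some.inj h'
            rw [← this]
            simp [mem_tTime]
        · rcases h1 with h1 | h1 <;> rw [h1] at h4 <;> simp at h4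
        · rcases h1 with h1 | h1 <;> rw [h1] at h4 <;> simp at h4
    · have : j = i := by
        have := ID_succ hi
        rw [h] at this
        exact (Option.some.inj this).symm
      obtain ⟨T, hT, hT'⟩ := ih (by rw [hi, this])
      exact ⟨T, by omega, hT'⟩

/-! ### The first blocks of the two agents -/

/-- The phases before the landmark is entered. -/
def Phase.IsEarly (p : Phase) : Prop := p = .initL ∨ p = .firstBlockL

theorem early_of_le {t t' : ℕ} (htt : t ≤ t') {a : Agent} (h : (mem K E t' a).phase.IsEarly) :
    (mem K E t a).phase.IsEarly := by
  rcases h with h | h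
  · exact Or.inl (trace_initL h t htt).1
  · obtain ⟨h1, h2, h3, h4⟩ := trace_firstBlockL h
    rcases Nat.lt_or_ge (mem K E t' a).r₁ t with h5 | h5
    · exact Or.inr (h4 t h5 htt).1
    · exact Or.inl (trace_initL h2 t h5).1

theorem early_request {t : ℕ} {a : Agent} (h : (mem K E (t + 1) a).phase.IsEarly) :
    requestAt (Alg K) E t a = some ((mem K E (t + 1) a).dir.relabel (E.flipped a)) := by
  rcases h with h | h <;>
    exact request_of_phase (by rw [h]; simp) (by rw [h]; simp) (by rw [h]; simp)

theorem early_dir_succ {t : ℕ} {a : Agent} (h : (mem K E (t + 1) a).phase.IsEarly)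
    (hport : portAt (Alg K) E t a = none) : (mem K E (t + 1) a).dir = (mem K E t a).dir := by
  rcases h with h | h
  · rw [mem_succ, Memory.tick_phase] at h
    rw [mem_succ, (Memory.into_initL h).2.2.1]
    rfl
  · rw [mem_succ, Memory.tick_phase] at h
    rcases Memory.into_firstBlockL h with h' | h'
    · exact absurd (view_myPos_eq_none.2 hport) h'.2.1
    · rw [mem_succ, h'.2.2.2.2]
      rfl

/-- A denial after round 0 would need a common node off the ports and equal requests. Off the ports
the directions are those of the previous round, whose equal requests had already separated the
agents. -/
theorem early_gainsAccess (hn : 3 ≤ n) {t : ℕ} {a : Agent} (hU : Uncaught K E (t + 3))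
    (h₁ : (mem K E (t + 2) a).phase.IsEarly) (h₂ : (mem K E (t + 2) (!a)).phase.IsEarly) :
    gainsAccess (Alg K) E (t + 1) (execution (Alg K) E (t + 1)) a = true := by
  by_contra hg
  have hg' : gainsAccess (Alg K) E (t + 1) (execution (Alg K) E (t + 1)) a = false := by
    simpa using hg
  obtain ⟨g1, g2, g3⟩ := hU.of_denied hn (by rcases h₁ with h | h <;> rw [h] <;> simp)
    (by rcases h₁ with h | h <;> rw [h] <;> simp) hg'
  have hU2 : Uncaught K E (t + 2) := hU.of_le (Nat.le_succ _)
  obtain ⟨p1, p2⟩ := hU2.ports_of_together hn g1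
  rw [early_request h₁, early_request h₂, early_dir_succ h₁ p1, early_dir_succ h₂ p2,
    ← early_request (early_of_le (Nat.le_succ _) h₁),
    ← early_request (early_of_le (Nat.le_succ _) h₂)] at g2
  exact hU2.not_together hn (early_request (early_of_le (Nat.le_succ _) h₁))
    (g2.trans (early_request (early_of_le (Nat.le_succ _) h₁))) g1

variable (K E) in
/-- The delay of an agent that is denied access in the first round. -/
def delay (a : Agent) : ℤ :=
  if gainsAccess (Alg K) E 0 (execution (Alg K) E 0) a = true then 0 else 1

theorem disp_zero (a : Agent) : disp K E 0 a = 0 := by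
  simp [disp_eq, mem_zero, Memory.init, movedAt, execution, initialConfig]

theorem early_step (hn : 3 ≤ n) {t : ℕ} {a : Agent} (hU : Uncaught K E (t + 2))
    (h₁ : (mem K E (t + 1) a).phase.IsEarly) (h₂ : (mem K E (t + 1) (!a)).phase.IsEarly)
    (ht : 1 ≤ t) :
    (movedAt (Alg K) E (t + 1) a = true ∧ portAt (Alg K) E (t + 1) a = none ∧
      disp K E (t + 1) a = disp K E t a + (mem K E (t + 1) a).dir.sign) ∨
    (portAt (Alg K) E (t + 1) a ≠ none ∧ disp K E (t + 1) a = disp K E t a) := by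
  obtain ⟨t, rfl⟩ := Nat.exists_eq_add_of_le' ht
  have hg := early_gainsAccess hn hU h₁ h₂
  rcases disp_step ((hU.of_le (Nat.le_succ _)) a) (by rcases h₁ with h | h <;> rw [h] <;> simp)
    (by rcases h₁ with h | h <;> rw [h] <;> simp) with h | h | h
  · exact Or.inl h
  · exact Or.inr h.2
  · rw [hg] at h; cases h.2.2.2

/-- Only round 0 can bring a denial, so every round is a move except for the initial delay and the
round that ends on a port. -/
theorem disp_initL (hn : 3 ≤ n) {t : ℕ} {a : Agent} (hU : Uncaught K E (t + 2))
    (h₁ : (mem K E (t + 1) a).phase = .initL) (h₂ : (mem K E (t + 1) (!a)).phase.IsEarly) :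
    (portAt (Alg K) E (t + 1) a = none → disp K E (t + 1) a = -(t + 1) + delay K E a) ∧
    (portAt (Alg K) E (t + 1) a ≠ none → disp K E (t + 1) a = -t + delay K E a) := by
  induction t with
  | zero =>
    have hc := (hU.of_le (Nat.le_succ _)) a
    have hw : (mem K E (0 + 1) a).dir = .left := by
      have := wellFormed_mem hc
      rw [Memory.WellFormed, h₁] at this
      exact this.1
    rcases step_some (early_request (Or.inl h₁)) with h | h | h
    · rw [disp_succ, h.2.2.2.1, h.2.2.2.2, disp_zero, hw, delay, h.1]
      simp [Side.sign]
    · rw [disp_succ, h.2.2.2.1, h.2.2.2.2, disp_zero, delay, h.1]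
      simp
    · rw [disp_succ, h.2.2.1, h.2.2.2, disp_zero, delay, h.1]
      simp
  | succ t ih =>
    have hc := (hU.of_le (Nat.le_succ _)) a
    have hw : (mem K E (t + 1 + 1) a).dir = .left := by
      have := wellFormed_mem hc
      rw [Memory.WellFormed, h₁] at this
      exact this.1
    have htr := trace_initL h₁ (t + 1) (Nat.le_succ _)
    have ih' := (ih (hU.of_le (Nat.le_succ _)) htr.1 (early_of_le (Nat.le_succ _) h₂)).1
      (htr.2 (Nat.lt_succ_self _))
    rcases early_step hn hU (Or.inl h₁) h₂ (by omega) with h | h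
    · rw [hw] at h
      refine ⟨fun _ => ?_, fun h' => absurd h.2.1 h'⟩
      rw [h.2.2, ih']
      simp only [Side.sign]
      push_cast
      ring
    · refine ⟨fun h' => absurd h' h.1, fun _ => ?_⟩
      rw [h.2, ih']
      push_cast
      ring

/-- Up to the delay, r₁ - 1 moves to the left are followed by a move to the right in each round from
r₁ on, except for a round that ends on a port. -/
theorem disp_firstBlockL (hn : 3 ≤ n) {t : ℕ} {a : Agent} (hU : Uncaught K E (t + 1))
    (h₁ : (mem K E t a).phase = .firstBlockL) (h₂ : (mem K E t (!a)).phase.IsEarly) :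
    (portAt (Alg K) E t a = none →
      disp K E t a = t - 2 * (mem K E t a).r₁ + 1 + delay K E a) ∧
    (portAt (Alg K) E t a ≠ none →
      disp K E t a = t - 2 * (mem K E t a).r₁ + delay K E a) := by
  induction t with
  | zero => simp [mem_zero, Memory.init] at h₁
  | succ t ih =>
    have hc := (hU.of_le (Nat.le_succ _)) a
    have hw : (mem K E (t + 1) a).dir = .right := by
      have := wellFormed_mem hc
      rw [Memory.WellFormed, h₁] at this
      exact this.1
    have base : 1 ≤ t ∧ disp K E t a = t - 2 * (mem K E (t + 1) a).r₁ + 1 + delay K E a := by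
      have hp' := h₁
      rw [mem_succ, Memory.tick_phase] at hp'
      rcases Memory.into_firstBlockL hp' with ⟨h3, h4, h5, h6⟩ | ⟨h3, h4, h5, h6, h7⟩
      · have hr : (mem K E (t + 1) a).r₁ = t := by
          rw [mem_succ, h6]
          exact mem_tTime t a
        have hport : portAt (Alg K) E t a ≠ none := fun h => h4 (view_myPos_eq_none.2 h)
        have ht : 1 ≤ t := by
          rcases Nat.eq_zero_or_pos t with rfl | h
          · exact absurd rfl hport
          · exact h
        obtain ⟨t, rfl⟩ := Nat.exists_eq_add_of_le' ht
        refine ⟨ht, ?_⟩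
        rw [(disp_initL hn (hU.of_le (Nat.le_succ _)) h3 (early_of_le (Nat.le_succ _) h₂)).2 hport,
          hr]
        push_cast
        ring
      · have hr : (mem K E (t + 1) a).r₁ = (mem K E t a).r₁ := by
          rw [mem_succ, h7]
          rfl
        have ht : 1 ≤ t := by
          rcases Nat.eq_zero_or_pos t with rfl | h
          · simp [mem_zero, Memory.init] at h3
          · exact h
        exact ⟨ht, by rw [hr]; exact (ih (hU.of_le (Nat.le_succ _)) h3
          (early_of_le (Nat.le_succ _) h₂)).1 (view_myPos_eq_none.1 h4)⟩
    rcases early_step hn hU (Or.inr h₁) h₂ base.1 with h | h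
    · rw [hw] at h
      refine ⟨fun _ => ?_, fun h' => absurd h.2.1 h'⟩
      rw [h.2.2, base.2]
      simp only [Side.sign]
      push_cast
      ring
    · refine ⟨fun h' => absurd h' h.1, fun _ => ?_⟩
      rw [h.2, base.2]
      push_cast
      ring

theorem orient_not_of_ne {a : Agent} (h : E.flipped (!a) ≠ E.flipped a) :
    orient E (!a) = -orient E a := by
  unfold orient
  revert h
  cases E.flipped (!a) <;> cases E.flipped a <;> simp [Side.relabel, Side.opp, Side.sign]

theorem delay_of_ne {a : Agent} (h : E.flipped (!a) ≠ E.flipped a)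
    (h₁ : (mem K E 1 a).phase.IsEarly) (h₂ : (mem K E 1 (!a)).phase.IsEarly) :
    delay K E a = 0 := by
  unfold delay
  rw [if_pos]
  apply gainsAccess_of_not
  rw [early_request h₁, early_request h₂, early_dir_succ h₁ rfl, early_dir_succ h₂ rfl]
  rintro ⟨-, h3⟩
  revert h h3
  cases E.flipped (!a) <;> cases E.flipped a <;>
    simp [mem_zero, Memory.init, Side.relabel, Side.opp]

/-- Both agents compete for the same port in round 0. The resulting shift by one excludes a
simultaneous return to the landmark, by parity. -/
theorem delay_of_eq {a : Agent} (h : E.flipped (!a) = E.flipped a)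
    (h₁ : (mem K E 1 a).phase.IsEarly) (h₂ : (mem K E 1 (!a)).phase.IsEarly) :
    delay K E a + delay K E (!a) = 1 := by
  have r1 := early_request h₁
  have r2 := early_request h₂
  rw [early_dir_succ h₁ rfl] at r1
  rw [early_dir_succ h₂ rfl, h] at r2
  have := not_both_gain (P := Alg K) (E := E) (t := 0) (a := a) rfl r1 (by rw [r2]; rfl)
  unfold delay
  rw [this]
  generalize gainsAccess (Alg K) E 0 (execution (Alg K) E 0) (!a) = b
  cases b <;> simp

/-- Agents that are first blocked in the same round have seen the whole ring between them. -/
theorem ring_size_of_same_block (hn : 3 ≤ n) {r : ℕ} {a : Agent} (hU : Uncaught K E (r + 1))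
    (h₁ : (mem K E r a).phase = .initL) (h₂ : (mem K E r (!a)).phase = .initL)
    (p₁ : portAt (Alg K) E r a ≠ none) (p₂ : portAt (Alg K) E r (!a) ≠ none)
    (hs : (mem K E (r + 1) a).size = none) :
    E.flipped (!a) ≠ E.flipped a ∧ n + 1 = 2 * r := by
  have hc := hU.of_le (Nat.le_succ _)
  obtain ⟨s, hs1⟩ := Option.ne_none_iff_exists'.1 p₁
  obtain ⟨s', hs2⟩ := Option.ne_none_iff_exists'.1 p₂
  obtain ⟨h3, h4⟩ := of_both_on_port hs1 hs2
  have d1 : (mem K E r a).dir = .left := by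
    have := wellFormed_mem (hc a)
    rw [Memory.WellFormed, h₁] at this
    exact this.1
  have d2 : (mem K E r (!a)).dir = .left := by
    have := wellFormed_mem (hc (!a))
    rw [Memory.WellFormed, h₂] at this
    exact this.1
  have e1 := port_eq (hc a) hs1
  have e2 := port_eq (hc (!a)) hs2
  rw [d1] at e1
  rw [d2] at e2
  have hne : E.flipped (!a) ≠ E.flipped a := by
    intro h
    rw [e1, e2, h] at h3
    exact Side.opp_ne _ h3.symm
  refine ⟨hne, ?_⟩
  have hr : 1 ≤ r := by
    rcases Nat.eq_zero_or_pos r with rfl | h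
    · exact absurd rfl p₁
    · exact h
  obtain ⟨r, rfl⟩ := Nat.exists_eq_add_of_le' hr
  have E1 : (mem K E 1 a).phase.IsEarly := early_of_le (by omega) (Or.inl h₁)
  have E2 : (mem K E 1 (!a)).phase.IsEarly := early_of_le (by omega) (Or.inl h₂)
  have x1 := (disp_initL hn hU h₁ (Or.inl h₂)).2 p₁
  have x2 := (disp_initL (a := !a) hn hU h₂ (by rw [Bool.not_not]; exact Or.inl h₁)).2 p₂
  rw [delay_of_ne hne E1 E2, add_zero] at x1
  rw [delay_of_ne (a := !a) (by rw [Bool.not_not]; exact hne.symm) E2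
    (by rw [Bool.not_not]; exact E1), add_zero] at x2
  have hlt := abs_disp_lt hn (hc a) hs
  rw [x1, abs_lt] at hlt
  rw [node_eq (hc a), node_eq (hc (!a)), x1, x2, e1, sign_relabel, orient_not_of_ne hne] at h4
  -- After the shift of r by one, each agent has made r moves, in opposite directions. The two paths
  -- and the missing edge close up to 2r + 1 edges, a multiple of n, and r < n leaves only n itself.
  have h5 : ((orient E a * (2 * r + 1) : ℤ) : ZMod n) = 0 := by
    have := sub_eq_zero.2 h4
    push_cast [Side.sign] at this ⊢
    rw [← this]
    ring
  rw [intCast_eq_zero_iff] at h5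
  have h6 : (n : ℤ) ∣ 2 * r + 1 := by
    have := h5.mul_left (orient E a)
    rwa [← mul_assoc, orient_sq, one_mul] at this
  obtain ⟨q, hq⟩ := h6
  have hq1 : 0 < q := by
    by_contra hq1
    nlinarith
  have hq2 : q < 2 := by
    by_contra hq2
    nlinarith
  obtain rfl : q = 1 := by omega
  omega

end Run

end DynamicRing

namespace DynamicRing

section Run

variable {n : ℕ} {K : Protocol} {E : Environment n}

local notation "Alg" => startFromLandmarkNoChirality

/-! ### Both agents return to the landmark at the same time -/

theorem le_timeout (hn : 3 ≤ n) : 20 * n ≤ timeout n := by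
  unfold timeout
  nlinarith [Nat.zero_le (Nat.clog 2 n * n)]

/-- How an agent that has not been caught terminates. -/
theorem of_phase_terminated (hn : 3 ≤ n) {t : ℕ} {a : Agent}
    (h : (mem K E t a).phase = .terminated) :
    (∃ s < t, (mem K E s a).phase = .waitL ∧ (mem K E (s + 1) a).phase = .terminated ∧
      nodeAt (Alg K) E s (!a) = nodeAt (Alg K) E s a) ∨
    (timeout n < t ∧ (mem K E t a).size.isSome = true) := by
  induction t with
  | zero => simp [mem_zero, Memory.init] at h
  | succ t ih =>
    have hp' := h
    rw [mem_succ, Memory.tick_phase] at hp'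
    have hc : (mem K E t a).phase ≠ .caught := phase_ne_caught_of_succ (by rw [h]; simp)
    have timed : ∀ s, ((mem K E t a).compute (view K E t a)).size = some s →
        timeout s ≤ (mem K E t a).tTime →
        timeout n < t + 1 ∧ (mem K E (t + 1) a).size.isSome = true := by
      intro s hs hts
      have hs' : (mem K E (t + 1) a).size = some s := by rw [mem_succ]; exact hs
      rw [mem_tTime, (size_eq hn hc hs').1] at hts
      exact ⟨by omega, by rw [hs']; rfl⟩
    rcases Memory.into_terminated hp' with h1 | ⟨h1, s, h2, h3⟩ | ⟨h1, s, h2, h3⟩ | ⟨h1, h2⟩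
    · rcases ih h1 with ⟨s, hs, h2⟩ | h2
      · exact Or.inl ⟨s, by omega, h2⟩
      · refine Or.inr ⟨by omega, ?_⟩
        rw [mem_succ]
        exact Memory.size_isSome_compute h2.2
    · exact Or.inr (timed s h2 (by omega))
    · exact Or.inr (timed s h2 h3)
    · exact Or.inl ⟨t, Nat.lt_succ_self t, h1, h, view_together.1 h2⟩

/-- What happened before the round in which an agent waits at the landmark. -/
theorem of_waitL (hn : 3 ≤ n) {t : ℕ} {a : Agent} (h : (mem K E t a).phase = .waitL) :
    ∃ u, t = u + 1 ∧ (mem K E u a).phase = .firstBlockL ∧ nodeAt (Alg K) E u a = E.landmark ∧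
      movedAt (Alg K) E u a = true ∧ nodeAt (Alg K) E u (!a) = nodeAt (Alg K) E u a ∧
      (mem K E (u + 1) a).size = none ∧ u ≤ 6 * n + 2 ∧ Uncaught K E (u + 1) ∧
      nodeAt (Alg K) E (u + 1) a = E.landmark := by
  cases t with
  | zero => simp [mem_zero, Memory.init] at h
  | succ t =>
    have hp' := h
    rw [mem_succ, Memory.tick_phase] at hp'
    obtain ⟨h1, h2, h3, h4, h5, h6⟩ := Memory.into_waitL hp'
    have hU : Uncaught K E (t + 1) :=
      uncaught_of_active (a := a) (by rw [h]; simp) (by rw [h]; simp)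
    refine ⟨t, rfl, h1, view_isLandmark.1 h2, h3, view_together.1 h4, by rw [mem_succ]; exact h5,
      hU.time_le hn (Or.inr (Or.inl h1)), hU, ?_⟩
    rw [(step_none (request_eq_none (by rw [h]; simp) (Or.inr h))).1]
    exact view_isLandmark.1 h2

/-- If an agent terminates after waiting at the landmark, then the other one waits, too. -/
theorem waitL_other (hn : 3 ≤ n) {t : ℕ} {a : Agent} (h : (mem K E t a).phase = .waitL)
    (h' : (mem K E (t + 1) a).phase = .terminated) : (mem K E t (!a)).phase = .waitL := by
  induction t using Nat.strong_induction_on generalizing a with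
  | _ t ih =>
  obtain ⟨u, rfl, h1, h2, h3, h4, h5, h6, hU, h7⟩ := of_waitL hn h
  have hc : (view K E (u + 1) a).isCatch = false :=
    isCatch_eq_false (by rw [h']; simp) (by rw [h]; simp)
  have htog : nodeAt (Alg K) E (u + 1) (!a) = nodeAt (Alg K) E (u + 1) a := by
    have hp' := h'
    rw [mem_succ, Memory.tick_phase, Memory.compute_waitL h hc] at hp'
    split at hp'
    · exact view_together.1 ‹_›
    · cases hp'
  have hpa : portAt (Alg K) E (u + 1) a = none :=
    (disp_stay (by rw [h]; simp) (Or.inr h)).2.1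
  have hpb : portAt (Alg K) E (u + 1) (!a) = none := by
    by_contra hpb
    have := view_isCatch (K := K) (E := E) (t := u + 1) (a := a).2 ⟨htog, Or.inl ⟨hpa, hpb⟩⟩
    rw [hc] at this
    cases this
  -- the other agent did not try to move
  have hreq : requestAt (Alg K) E u (!a) = none := by
    rcases hr : requestAt (Alg K) E u (!a) with _ | s
    · rfl
    · exfalso
      rcases step_some hr with h8 | h8 | h8
      · have h9 := h8.2.2.1
        rw [htog, h7, h4, h2] at h9
        exact sign_ne_zero hn s (left_eq_add.1 h9)
      · rw [h8.2.2.2.1] at hpb; cases hpb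
      · obtain ⟨-, g2, -⟩ := of_denied hn hr h8.1
        rw [Bool.not_not, request_eq_none (by rw [h]; simp) (Or.inr h)] at g2
        cases g2
  by_contra hw
  have hterm : (mem K E (u + 1) (!a)).phase = .terminated := by
    by_contra hterm
    rw [request_of_phase (hU (!a)) hterm hw] at hreq
    cases hreq
  rcases of_phase_terminated hn hterm with ⟨s, hs, g1, g2, g3⟩ | g
  · have := ih s hs g1 g2
    rw [Bool.not_not] at this
    rcases early_of_le (Nat.lt_succ_iff.1 hs) (Or.inr h1) with h8 | h8 <;> rw [h8] at this <;>
      cases this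
  · have := le_timeout hn
    omega

theorem disp_eq_zero_at_landmark {t : ℕ} {a : Agent} (h : nodeAt (Alg K) E t a = E.landmark)
    (hs : (mem K E (t + 1) a).size = none) : disp K E t a = 0 := by
  rw [size_succ] at hs
  by_contra h0
  split at hs
  · cases hs
  · rename_i hc
    exact hc ⟨hs, h, h0⟩

/-- Agents that enter the landmark at the same time after their first blocks have explored the
ring. -/
theorem explored_of_waitL (hn : 3 ≤ n) {t : ℕ} {a : Agent} (h₁ : (mem K E t a).phase = .waitL)
    (h₂ : (mem K E t (!a)).phase = .waitL) : ExploredBy (Alg K) E t := by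
  obtain ⟨u, rfl, a1, a2, a3, a4, a5, a6, hU, a7⟩ := of_waitL hn h₁
  obtain ⟨u', hu, b1, b2, b3, b4, b5, b6, -, b7⟩ := of_waitL hn h₂
  obtain rfl : u' = u := by omega
  have hc := hU.of_le (Nat.le_succ _)
  have da := disp_eq_zero_at_landmark a2 a5
  have db := disp_eq_zero_at_landmark b2 b5
  have pa := (hU.ports_of_together hn a4).1
  have pb := (hU.ports_of_together hn a4).2
  have xa := (disp_firstBlockL hn hU a1 (Or.inr b1)).1 pa
  have xb := (disp_firstBlockL hn hU b1 (by rw [Bool.not_not]; exact Or.inr a1)).1 pb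
  obtain ⟨ta1, ta2, ta3, ta4⟩ := trace_firstBlockL a1
  obtain ⟨tb1, tb2, tb3, tb4⟩ := trace_firstBlockL b1
  have hu1 : 1 ≤ u' := by omega
  have E1 : (mem K E 1 a).phase.IsEarly := early_of_le hu1 (Or.inr a1)
  have E2 : (mem K E 1 (!a)).phase.IsEarly := early_of_le hu1 (Or.inr b1)
  -- With equal orientations the delays add up to 1, so the two displacements have different
  -- parities and cannot both vanish.
  by_cases hf : E.flipped (!a) = E.flipped a
  · have := delay_of_eq hf E1 E2
    omega
  · rw [da, delay_of_ne hf E1 E2] at xa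
    rw [db, delay_of_ne (a := !a) (by rw [Bool.not_not]; exact fun h => hf h.symm) E2
      (by rw [Bool.not_not]; exact E1)] at xb
    have hr : (mem K E u' (!a)).r₁ = (mem K E u' a).r₁ := by omega
    rw [hr] at tb1 tb2 tb3 tb4
    set r := (mem K E u' a).r₁ with hr'
    have hring := ring_size_of_same_block hn (hU.of_le (by omega)) ta2 tb2 ta3 tb3
      (size_mono (by omega) a5)
    have hr1 : 1 ≤ r := by omega
    obtain ⟨r', hr''⟩ := Nat.exists_eq_add_of_le' hr1
    have y1 := (disp_initL (t := r') hn (hU.of_le (by omega)) (by rw [← hr'']; exact ta2)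
      (by rw [← hr'']; exact Or.inl tb2)).2 (by rw [← hr'']; exact ta3)
    have y2 := (disp_initL (t := r') (a := !a) hn (hU.of_le (by omega)) (by rw [← hr'']; exact tb2)
      (by rw [← hr'', Bool.not_not]; exact Or.inl ta2)).2 (by rw [← hr'']; exact tb3)
    rw [delay_of_ne hf E1 E2, ← hr''] at y1
    rw [delay_of_ne (a := !a) (by rw [Bool.not_not]; exact fun h => hf h.symm) E2
      (by rw [Bool.not_not]; exact E1), ← hr''] at y2
    intro v
    -- Each agent went r' = r - 1 steps to its own side, and n = 2r' + 1, so the displacements from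
    -- -r' to r' represent every node.
    obtain ⟨k, k1, k2, k3⟩ := exists_int_rep hn
      (((orient E a : ℤ) : ZMod n) * (v - E.landmark)) (-r')
    have hv : v = E.landmark + ((orient E a * k : ℤ) : ZMod n) := by
      push_cast
      rw [k3, ← mul_assoc, orient_cast_sq]
      ring
    rcases le_total k 0 with hk | hk
    · obtain ⟨s, hs, hs'⟩ := disp_visited (hc.of_le (show r ≤ u' by omega) a) k (by omega)
      exact ⟨s, by omega, a, by rw [hv]; exact hs'⟩
    · obtain ⟨s, hs, hs'⟩ := disp_visited (hc.of_le (show r ≤ u' by omega) (!a)) (-k) (by omega)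
      refine ⟨s, by omega, !a, ?_⟩
      rw [hv, show (execution (Alg K) E s (!a)).node = nodeAt (Alg K) E s (!a) from rfl, hs',
        orient_not_of_ne hf]
      ring_nf

/-- Before the timeout an agent terminates only together with the other one. -/
theorem terminated_before_timeout (hn : 3 ≤ n) {t : ℕ} {a : Agent}
    (h : (mem K E t a).phase = .terminated) :
    ((∀ b, (mem K E t b).phase = .terminated) ∧ ExploredBy (Alg K) E t) ∨
    (timeout n < t ∧ (mem K E t a).size.isSome = true) := by
  rcases of_phase_terminated hn h with ⟨s, hs, g1, g2, g3⟩ | g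
  · left
    have hw := waitL_other hn g1 g2
    refine ⟨?_, (explored_of_waitL hn g1 hw).mono hs.le⟩
    have hc : (view K E s a).isCatch = false :=
      isCatch_eq_false (by rw [g2]; simp) (by rw [g1]; simp)
    have hc' : (view K E s (!a)).isCatch = false := by
      by_contra hcon
      have := view_isCatch_not.1 (by simpa using hcon)
      rw [hc] at this
      cases this
    have g4 : (mem K E (s + 1) (!a)).phase = .terminated := by
      rw [mem_succ, Memory.tick_phase, Memory.compute_waitL hw hc', if_pos]
      · rfl
      · rw [view_together, Bool.not_not]
        exact g3.symm
    intro b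
    by_cases hb : b = a
    · rw [hb]; exact h
    · obtain rfl : b = !a := by cases a <;> cases b <;> simp_all
      exact phase_terminated_of_le hs g4
  · exact Or.inr g

/-! ### The identifiers -/

/-- The bounds for an identifier. -/
theorem ID_bound (hn : 3 ≤ n) {t : ℕ} {a : Agent} {i : ℕ} (h : (mem K E t a).ID = some i) :
    0 < i ∧ Nat.size i ≤ 3 * (Nat.clog 2 n + 3) ∧ (mem K E (6 * n + 3) a).ID = some i := by
  obtain ⟨T, hT, h1, h2, hU, h3, h4, h5, h6⟩ := trace_ID h
  have hTle : T ≤ 6 * n + 2 := hU.time_le hn (by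
    rcases h5 with h5 | h5
    · exact Or.inr (Or.inl h5)
    · exact Or.inr (Or.inr (Or.inr h5)))
  have hw := wellFormed_mem (hU.of_le (Nat.le_succ T) a)
  rw [Memory.WellFormed] at hw
  have hr : 1 ≤ (mem K E T a).r₁ ∧ (mem K E T a).r₁ ≤ T ∧ (mem K E T a).r₃ ≤ T := by
    rcases h5 with h5 | h5 <;> rw [h5] at hw <;> simp only [mem_tTime] at hw <;> omega
  -- The three additional bits suffice since T ≤ 6n + 2 < 8n.
  have hlt : ∀ x ≤ T, x < 2 ^ (Nat.clog 2 n + 3) := by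
    intro x hx
    have := Nat.le_pow_clog (b := 2) (by norm_num) n
    rw [pow_add]
    omega
  refine ⟨?_, ?_, ID_of_le (by omega) h2⟩
  · rw [h6]
    exact interleave_pos hr.1
  · rw [h6]
    exact size_interleave_le (hlt _ hr.2.1) (hlt _ (by omega)) (hlt _ hr.2.2)

/-- Two agents that compute an identifier in the same round after the same first block have not
followed symmetric paths. -/
theorem not_blocked_twice_together (hn : 3 ≤ n) {T : ℕ} {a : Agent} (hU : Uncaught K E (T + 1))
    (h₁ : (mem K E T a).phase = .firstBlockL) (h₂ : (mem K E T (!a)).phase = .firstBlockL)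
    (hr : (mem K E T (!a)).r₁ = (mem K E T a).r₁)
    (p₁ : portAt (Alg K) E T a ≠ none) (p₂ : portAt (Alg K) E T (!a) ≠ none)
    (hs : (mem K E (T + 1) a).size = none) : False := by
  obtain ⟨ta1, ta2, ta3, ta4⟩ := trace_firstBlockL h₁
  obtain ⟨tb1, tb2, tb3, tb4⟩ := trace_firstBlockL h₂
  have hc := hU.of_le (Nat.le_succ _)
  have E1 : (mem K E 1 a).phase.IsEarly := early_of_le (by omega) (Or.inr h₁)
  have E2 : (mem K E 1 (!a)).phase.IsEarly := early_of_le (by omega) (Or.inr h₂)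
  have hring := ring_size_of_same_block hn (hU.of_le (by omega)) ta2 (by rw [← hr]; exact tb2) ta3
    (by rw [← hr]; exact tb3) (size_mono (by omega) hs)
  have hf := hring.1
  have xa := (disp_firstBlockL hn hU h₁ (Or.inr h₂)).2 p₁
  have xb := (disp_firstBlockL hn hU h₂ (by rw [Bool.not_not]; exact Or.inr h₁)).2 p₂
  rw [delay_of_ne hf E1 E2, add_zero] at xa
  rw [delay_of_ne (a := !a) (by rw [Bool.not_not]; exact fun h => hf h.symm) E2
    (by rw [Bool.not_not]; exact E1), hr, add_zero] at xb
  set r := (mem K E T a).r₁ with hr'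
  -- the landmark has not been reached
  have hneg : T < 2 * r := by
    by_contra hge
    push Not at hge
    -- In round 2r - 1 the displacement would be 0, reached by a move. An agent that enters the
    -- landmark leaves the state `firstBlockL`.
    have hs1 : r < 2 * r - 1 := by omega
    obtain ⟨q1, q2, q3⟩ := ta4 (2 * r - 1) hs1 (by omega)
    obtain ⟨s1, s2, s3⟩ := ta4 (2 * r - 1 + 1) (by omega) (by omega)
    have hU' : Uncaught K E (2 * r - 1 + 1) := hU.of_le (by omega)
    have E3 := early_of_le (t := 2 * r - 1) (by omega) (Or.inr h₂ : (mem K E T (!a)).phase.IsEarly)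
    have y := (disp_firstBlockL hn hU' q1 E3).1 (q3 (by omega))
    rw [q2, delay_of_ne hf E1 E2] at y
    have hy : disp K E (2 * r - 1) a = 0 := by
      rw [y]; push_cast [show 1 ≤ 2 * r by omega]; ring
    have hmoved : movedAt (Alg K) E (2 * r - 1) a = true := by
      have e : 2 * r - 1 = (2 * r - 2) + 1 := by omega
      have := early_step (t := 2 * r - 2) (a := a) hn (hU'.of_le (by omega))
        (by rw [← e]; exact Or.inr q1) (by rw [← e]; exact E3) (by omega)
      rw [← e] at this
      rcases this with h | h
      · exact h.1
      · exact absurd (q3 (by omega)) h.1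
    have hland : nodeAt (Alg K) E (2 * r - 1) a = E.landmark := by
      rw [node_eq (hU.of_le (by omega) a), hy]
      simp
    have hp' := s1
    rw [mem_succ, Memory.tick_phase] at hp'
    rcases Memory.into_firstBlockL hp' with h | h
    · rw [q1] at h; simp at h
    · have := h.2.2.1
      rw [view_isLandmark.2 hland, view_moved, hmoved] at this
      cases this
  obtain ⟨s, hs1⟩ := Option.ne_none_iff_exists'.1 p₁
  obtain ⟨s', hs2⟩ := Option.ne_none_iff_exists'.1 p₂
  have h4 := (of_both_on_port hs1 hs2).2
  have d1 : (mem K E T a).dir = .right := by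
    have := wellFormed_mem (hc a)
    rw [Memory.WellFormed, h₁] at this
    exact this.1
  have e1 := port_eq (hc a) hs1
  rw [d1] at e1
  rw [node_eq (hc a), node_eq (hc (!a)), xa, xb, e1, sign_relabel, orient_not_of_ne hf] at h4
  have h5 : ((orient E a * (2 * (2 * r - T) - 1) : ℤ) : ZMod n) = 0 := by
    have := sub_eq_zero.2 h4
    push_cast [Side.sign] at this ⊢
    rw [← this]
    ring
  rw [intCast_eq_zero_iff] at h5
  have h6 : (n : ℤ) ∣ 2 * (2 * r - T) - 1 := by
    have := h5.mul_left (orient E a)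
    rwa [← mul_assoc, orient_sq, one_mul] at this
  -- With r < T < 2r and n = 2r - 1, the multiple of n is positive and less than n.
  have := Int.le_of_dvd (by omega) h6
  omega

/-- The two identifiers are distinct. -/
theorem ID_ne (hn : 3 ≤ n) {t : ℕ} {a : Agent} {i i' : ℕ} (h : (mem K E t a).ID = some i)
    (h' : (mem K E t (!a)).ID = some i') : i ≠ i' := by
  rintro rfl
  obtain ⟨T, hT, a1, a2, aU, a3, a4, a5, a6⟩ := trace_ID h
  obtain ⟨T', hT', b1, b2, bU, b3, b4, b5, b6⟩ := trace_ID h'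
  rw [a6] at b6
  obtain ⟨e1, e2, e3⟩ := interleave_inj b6
  have wa := wellFormed_mem (aU.of_le (Nat.le_succ T) a)
  have wb := wellFormed_mem (bU.of_le (Nat.le_succ T') (!a))
  rw [Memory.WellFormed] at wa wb
  rcases a5 with a5 | a5 <;> rcases b5 with b5 | b5 <;> rw [a5] at wa <;> rw [b5] at wb <;>
    simp only [mem_tTime] at wa wb
  -- Neither agent has reached the landmark, so both r₃ vanish and r₁ + r₂ is the round of the
  -- second block. In the two mixed cases one r₃ is zero and the other positive.
  · obtain rfl : T' = T := by omega
    exact not_blocked_twice_together hn aU a5 b5 e1.symm a3 b3 a4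
  · omega
  · omega
  · obtain ⟨u, u1, u2, u3, u4, u5, u6, u7⟩ := trace_landmark (Or.inr a5)
    obtain ⟨u', v1, v2, v3, v4, v5, v6, v7⟩ := trace_landmark (Or.inr b5)
    obtain rfl : u' = u := by omega
    have waits : ∀ (b : Agent) (S : ℕ), u' < S → (mem K E S b).phase ≠ .caught →
        (mem K E u' b).phase = .firstBlockL → movedAt (Alg K) E u' b = true →
        nodeAt (Alg K) E u' b = E.landmark → (mem K E (u' + 1) b).size = none →
        nodeAt (Alg K) E u' (!b) = E.landmark → (mem K E (u' + 1) b).phase = .waitL := by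
      intro b S hS hc g1 g2 g3 g4 g5
      have hc' : (view K E u' b).isCatch = false :=
        isCatch_eq_false (phase_ne_caught_of_le hS hc) (by rw [g1]; simp)
      have hs : ((mem K E u' b).track (view K E u' b)).size.isSome = false := by
        rw [mem_succ, Memory.tick_size, Memory.track_compute_size] at g4
        rw [g4]
        rfl
      have hl : ((view K E u' b).isLandmark && (view K E u' b).moved) = true := by
        rw [view_isLandmark.2 g3, view_moved, g2]
        rfl
      rw [mem_succ, Memory.tick_phase, Memory.compute_firstBlockL g1 hc', hs, hl,
        if_neg (by simp), if_pos rfl, if_pos (view_together.2 (g5.trans g3.symm))]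
    have w1 := waits a T u2 (aU.of_le (Nat.le_succ _) a) u3 u5 u6 u7 v6
    have w2 := waits (!a) T' v2 (bU.of_le (Nat.le_succ _) (!a)) v3 v5 v6 v7
      (by rw [Bool.not_not]; exact u6)
    have hlt : u' + 1 < T := by
      rcases Nat.lt_or_ge (u' + 1) T with h | h
      · exact h
      · obtain rfl : T = u' + 1 := by omega
        rw [w1] at a5
        cases a5
    have hc : (view K E (u' + 1) a).isCatch = false :=
      isCatch_eq_false (aU.of_le (by omega) a) (by rw [w1]; simp)
    have n1 : nodeAt (Alg K) E (u' + 1) a = E.landmark := by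
      rw [(step_none (request_eq_none (by rw [w1]; simp) (Or.inr w1))).1]
      exact u6
    have n2 : nodeAt (Alg K) E (u' + 1) (!a) = E.landmark := by
      rw [(step_none (request_eq_none (by rw [w2]; simp) (Or.inr w2))).1]
      exact v6
    have hterm : (mem K E (u' + 1 + 1) a).phase = .terminated := by
      rw [mem_succ, Memory.tick_phase, Memory.compute_waitL w1 hc,
        if_pos (view_together.2 (n2.trans n1.symm))]
      rfl
    have := phase_terminated_of_le (show u' + 1 + 1 ≤ T by omega) hterm
    rw [a5] at this
    cases this

/-- The blocks of the schedules are long enough before the timeout. -/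
theorem exists_long_blocks (hn : 3 ≤ n) {i' : ℕ}
    (h₂ : Nat.size i' ≤ 3 * (Nat.clog 2 n + 3)) (h₃ : 0 < i') :
    ∃ e, 5 * n ≤ 2 ^ e ∧ 0 < e ∧ 20 * n ≤ 2 ^ (basePhase i' + e) ∧
      2 ^ (basePhase i' + e + 2) ≤ timeout n := by
  -- A positive identifier has at least one bit, so its string has at least four characters.
  have h4 : 4 ≤ 2 ^ basePhase i' := by
    have := length_idString_le i'
    have := Nat.size_pos.2 h₃
    omega
  obtain ⟨e, e1, e2, e3⟩ := blocks_fit hn h₂ h4 (two_pow_basePhase_lt i')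
  refine ⟨e, e1, ?_, e2, e3⟩
  rcases Nat.eq_zero_or_pos e with rfl | h
  · norm_num at e1
    omega
  · exact h

/-- The two schedules agree during `5 n` rounds in one phase; during the next phase, each schedule
prescribes each direction for `5 n` rounds. -/
theorem exists_agreement (hn : 3 ≤ n) {i i' : ℕ} (hne : i ≠ i')
    (h₁ : Nat.size i ≤ 3 * (Nat.clog 2 n + 3)) (h₂ : Nat.size i' ≤ 3 * (Nat.clog 2 n + 3))
    (p₁ : 0 < i) (p₂ : 0 < i') (f g : Bool) :
    ∃ j, 20 * n ≤ 2 ^ j ∧ 2 ^ (j + 2) ≤ timeout n ∧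
      (∃ u s, 2 ^ j ≤ u ∧ u + 5 * n ≤ 2 ^ (j + 1) ∧ ∀ r, u ≤ r → r < u + 5 * n →
        (direction i r).relabel f = s ∧ (direction i' r).relabel g = s) ∧
      (∀ s, ∃ u, 2 ^ (j + 1) ≤ u ∧ u + 5 * n ≤ 2 ^ (j + 2) ∧
        ∀ r, u ≤ r → r < u + 5 * n → direction i r = s) ∧
      (∀ s, ∃ u, 2 ^ (j + 1) ≤ u ∧ u + 5 * n ≤ 2 ^ (j + 2) ∧
        ∀ r, u ≤ r → r < u + 5 * n → direction i' r = s) := by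
  wlog h : basePhase i ≤ basePhase i' generalizing i i' f g
  · obtain ⟨j, j1, j2, ⟨u, s, j3, j4, j5⟩, j6, j7⟩ :=
      this hne.symm h₂ h₁ p₂ p₁ g f (le_of_not_ge h)
    exact ⟨j, j1, j2, ⟨u, s, j3, j4, fun r h1 h2 => (j5 r h1 h2).symm⟩, j7, j6⟩
  obtain ⟨e, e1, e2, e3, e4⟩ := exists_long_blocks hn h₂ p₂
  -- One phase later the blocks are twice as long, and a smaller base phase only lengthens them.
  have block : ∀ i'' : ℕ, basePhase i'' ≤ basePhase i' → ∀ s, ∃ u,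
      2 ^ (basePhase i' + e + 1) ≤ u ∧ u + 5 * n ≤ 2 ^ (basePhase i' + e + 2) ∧
        ∀ r, u ≤ r → r < u + 5 * n → direction i'' r = s := by
    intro i'' hi s
    obtain ⟨u, u1, u2, u3⟩ := exists_block i'' (basePhase i' + e + 1) (by omega) s
    have : 2 ^ e ≤ 2 ^ (basePhase i' + e + 1 - basePhase i'') :=
      Nat.pow_le_pow_right (by norm_num) (by omega)
    have e' : basePhase i' + e + 1 + 1 = basePhase i' + e + 2 := by ring
    rw [e'] at u2
    exact ⟨u, u1, by omega, fun r h1 h2 => u3 r h1 (by omega)⟩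
  refine ⟨basePhase i' + e, e3, e4, ?_, block i h, block i' le_rfl⟩
  obtain ⟨u, u1, u2, s, u3⟩ := exists_agreement_of_le hne h f g (j := basePhase i' + e) (by omega)
  rw [Nat.add_sub_cancel_left] at u2 u3
  exact ⟨u, s, u1, by omega, fun r h1 h2 => u3 r h1 (by omega)⟩

end Run

end DynamicRing

namespace DynamicRing

section Run

variable {n : ℕ} {K : Protocol} {E : Environment n}

local notation "Alg" => startFromLandmarkNoChirality

/-! ### Long runs in the same direction -/

theorem sign_sq (s : Side) : s.sign * s.sign = 1 := by cases s <;> rfl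

/-- If both agents try to move in the same direction for `5 n` rounds and do not catch each other,
then both of them make a full loop. -/
theorem size_known_of_run (hn : 3 ≤ n) {s : ℕ} (hU : Uncaught K E (s + 5 * n)) {σ : Side}
    (hr : ∀ b r, s ≤ r → r < s + 5 * n → requestAt (Alg K) E r b = some σ) (a : Agent) :
    (mem K E (s + 5 * n) a).size ≠ none := by
  intro hs
  have hc : ∀ b t, t ≤ s + 5 * n → (mem K E t b).phase ≠ .caught := fun b t ht => hU.of_le ht b
  -- The agents may be together at time s; the first common request separates them, so the count
  -- starts at s + 1.
  have hne : ∀ k, k ≤ 5 * n - 2 →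
      nodeAt (Alg K) E (s + 1 + k) (!a) ≠ nodeAt (Alg K) E (s + 1 + k) a := by
    intro k hk
    have e : s + 1 + k = s + k + 1 := by ring
    rw [e]
    exact (hU.of_le (by omega) : Uncaught K E (s + k + 2)).not_together hn
      (hr a _ (by omega) (by omega)) (hr (!a) _ (by omega) (by omega))
  -- The progress in the direction σ since time s + 1.
  let Y : Agent → ℕ → ℤ := fun b k =>
    σ.sign * (orient E b * (disp K E (s + 1 + k) b - disp K E (s + 1) b))
  have hY : ∀ b k, k ≤ 5 * n - 2 → orient E b * disp K E (s + 1 + k) b =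
      orient E b * disp K E (s + 1) b + σ.sign * Y b k := by
    intro b k _
    simp only [Y]
    rw [← mul_assoc, sign_sq]
    ring
  have hstep : ∀ b k, k + 1 ≤ 5 * n - 2 →
      (Y b (k + 1) = Y b k + 1) ∨ (Y b (k + 1) = Y b k ∧
        E.missing (s + 1 + k) = some (edgeAt (nodeAt (Alg K) E (s + 1 + k) b) σ)) := by
    intro b k hk
    have hreq := hr b (s + 1 + k) (by omega) (by omega)
    have hdir := (of_request_eq_some (hc b (s + 1 + k + 1) (by omega)) hreq).1
    have hsg : σ.sign * (orient E b * (mem K E (s + 1 + k + 1) b).dir.sign) = 1 := by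
      rw [← sign_relabel, ← hdir, sign_sq]
    have hne' : nodeAt (Alg K) E (s + 1 + k) (!b) ≠ nodeAt (Alg K) E (s + 1 + k) b := by
      have := hne k (by omega)
      by_cases hb : b = a
      · rw [hb]; exact this
      · obtain rfl : b = !a := by cases a <;> cases b <;> simp_all
        rw [Bool.not_not]; exact this.symm
    have hd := disp_succ (K := K) (E := E) (t := s + 1 + k) (a := b)
    rcases step_some hreq with h | h | h
    · left
      rw [if_pos h.2.2.2.2] at hd
      simp only [Y]
      rw [← Nat.add_assoc, hd, ← hsg]
      ring
    · right
      rw [h.2.2.2.2] at hd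
      refine ⟨?_, h.2.1⟩
      simp only [Y]
      rw [← Nat.add_assoc, hd]
      simp
    · rw [gainsAccess_of_not fun h => hne' h.1] at h
      cases h.1
  -- The distance from `a` forward to the other agent. Changing by at most one per round and never
  -- divisible by n, it remains between 1 and n - 1.
  obtain ⟨d, d1, d2, d3⟩ := exists_int_rep hn (((σ.sign : ℤ) : ZMod n) *
    (nodeAt (Alg K) E (s + 1) (!a) - nodeAt (Alg K) E (s + 1) a)) 0
  have hssq : ((σ.sign : ℤ) : ZMod n) * (σ.sign : ℤ) = 1 := by
    rw [← Int.cast_mul, sign_sq, Int.cast_one]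
  have hdist : ∀ k, k ≤ 5 * n - 2 → ((d + Y (!a) k - Y a k : ℤ) : ZMod n) =
      ((σ.sign : ℤ) : ZMod n) *
        (nodeAt (Alg K) E (s + 1 + k) (!a) - nodeAt (Alg K) E (s + 1 + k) a) := by
    intro k hk
    rw [node_eq (hc a _ (by omega)), node_eq (hc (!a) _ (by omega)), hY a k hk, hY (!a) k hk]
    push_cast
    rw [d3, node_eq (hc a (s + 1) (by omega)), node_eq (hc (!a) (s + 1) (by omega))]
    push_cast
    linear_combination ((Y a k : ZMod n) - (Y (!a) k : ZMod n)) * hssq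
  have hnz : ∀ k, k ≤ 5 * n - 2 → ¬ (n : ℤ) ∣ d + Y (!a) k - Y a k := by
    intro k hk hdvd
    rw [← intCast_eq_zero_iff, hdist k hk] at hdvd
    apply hne k hk
    have := congrArg (fun x => ((σ.sign : ℤ) : ZMod n) * x) hdvd
    simp only [mul_zero] at this
    rw [← mul_assoc, hssq, one_mul] at this
    exact sub_eq_zero.1 this
  have main : ∀ k, k ≤ 5 * n - 2 → (k : ℤ) ≤ Y a k + Y (!a) k ∧
      1 ≤ d + Y (!a) k - Y a k ∧ d + Y (!a) k - Y a k ≤ n - 1 := by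
    intro k
    induction k with
    | zero =>
      intro hk
      have hz : ∀ b, Y b 0 = 0 := fun b => by simp [Y]
      have h0 := hnz 0 hk
      rw [hz, hz] at h0 ⊢
      refine ⟨by simp, ?_, by omega⟩
      by_contra hlt
      obtain rfl : d = 0 := by omega
      simp at h0
    | succ k ih =>
      intro hk
      obtain ⟨i1, i2, i3⟩ := ih (by omega)
      have h0 := hnz (k + 1) hk
      have hb0 : d + Y (!a) (k + 1) - Y a (k + 1) ≠ 0 := fun h => h0 (by rw [h]; exact dvd_zero _)
      have hbn : d + Y (!a) (k + 1) - Y a (k + 1) ≠ n := fun h => h0 (by rw [h])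
      -- One missing edge does not block two agents at distinct nodes in the same direction, so the
      -- total progress grows in every round.
      have hboth : ¬ (Y a (k + 1) = Y a k ∧ Y (!a) (k + 1) = Y (!a) k) := by
        rintro ⟨e1, e2⟩
        rcases hstep a k hk with h1 | h1
        · omega
        · rcases hstep (!a) k hk with h2 | h2
          · omega
          · have := h1.2.symm.trans h2.2
            exact hne k (by omega) (edgeAt_injective (Option.some.inj this)).symm
      have h1 : Y a (k + 1) = Y a k + 1 ∨ Y a (k + 1) = Y a k :=
        (hstep a k hk).imp id And.left
      have h2 : Y (!a) (k + 1) = Y (!a) k + 1 ∨ Y (!a) (k + 1) = Y (!a) k :=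
        (hstep (!a) k hk).imp id And.left
      push_cast
      omega
  obtain ⟨m1, m2, m3⟩ := main (5 * n - 2) le_rfl
  -- The total progress is at least 5n - 2 and the other agent gains at most n - 1 on `a`. A
  -- progress of 2n does not fit between displacements of absolute value less than n.
  have hYa : 2 * (n : ℤ) ≤ Y a (5 * n - 2) := by omega
  have b1 := abs_disp_lt hn (hc a (s + 1) (by omega)) (size_mono (by omega) hs)
  have b2 := abs_disp_lt hn (hc a (s + 1 + (5 * n - 2)) (by omega)) (size_mono (by omega) hs)
  have b3 : Y a (5 * n - 2) ≤
      |disp K E (s + 1 + (5 * n - 2)) a| + |disp K E (s + 1) a| := by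
    simp only [Y]
    refine (le_abs_self _).trans ?_
    rw [abs_mul, abs_mul]
    have o1 : |σ.sign| = 1 := by cases σ <;> rfl
    have o2 : |orient E a| = 1 := by unfold orient; cases (Side.right.relabel (E.flipped a)) <;> rfl
    rw [o1, o2, one_mul, one_mul]
    exact abs_sub _ _
  omega

/-! ### After the identifiers have been computed -/

/-- The phases in which the direction does not change any more. -/
def Phase.IsFixed (p : Phase) : Prop := p = .happy ∨ p = .reverse true

theorem fixed_succ {t : ℕ} {a : Agent} (h : (mem K E t a).phase.IsFixed)
    (hc : (mem K E (t + 1) a).phase ≠ .caught) (ht : (mem K E (t + 1) a).phase ≠ .terminated) :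
    (mem K E (t + 1) a).phase.IsFixed ∧ (mem K E (t + 1) a).dir = (mem K E t a).dir := by
  have hC : (view K E t a).isCatch = false :=
    isCatch_eq_false hc (by rcases h with h | h <;> rw [h] <;> simp)
  have hw := wellFormed_mem (phase_ne_caught_of_succ hc)
  rw [Memory.WellFormed] at hw
  have hs : ∃ s, ((mem K E t a).track (view K E t a)).size = some s := by
    rw [← Option.isSome_iff_exists, ← Memory.track_compute_size]
    apply Memory.size_isSome_compute
    rcases h with h | h <;> rw [h] at hw <;> exact hw.1
  obtain ⟨s, hs⟩ := hs
  rw [mem_succ] at ht ⊢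
  rcases h with h | h
  · rw [Memory.compute_happy h hC hs] at ht ⊢
    split at ht
    · exact absurd rfl ht
    · rw [if_neg ‹_›]
      exact ⟨Or.inl h, rfl⟩
  · rw [Memory.compute_reverse_true h hC hs] at ht ⊢
    split at ht
    · exact absurd rfl ht
    · rw [if_neg ‹_›]
      exact ⟨Or.inr h, rfl⟩

theorem fixed_of_le {t t' : ℕ} (htt : t ≤ t') {a : Agent} (h : (mem K E t a).phase.IsFixed)
    (hc : (mem K E t' a).phase ≠ .caught) (ht : (mem K E t' a).phase ≠ .terminated) :
    (mem K E t' a).phase.IsFixed ∧ (mem K E t' a).dir = (mem K E t a).dir := by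
  induction htt with
  | refl => exact ⟨h, rfl⟩
  | step _ ih =>
    have := ih (phase_ne_caught_of_succ hc) fun h => ht (phase_terminated_succ h)
    have h2 := fixed_succ this.1 hc ht
    exact ⟨h2.1, h2.2.trans this.2⟩

/-- One round earlier `Uncaught.time_le` already excludes all phases before the identifier. -/
theorem late_phase (hn : 3 ≤ n) {t : ℕ} (ht : 6 * n + 4 ≤ t) (hU : Uncaught K E t) {a : Agent}
    (hT : (mem K E t a).phase ≠ .terminated) :
    (mem K E t a).phase.IsFixed ∨ (mem K E t a).phase = .reverse false := by
  obtain ⟨t, rfl⟩ := Nat.exists_eq_add_of_le' (show 1 ≤ t by omega)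
  have early : ¬ ((mem K E t a).phase = .initL ∨ (mem K E t a).phase.IsMiddle) := by
    intro h
    have := hU.time_le hn h
    omega
  unfold Phase.IsMiddle at early
  rcases hp : (mem K E (t + 1) a).phase with _ | _ | _ | _ | _ | k | _ | _
  · rw [mem_succ, Memory.tick_phase] at hp
    exact absurd (Or.inl (Memory.into_initL hp).1) early
  · exact Or.inl (Or.inl rfl)
  · rw [mem_succ, Memory.tick_phase] at hp
    rcases Memory.into_firstBlockL hp with h | h <;> simp [h.1] at early
  · rw [mem_succ, Memory.tick_phase] at hp
    rcases Memory.into_atLandmarkL hp with h | h | h <;> simp [h.1] at early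
  · rw [mem_succ, Memory.tick_phase] at hp
    simp [(Memory.into_waitL hp).1] at early
  · cases k
    · exact Or.inr rfl
    · exact Or.inl (Or.inr rfl)
  · exact absurd hp (hU a)
  · exact absurd hp hT

/-- A phase with fixed direction is left only by a catch or by termination, so an agent found
following its schedule has followed it all along. -/
theorem reverse_false_of_le (hn : 3 ≤ n) {t t' : ℕ} (htt : t ≤ t') (ht : 6 * n + 4 ≤ t)
    (hU : Uncaught K E t') {a : Agent} (h : (mem K E t' a).phase = .reverse false) :
    (mem K E t a).phase = .reverse false := by
  rcases late_phase hn ht (hU.of_le htt) (a := a) (fun h' => by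
    rw [phase_terminated_of_le htt h'] at h; cases h) with h' | h'
  · have := (fixed_of_le htt h' (by rw [h]; simp) (by rw [h]; simp)).1
    rcases this with h2 | h2 <;> rw [h] at h2 <;> cases h2
  · exact h'

theorem request_reverse_false {t : ℕ} {a : Agent} (h : (mem K E (t + 1) a).phase = .reverse false) :
    ∃ i, (mem K E (t + 1) a).ID = some i ∧
      requestAt (Alg K) E t a = some ((direction i t).relabel (E.flipped a)) := by
  have hw := wellFormed_mem (K := K) (E := E) (t := t + 1) (a := a) (by rw [h]; simp)
  rw [Memory.WellFormed, h] at hw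
  obtain ⟨i, hi, hd⟩ := hw
  refine ⟨i, hi, ?_⟩
  rw [request_of_phase (by rw [h]; simp) (by rw [h]; simp) (by rw [h]; simp), hd, mem_tTime,
    Nat.add_sub_cancel]

/-- If the agents have not caught each other before the timeout, both know the size of the ring. -/
theorem size_known_of_timeout (hn : 3 ≤ n) (hU : Uncaught K E (timeout n)) (a : Agent)
    (hT : ∀ b, (mem K E (timeout n) b).phase ≠ .terminated) :
    (mem K E (timeout n) a).size ≠ none := by
  intro hs
  have h20 := le_timeout hn
  have hT' : ∀ b t, t ≤ timeout n → (mem K E t b).phase ≠ .terminated :=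
    fun b t ht h => hT b (phase_terminated_of_le ht h)
  have ha : ∀ t, 6 * n + 4 ≤ t → t ≤ timeout n → (mem K E t a).phase = .reverse false := by
    intro t h1 h2
    rcases late_phase hn h1 (hU.of_le h2) (hT' a t h2) with h | h
    · exfalso
      have hw := wellFormed_mem (hU.of_le h2 a)
      rw [Memory.WellFormed] at hw
      have := size_mono h2 hs
      rcases h with h | h <;> rw [h, this] at hw <;> cases hw.1
    · exact h
  obtain ⟨i, hi, -⟩ := request_reverse_false (ha (6 * n + 3 + 1) (by omega) (by omega))
  obtain ⟨ip, isz, -⟩ := ID_bound hn hi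
  have hreqa : ∀ r, 6 * n + 4 ≤ r → r < timeout n →
      requestAt (Alg K) E r a = some ((direction i r).relabel (E.flipped a)) := by
    intro r h1 h2
    obtain ⟨i₂, h3, h4⟩ := request_reverse_false (ha (r + 1) (by omega) (by omega))
    rw [ID_of_le (by omega) hi] at h3
    rw [h4, ← Option.some.inj h3]
  -- the identifier of the other agent, if any
  obtain ⟨i', hne, sz', p', hi'⟩ : ∃ i', i ≠ i' ∧ Nat.size i' ≤ 3 * (Nat.clog 2 n + 3) ∧ 0 < i' ∧
      ∀ t x, t ≤ timeout n → (mem K E t (!a)).ID = some x → x = i' := by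
    rcases hx : (mem K E (timeout n) (!a)).ID with _ | x
    · obtain ⟨y, y1, y2, y3⟩ : ∃ y, i ≠ y ∧ Nat.size y ≤ 2 ∧ 0 < y := by
        by_cases h1 : i = 1
        · exact ⟨2, by omega, by decide, by omega⟩
        · exact ⟨1, h1, by decide, by omega⟩
      refine ⟨y, y1, by omega, y3, fun t x ht h => ?_⟩
      rw [ID_of_le ht h] at hx
      cases hx
    · obtain ⟨xp, xs, -⟩ := ID_bound hn hx
      refine ⟨x, ID_ne hn (ID_of_le (by omega) hi) hx, xs, xp, fun t y ht h => ?_⟩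
      rw [ID_of_le ht h] at hx
      exact Option.some.inj hx
  obtain ⟨j, j1, j2, ⟨u, σ, u1, u2, u3⟩, hblock, -⟩ :=
    exists_agreement hn hne isz sz' ip p' (E.flipped a) (E.flipped (!a))
  have hjj : 2 ^ (j + 1) ≤ 2 ^ (j + 2) := Nat.pow_le_pow_right (by norm_num) (by omega)
  have hjj' : 2 ^ j ≤ 2 ^ (j + 1) := Nat.pow_le_pow_right (by norm_num) (by omega)
  have agent_cases : ∀ (p : Agent → Prop), p a → p (!a) → ∀ b, p b := by
    intro p h1 h2 b
    by_cases hb : b = a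
    · rw [hb]; exact h1
    · obtain rfl : b = !a := by cases a <;> cases b <;> simp_all
      exact h2
  -- If the other agent has a fixed direction by the end of phase j, the schedule of `a` prescribes
  -- that direction for 5n rounds in phase j + 1. Otherwise both agents followed their schedules
  -- throughout phase j, which contains a block of agreement.
  rcases late_phase hn (show 6 * n + 4 ≤ 2 ^ (j + 1) by omega) (hU.of_le (by omega))
    (hT' (!a) _ (by omega)) with h | h
  · obtain ⟨u, u1, u2, u3⟩ := hblock
      (((mem K E (2 ^ (j + 1)) (!a)).dir.relabel (E.flipped (!a))).relabel (E.flipped a))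
    refine size_known_of_run hn (hU.of_le (show u + 5 * n ≤ timeout n by omega))
      (σ := (mem K E (2 ^ (j + 1)) (!a)).dir.relabel (E.flipped (!a)))
      (agent_cases _ (fun r h1 h2 => ?_) fun r h1 h2 => ?_) a (size_mono (by omega) hs)
    · rw [hreqa r (by omega) (by omega), u3 r h1 h2, Side.relabel_relabel]
    · have hf := fixed_of_le (show 2 ^ (j + 1) ≤ r + 1 by omega) h (hU.of_le (by omega) (!a))
        (hT' (!a) _ (by omega))
      rw [request_of_phase (hU.of_le (by omega) (!a)) (hT' (!a) _ (by omega))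
        (by rcases hf.1 with h | h <;> rw [h] <;> simp), hf.2]
  · refine size_known_of_run hn (hU.of_le (show u + 5 * n ≤ timeout n by omega)) (σ := σ)
      (agent_cases _ (fun r h1 h2 => ?_) fun r h1 h2 => ?_) a (size_mono (by omega) hs)
    · rw [hreqa r (by omega) (by omega), (u3 r h1 h2).1]
    · have hrf := reverse_false_of_le hn (show r + 1 ≤ 2 ^ (j + 1) by omega) (by omega)
        (hU.of_le (by omega)) h
      obtain ⟨x, x1, x2⟩ := request_reverse_false hrf
      rw [x2, hi' _ x (by omega) x1, (u3 r h1 h2).2]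

/-- If the agents have not caught each other by the time `t`, a time after the timeout, an agent
that has not terminated knows the size of the ring. -/
theorem size_known_after_timeout (hn : 3 ≤ n) {t : ℕ} (ht : timeout n ≤ t) (hU : Uncaught K E t)
    (a : Agent) (hT : (mem K E t a).phase ≠ .terminated) : (mem K E t a).size ≠ none := by
  have key : (mem K E (timeout n) a).size ≠ none := by
    refine size_known_of_timeout hn (hU.of_le ht) a fun b hb => ?_
    rcases terminated_before_timeout hn hb with h | h
    · exact hT (phase_terminated_of_le ht (h.1 a))
    · omega
  exact fun h => key (size_mono ht h)

/-- The direction changes in each late phase. -/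
theorem exists_direction_change {i j : ℕ} (hj : basePhase i < j) :
    ∃ r, 2 ^ j < r ∧ r < 2 ^ (j + 1) ∧ direction i r ≠ direction i (r - 1) := by
  by_contra! hcon
  have const : ∀ r, 2 ^ j ≤ r → r < 2 ^ (j + 1) → direction i r = direction i (2 ^ j) := by
    intro r hr
    induction r, hr using Nat.le_induction with
    | base => exact fun _ => rfl
    | succ r hr ih =>
      intro h
      have := hcon (r + 1) (by omega) h
      rw [this, Nat.add_sub_cancel, ih (by omega)]
  have hpos := Nat.two_pow_pos (j - basePhase i)
  obtain ⟨u, u1, u2, u3⟩ := exists_block i j hj .left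
  obtain ⟨v, v1, v2, v3⟩ := exists_block i j hj .right
  have h1 := u3 u le_rfl (by omega)
  have h2 := v3 v le_rfl (by omega)
  rw [const u u1 (by omega)] at h1
  rw [const v v1 (by omega), h1] at h2
  cases h2

/-- If the agents do not catch each other, they terminate. -/
theorem terminated_of_uncaught (hn : 3 ≤ n) (hU : Uncaught K E (5 * timeout n)) (a : Agent) :
    (mem K E (5 * timeout n) a).phase = .terminated := by
  by_contra hT
  have h20 := le_timeout hn
  have hT' : ∀ t, t ≤ 5 * timeout n → (mem K E t a).phase ≠ .terminated :=
    fun t ht h => hT (phase_terminated_of_le ht h)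
  have hsz : ∀ t, timeout n ≤ t → t < 5 * timeout n →
      ((mem K E t a).track (view K E t a)).size = some n := by
    intro t h1 h2
    have hU' : Uncaught K E t := hU.of_le h2.le
    have := size_known_after_timeout hn h1 hU' a (hT' t h2.le)
    obtain ⟨s, hs⟩ := Option.isSome_iff_exists.1
      (Memory.size_isSome_compute (o := view K E t a) (Option.isSome_iff_ne_none.2 this))
    have hs' : (mem K E (t + 1) a).size = some s := by rw [mem_succ]; exact hs
    rw [← Memory.track_compute_size, hs, (size_eq hn (hU' a) hs').1]
  have nofix : ∀ t, timeout n + 1 ≤ t → t < 5 * timeout n → ¬ (mem K E t a).phase.IsFixed := by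
    intro t h1 h2 hf
    have hc : (view K E t a).isCatch = false :=
      isCatch_eq_false (hU.of_le (by omega) a) (hT' t h2.le)
    apply hT' (t + 1) (by omega)
    rw [mem_succ, Memory.tick_phase]
    rcases hf with h | h
    · rw [Memory.compute_happy h hc (hsz t (by omega) h2), if_pos (by rw [mem_tTime]; omega)]
      rfl
    · rw [Memory.compute_reverse_true h hc (hsz t (by omega) h2), if_pos (by rw [mem_tTime]; omega)]
      rfl
  have hrev : ∀ t, timeout n + 1 ≤ t → t < 5 * timeout n → (mem K E t a).phase = .reverse false :=
    fun t h1 h2 => (late_phase hn (by omega) (hU.of_le h2.le) (hT' t h2.le)).resolve_left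
      (nofix t h1 h2)
  obtain ⟨i, hi, -⟩ := request_reverse_false (hrev (timeout n + 1) le_rfl (by omega))
  obtain ⟨-, isz, -⟩ := ID_bound hn hi
  -- The first phase that begins after the timeout ends by four times the timeout.
  have j1 := Nat.le_pow_clog (b := 2) (by norm_num) (timeout n + 1)
  have j2 := Nat.pow_pred_clog_lt_self (b := 2) (by norm_num) (x := timeout n + 1) (by omega)
  have j3 : 2 ^ Nat.clog 2 (timeout n + 1) = 2 * 2 ^ (Nat.clog 2 (timeout n + 1)).pred := by
    have hpos : 0 < Nat.clog 2 (timeout n + 1) := Nat.clog_pos (by norm_num) (by omega)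
    conv_lhs => rw [← Nat.succ_pred_eq_of_pos hpos, pow_succ]
    ring
  set j := Nat.clog 2 (timeout n + 1) with hj
  have hb : basePhase i < j := by
    rw [← Nat.pow_lt_pow_iff_right (a := 2) (by norm_num)]
    refine (two_pow_basePhase_lt i).trans_le (le_trans ?_ j1)
    unfold timeout
    nlinarith [Nat.zero_le (Nat.clog 2 n)]
  obtain ⟨r, r1, r2, r3⟩ := exists_direction_change hb
  rw [pow_succ] at r2
  have hlt : r + 1 < 5 * timeout n := by omega
  have hr := hrev r (by omega) (by omega)
  have hc : (view K E r a).isCatch = false :=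
    isCatch_eq_false (hU.of_le (by omega) a) (hT' r (by omega))
  -- A change of the scheduled direction with known ring size fixes the direction.
  apply nofix (r + 1) (by omega) hlt
  right
  rw [mem_succ, Memory.tick_phase, Memory.compute_reverse_false hr hc (ID_of_le (by omega) hi),
    mem_tTime, if_pos r3]
  simp [Memory.enterReverse, Memory.enter, hsz r (by omega) (by omega)]

end Run

end DynamicRing

namespace DynamicRing

/-! ### The procedure that is followed once the agents have caught each other -/

/-- Whether the other agent is at the same node, on a port. -/
def Snapshot.otherOnPort (o : Snapshot) : Bool :=
  match o.other with
  | some (some _) => true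
  | _ => false

/-- The states of the procedure.  The agent that is on the port when the agents catch each other
walks forward for ever (`walk`).  The other one bounces backward until it has been blocked for long
enough (`bounce`), and then comes back (`back`).  When it reaches the walker, which is blocked, it
waits for a round (`hold`); a walker that knows that the ring has been explored leaves its port in
this round (`pause`), any other one insists (`hear`).  If the walker is still blocked after this
round, it leaves its port (`pause`); an agent that has come back knowing that the ring has been
explored stays with it (`answer`), any other one starts to bounce again. -/
inductive CatchMode
  | walk
  | hear
  | pause
  | bounce
  | back
  | hold
  | answer
  | done

/-- The variables of the procedure. -/
structure CatchMemory where
  mode : CatchMode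
  /-- the common forward direction -/
  fwd : Side
  /-- the direction of the last attempted move -/
  dir : Side
  /-- right moves minus left moves since the start at the landmark -/
  pos : ℤ
  /-- the ring size, once a full loop around the ring has been made -/
  size : Option ℕ
  /-- rounds since the agents caught each other -/
  time : ℕ
  /-- moves of the present bounce -/
  steps : ℕ
  /-- blocked rounds of the present bounce -/
  blocked : ℕ
  /-- the walker is ahead by at least this number of edges if the ring is not explored -/
  credit : ℕ
  act : Act

namespace CatchMemory

/-- Update of the counters. -/
def track (q : CatchMemory) (o : Snapshot) : CatchMemory :=
  let p := if o.moved then q.pos + q.dir.sign else q.pos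
  { q with
    pos := p
    size := if q.size = none ∧ o.isLandmark = true ∧ p ≠ 0 then some p.natAbs else q.size
    time := q.time + 1
    steps := if o.moved then q.steps + 1 else q.steps
    blocked := if o.myPos.isSome then q.blocked + 1 else q.blocked
    credit := if o.moved then q.credit - 1 else q.credit }

/-- Try to move in direction `s`. -/
def go (q : CatchMemory) (p : CatchMode) (s : Side) : CatchMemory :=
  { q with mode := p, dir := s, act := .move s }

/-- Stay in the node. -/
def rest (q : CatchMemory) (p : CatchMode) : CatchMemory := { q with mode := p, act := .stay }

/-- Terminate. -/
def finish (q : CatchMemory) : CatchMemory := { q with mode := .done, act := .terminate }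

/-- The time limit, for an agent that knows the size of the ring. -/
def expired (q : CatchMemory) : Bool :=
  match q.size with
  -- Both agents know n by this time unless they are about to stop anyway, see
  -- `Joint.known_of_expired`.
  | some n => decide (200 * n ≤ q.time)
  | none => false

/-- The choice of the next action. -/
def decide (q : CatchMemory) (o : Snapshot) : CatchMemory :=
  if q.expired then q.finish else
  match q.mode with
  | .walk =>
    if o.together then
      if o.myPos.isSome && !o.otherOnPort then
        if q.size.isSome then q.rest .pause else q.go .hear q.fwd
      else q.finish
    else q.go .walk q.fwd
  | .hear => if o.myPos.isSome then q.rest .pause else q.go .walk q.fwd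
  | .pause => if o.together && !o.otherOnPort then q.finish else q.go .walk q.fwd
  | .bounce =>
    if o.together && !o.myPos.isSome then q.finish
    -- With this threshold 3 (steps + blocked - 1) exceeds 5 steps + blocked + 1, so the new credit
    -- pays for the whole bounce in the potential.
    else if q.steps + 3 ≤ q.blocked ∨ q.size.isSome = true then
      { q with credit := q.steps + q.blocked - 1 }.go .back q.fwd
    else q.go .bounce q.fwd.opp
  | .back =>
    if o.together then
      if !o.myPos.isSome && o.otherOnPort then q.rest .hold else q.finish
    else q.go .back q.fwd
  | .hold =>
    if o.together then
      if o.otherOnPort then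
        -- A meeting despite a positive credit means that the walker is ahead by at least n edges.
        if 0 < q.credit ∨ q.size.isSome = true then q.rest .answer
        else { q with steps := 0, blocked := 0 }.go .bounce q.fwd.opp
      else q.finish
    else q.go .back q.fwd
  | .answer => q.finish
  | .done => q.finish

/-- The variables when the agents catch each other, for the memory `m` of the algorithm.  An agent
that knows the size of the ring is done if the timeout has passed. -/
def start (m : Memory) (o : Snapshot) : CatchMemory where
  mode :=
    -- After the timeout the other agent may have terminated already, and cooperation would be
    -- impossible; by then every active agent knows n.
    if (match m.size with | some n => Decidable.decide (timeout n ≤ m.tTime) | none => false)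
    then .done
    else if o.myPos.isSome then .walk else .back
  fwd :=
    match o.myPos, o.other with
    | some s, _ => s
    | none, some (some s) => s
    | _, _ => .left
  dir := m.dir
  pos := m.pos
  size := m.size
  time := 0
  steps := 0
  blocked := 0
  credit := 0
  act := .stay

end CatchMemory

/-- One round, for the memory of the algorithm together with that of the procedure. -/
def catchStep (st : Memory × Option CatchMemory) (o : Snapshot) : Memory × Option CatchMemory :=
  let m := st.1.compute o
  (m.tick,
    match st.2 with
    | some q => some ((q.track o).decide o)
    | none =>
      match m.phase with
      | .caught => some ((CatchMemory.start m o).decide o)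
      | _ => none)

/-- The procedure as a protocol. -/
def catchProtocol : Protocol := fun h =>
  match (h.foldl catchStep (Memory.init, none)).2 with
  | some q => q.act
  | none => .stay

section Catch

variable {n : ℕ} (E : Environment n)

/-- The complete algorithm. -/
local notation "Full" => startFromLandmarkNoChirality catchProtocol

/-- The variables of the procedure after `t` rounds. -/
def catchMem (t : ℕ) (a : Agent) : Option CatchMemory :=
  ((execution Full E t a).history.foldl catchStep (Memory.init, none)).2

/-- The variables of the procedure in round `t`, before the choice of the action. -/
def present (t : ℕ) (a : Agent) : CatchMemory :=
  match catchMem E t a with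
  | some q => q.track (view catchProtocol E t a)
  | none => CatchMemory.start ((mem catchProtocol E t a).compute (view catchProtocol E t a))
      (view catchProtocol E t a)

variable {E}

/-- The procedure receives the whole history, so it replays the memory of the algorithm in order to
recognise the round of the catch. -/
theorem catchStep_fst (h : List Snapshot) (st : Memory × Option CatchMemory) :
    (h.foldl catchStep st).1 = h.foldl (fun m o => (m.compute o).tick) st.1 := by
  induction h generalizing st with
  | nil => rfl
  | cons o h ih => rw [List.foldl_cons, ih, List.foldl_cons]; rfl

theorem catchMem_succ (t : ℕ) (a : Agent) : catchMem E (t + 1) a =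
    match catchMem E t a with
    | some q => some ((q.track (view catchProtocol E t a)).decide (view catchProtocol E t a))
    | none =>
      match ((mem catchProtocol E t a).compute (view catchProtocol E t a)).phase with
      | .caught => some ((CatchMemory.start
          ((mem catchProtocol E t a).compute (view catchProtocol E t a))
          (view catchProtocol E t a)).decide (view catchProtocol E t a))
      | _ => none := by
  have e : ((execution Full E t a).history.foldl catchStep (Memory.init, none)).1 =
      mem catchProtocol E t a := catchStep_fst _ _
  rw [catchMem, history_succ, List.foldl_append, List.foldl_cons, List.foldl_nil, catchStep, e]
  rfl

theorem catchMem_eq_none {t : ℕ} {a : Agent} (h : (mem catchProtocol E t a).phase ≠ .caught) :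
    catchMem E t a = none := by
  induction t with
  | zero => rfl
  | succ t ih =>
    rw [catchMem_succ, ih (phase_ne_caught_of_succ h)]
    rw [mem_succ, Memory.tick_phase] at h
    simp only

theorem catchMem_succ_eq {t : ℕ} {a : Agent} (h : (mem catchProtocol E (t + 1) a).phase = .caught) :
    catchMem E (t + 1) a = some ((present E t a).decide (view catchProtocol E t a)) := by
  rw [catchMem_succ, present]
  rcases hq : catchMem E t a with _ | q
  · rw [mem_succ, Memory.tick_phase] at h
    simp only [h]
  · rfl

theorem present_succ {t : ℕ} {a : Agent} (h : (mem catchProtocol E (t + 1) a).phase = .caught) :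
    present E (t + 1) a = ((present E t a).decide (view catchProtocol E t a)).track
      (view catchProtocol E (t + 1) a) := by
  rw [present, catchMem_succ_eq h]

theorem compute_catch_eq {t : ℕ} {a : Agent} (h : (mem catchProtocol E (t + 1) a).phase = .caught)
    (hT : (execution Full E t a).terminated = false) :
    compute Full E (execution Full E t) a =
      ((present E t a).decide (view catchProtocol E t a)).act := by
  have hm : memory ((execution Full E t a).history ++ [look E (execution Full E t) a]) =
      mem catchProtocol E (t + 1) a := by
    rw [mem, memoryAt, history_succ]
  have hq : (((execution Full E t a).history ++ [look E (execution Full E t) a]).foldl catchStep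
      (Memory.init, none)).2 = some ((present E t a).decide (view catchProtocol E t a)) := by
    rw [← catchMem_succ_eq h, catchMem, history_succ]
  unfold compute
  rw [hT]
  simp only [Bool.false_eq_true, if_false, startFromLandmarkNoChirality, hm, h]
  rw [catchProtocol, hq]

theorem request_go {t : ℕ} {a : Agent} (h : (mem catchProtocol E (t + 1) a).phase = .caught)
    (hT : (execution Full E t a).terminated = false) {s : Side}
    (hact : ((present E t a).decide (view catchProtocol E t a)).act = .move s) :
    requestAt Full E t a = some (s.relabel (E.flipped a)) ∧
      (execution Full E (t + 1) a).terminated = false := by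
  have hc := compute_catch_eq h hT
  rw [hact] at hc
  refine ⟨by simp only [requestAt, request, hc], ?_⟩
  rw [← Bool.not_eq_true, terminated_succ, hc]
  simp

theorem request_rest {t : ℕ} {a : Agent} (h : (mem catchProtocol E (t + 1) a).phase = .caught)
    (hT : (execution Full E t a).terminated = false)
    (hact : ((present E t a).decide (view catchProtocol E t a)).act = .stay) :
    requestAt Full E t a = none ∧ (execution Full E (t + 1) a).terminated = false := by
  have hc := compute_catch_eq h hT
  rw [hact] at hc
  refine ⟨by simp only [requestAt, request, hc], ?_⟩
  rw [← Bool.not_eq_true, terminated_succ, hc]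
  simp

theorem terminated_finish {t : ℕ} {a : Agent} (h : (mem catchProtocol E (t + 1) a).phase = .caught)
    (hact : ((present E t a).decide (view catchProtocol E t a)).act = .terminate) :
    (execution Full E (t + 1) a).terminated = true := by
  by_cases hT : (execution Full E t a).terminated = true
  · exact terminated_mono_succ hT
  · rw [terminated_succ, compute_catch_eq h (by simpa using hT), hact]

theorem decide_pos (q : CatchMemory) (o : Snapshot) : (q.decide o).pos = q.pos := by
  unfold CatchMemory.decide
  simp only [CatchMemory.finish, CatchMemory.rest, CatchMemory.go]
  repeat' first | rfl | split

theorem decide_size (q : CatchMemory) (o : Snapshot) : (q.decide o).size = q.size := by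
  unfold CatchMemory.decide
  simp only [CatchMemory.finish, CatchMemory.rest, CatchMemory.go]
  repeat' first | rfl | split

theorem decide_fwd (q : CatchMemory) (o : Snapshot) : (q.decide o).fwd = q.fwd := by
  unfold CatchMemory.decide
  simp only [CatchMemory.finish, CatchMemory.rest, CatchMemory.go]
  repeat' first | rfl | split

theorem decide_time (q : CatchMemory) (o : Snapshot) : (q.decide o).time = q.time := by
  unfold CatchMemory.decide
  simp only [CatchMemory.finish, CatchMemory.rest, CatchMemory.go]
  repeat' first | rfl | split

theorem decide_act (q : CatchMemory) (o : Snapshot) (s : Side) (h : (q.decide o).act = .move s) :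
    (q.decide o).dir = s := by
  revert h
  unfold CatchMemory.decide
  simp only [CatchMemory.finish, CatchMemory.rest, CatchMemory.go]
  repeat' split
  all_goals simp

/-! ### Dead reckoning during the procedure -/

variable (E) in
/-- The agent `x` is at distance `p` from the landmark, in the direction `d`; it has visited all
nodes between the distances `c` and `p`, and it knows the size `z` of the ring if it is known. -/
structure Tracked (d : Side) (t : ℕ) (x : Agent) (c p : ℤ) (z : Option ℕ) : Prop where
  node : nodeAt Full E t x = E.landmark + ((d.sign * p : ℤ) : ZMod n)
  reach₀ : ∀ k, (0 ≤ k ∧ k ≤ p) ∨ (p ≤ k ∧ k ≤ 0) →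
    ∃ s ≤ t, nodeAt Full E s x = E.landmark + ((d.sign * k : ℤ) : ZMod n)
  reach : ∀ k, (c ≤ k ∧ k ≤ p) ∨ (p ≤ k ∧ k ≤ c) →
    ∃ s ≤ t, nodeAt Full E s x = E.landmark + ((d.sign * k : ℤ) : ZMod n)
  small : z = none → |p| < n ∧ |c| < n
  known : ∀ s, z = some s → s = n ∧ ExploredBy Full E t

theorem explored_of_interval (hn : 3 ≤ n) {t : ℕ} (d : Side) (lo hi : ℤ) (h : lo + n ≤ hi + 1)
    (hv : ∀ k, lo ≤ k → k ≤ hi →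
      ∃ s ≤ t, ∃ x, nodeAt Full E s x = E.landmark + ((d.sign * k : ℤ) : ZMod n)) :
    ExploredBy Full E t := by
  intro v
  obtain ⟨k, h1, h2, h3⟩ := exists_int_rep hn (((d.sign : ℤ) : ZMod n) * (v - E.landmark)) lo
  obtain ⟨s, hs, x, hx⟩ := hv k h1 (by omega)
  refine ⟨s, hs, x, ?_⟩
  have hssq : ((d.sign : ℤ) : ZMod n) * (d.sign : ℤ) = 1 := by
    rw [← Int.cast_mul, sign_sq, Int.cast_one]
  rw [show (execution Full E s x).node = nodeAt Full E s x from rfl, hx]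
  push_cast
  rw [h3, ← mul_assoc, hssq]
  ring

theorem Tracked.landmark_iff {d : Side} {t : ℕ} {x : Agent} {p : ℤ}
    (h : nodeAt Full E t x = E.landmark + ((d.sign * p : ℤ) : ZMod n)) :
    nodeAt Full E t x = E.landmark ↔ (n : ℤ) ∣ p := by
  rw [h, add_eq_left, intCast_eq_zero_iff]
  constructor
  · intro hd
    have := hd.mul_left d.sign
    rwa [← mul_assoc, sign_sq, one_mul] at this
  · exact fun hd => hd.mul_left _

/-- The argument of `abs_disp_lt` and `size_eq`, for unit steps that need not come from the
algorithm: the first return to the landmark with non-zero position happens at n or -n. -/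
theorem Tracked.succ (hn : 3 ≤ n) {d : Side} {t : ℕ} {x : Agent} {c p p' : ℤ} {z z' : Option ℕ}
    (h : Tracked E d t x c p z)
    (hnode : nodeAt Full E (t + 1) x = E.landmark + ((d.sign * p' : ℤ) : ZMod n))
    (hp : p' = p ∨ p' = p + 1 ∨ p' = p - 1)
    (hz : z' = if z = none ∧ nodeAt Full E (t + 1) x = E.landmark ∧ p' ≠ 0
      then some p'.natAbs else z) : Tracked E d (t + 1) x c p' z' := by
  have r0 : ∀ k, (0 ≤ k ∧ k ≤ p') ∨ (p' ≤ k ∧ k ≤ 0) →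
      ∃ s ≤ t + 1, nodeAt Full E s x = E.landmark + ((d.sign * k : ℤ) : ZMod n) := by
    intro k hk
    by_cases he : k = p'
    · exact ⟨t + 1, le_rfl, by rw [he]; exact hnode⟩
    · obtain ⟨s, hs, hs'⟩ := h.reach₀ k (by omega)
      exact ⟨s, by omega, hs'⟩
  refine ⟨hnode, r0, fun k hk => ?_, fun hz0 => ?_, fun s hs => ?_⟩
  · by_cases he : k = p'
    · exact ⟨t + 1, le_rfl, by rw [he]; exact hnode⟩
    · obtain ⟨s, hs, hs'⟩ := h.reach k (by omega)
      exact ⟨s, by omega, hs'⟩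
  · rw [hz] at hz0
    split at hz0
    · cases hz0
    · rename_i hc
      obtain ⟨h1, h2⟩ := h.small hz0
      refine ⟨?_, h2⟩
      rw [Tracked.landmark_iff hnode] at hc
      have hle : |p'| ≤ n := by
        rw [abs_lt] at h1
        rw [abs_le]
        omega
      refine lt_of_le_of_ne hle fun he => hc ⟨hz0, ?_, ?_⟩
      · rw [← dvd_abs, he]
      · intro h0
        rw [h0] at he
        simp at he
        omega
  · rw [hz] at hs
    split at hs
    · rename_i hc
      obtain ⟨h1, h2⟩ := h.small hc.1
      have hle : |p'| ≤ n := by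
        rw [abs_lt] at h1
        rw [abs_le]
        omega
      have hdvd := (Tracked.landmark_iff hnode).1 hc.2.1
      have habs : |p'| = n :=
        le_antisymm hle (Int.le_of_dvd (abs_pos.2 hc.2.2) ((dvd_abs _ _).2 hdvd))
      refine ⟨?_, ?_⟩
      · have h3 := Option.some.inj hs
        have h4 := (Int.natCast_natAbs p').trans habs
        omega
      · refine explored_of_interval hn d (min 0 p') (max 0 p') ?_ fun k k1 k2 => ?_
        · rcases abs_cases p' with h' | h' <;> omega
        · obtain ⟨s, hs, hs'⟩ := r0 k (by omega)
          exact ⟨s, hs, x, hs'⟩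
    · have := h.known s hs
      exact ⟨this.1, this.2.mono (Nat.le_succ t)⟩

end Catch

end DynamicRing

namespace DynamicRing

/-! ### The stages of the procedure -/

/-- The situation of both agents in a round of the procedure: the walker `W`, which was on the port
when the agents caught each other, and the bouncer `B`.  The positions are measured in the forward
direction from the common node in which the agents caught each other; the counters are those of the
bouncer. -/
structure JointState where
  together : Prop
  explored : Prop
  portW : Prop
  portB : Prop
  knownW : Prop
  knownB : Prop
  -- Positions are not reduced modulo n, so the gap posW - posB also counts laps.
  posW : ℤ
  posB : ℤ
  time : ℤ
  credit : ℤ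
  steps : ℤ
  blocked : ℤ

namespace JointState

/-- What holds in every round, whatever the agents do. -/
structure Valid (n : ℤ) (s : JointState) : Prop where
  exploredW : s.knownW → s.explored
  exploredB : s.knownB → s.explored
  explored : n - 1 ≤ s.posW - s.posB → s.explored
  together : s.together ↔ n ∣ s.posW - s.posB
  smallW : ¬ s.knownW → -2 * n < s.posW ∧ s.posW < 2 * n
  smallB : ¬ s.knownB → -2 * n < s.posB ∧ s.posB < 2 * n
  credit : 0 ≤ s.credit
  steps : 0 ≤ s.steps
  blocked : 0 ≤ s.blocked

/-- The time passes, and what is known remains known. -/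
structure Next (s s' : JointState) : Prop where
  time : s'.time = s.time + 1
  explored : s.explored → s'.explored
  knownW : s.knownW → s'.knownW
  knownB : s.knownB → s'.knownB

/-- The walker has tried to move forward, and has not been denied access. -/
def WalkerMoves (s s' : JointState) : Prop :=
  (s'.posW = s.posW + 1 ∧ ¬ s'.portW) ∨ (s'.posW = s.posW ∧ s'.portW)

/-- The bouncer, with the given counters, has tried to move, and has not been denied access. -/
def BouncerMoves (ε credit steps blocked : ℤ) (s s' : JointState) : Prop :=
  (s'.posB = s.posB + ε ∧ ¬ s'.portB ∧ s'.credit = max (credit - 1) 0 ∧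
    s'.steps = steps + 1 ∧ s'.blocked = blocked) ∨
  (s'.posB = s.posB ∧ s'.portB ∧ s'.credit = credit ∧ s'.steps = steps ∧
    s'.blocked = blocked + 1 ∧ (s'.knownB → s.knownB))

/-- The walker walks forward, and the bouncer comes back. -/
structure WalkBack (n : ℤ) (s : JointState) : Prop where
  gap : 0 ≤ s.posW - s.posB
  credit : ¬ s.explored → s.credit ≤ s.posW - s.posB
  -- The gap can drop from 1 to 0 only when the walker is blocked and the bouncer moves.
  meet : ¬ s.explored → s.posW - s.posB = 0 → s.portW ∧ ¬ s.portB
  credit_le : s.credit ≤ 8 * n + 6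
  -- Each round raises the potential posW + 4 posB + 3 credit by at least one. The reserve 10n
  -- covers a bounce cut short because the bouncer learned n.
  time : ¬ s.knownW → s.time ≤ s.posW + 4 * s.posB + 3 * s.credit + 10 * n
  time' : ¬ s.knownW → ¬ s.knownB → s.time ≤ s.posW + 4 * s.posB + 3 * s.credit
  -- Once the walker knows n its position is unbounded, so it is replaced by the distance δ to the
  -- walker modulo n.
  late : s.knownW → ¬ s.knownB → ∃ δ, 1 ≤ δ ∧ δ ≤ n ∧ n ∣ s.posW - s.posB - δ ∧
    s.time ≤ 80 * n + 2 * s.posB + δ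

/-- The bouncer waits for a round, while the walker tries to walk on. -/
structure HearHold (n : ℤ) (s : JointState) : Prop where
  gap : 0 ≤ s.posW - s.posB
  credit : ¬ s.explored → s.credit ≤ s.posW - s.posB
  credit_le : s.credit ≤ 8 * n + 6
  posW : s.posW ≤ 2 * n
  port : s.together ↔ s.portW
  -- The last summand pays for the round of waiting, in which no position changes if the walker
  -- remains blocked.
  time : s.time ≤ s.posW + 4 * s.posB + 3 * s.credit + 10 * n + 1
  time_blocked : ¬ s.knownB → s.time ≤ s.posW + 4 * s.posB + 3 * s.credit + 1
  time_moved : ¬ s.portW → s.time ≤ s.posW + 4 * s.posB + 3 * s.credit + 10 * n ∧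
    (¬ s.knownB → s.time ≤ s.posW + 4 * s.posB + 3 * s.credit)

/-- The first step of a bounce, while the walker waits for a round. -/
structure PauseBounce (n : ℤ) (s : JointState) : Prop where
  gap : 0 ≤ s.posW - s.posB
  credit : ¬ s.explored → s.steps + s.blocked ≤ s.posW - s.posB + 1
  posW : s.posW ≤ 2 * n
  posB : -2 * n ≤ s.posB
  steps : s.steps + s.posB ≤ 2 * n
  blocked : s.blocked < s.steps + 3
  port : s.together → s.portB ∧ ¬ s.knownB
  time : s.time ≤ s.posW + 4 * s.posB + 5 * s.steps + s.blocked + 1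

/-- The walker walks forward, and the bouncer bounces backward. -/
structure WalkBounce (n : ℤ) (s : JointState) : Prop where
  gap : 0 ≤ s.posW - s.posB
  gap_pos : ¬ s.explored → 1 ≤ s.posW - s.posB
  credit : ¬ s.explored → s.steps + s.blocked ≤ s.posW - s.posB + 1
  posB : -2 * n ≤ s.posB
  steps : s.steps + s.posB ≤ 2 * n
  blocked : s.blocked ≤ s.steps + 3
  port : s.together → ¬ s.portW ∧ ¬ s.portB
  -- A backward step of the bouncer yields 5 - 4 and a blocked round yields 1, so the right-hand
  -- side keeps pace with the time.
  time : ¬ s.knownW → s.time ≤ s.posW + 4 * s.posB + 5 * s.steps + s.blocked + 1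
  late : s.knownW → s.time ≤ 60 * n + s.steps + s.blocked

/-- Both agents are about to terminate. -/
structure Over (s : JointState) : Prop where
  explored : s.explored
  together : s.together
  portW : ¬ s.portW
  portB : ¬ s.portB

/-- The stage of the procedure, for the states of the walker and of the bouncer. -/
def Stage (n : ℤ) (s : JointState) : CatchMode → CatchMode → Prop
  | .walk, .back => s.WalkBack n
  | .hear, .hold => s.HearHold n
  | .pause, .hold => s.Over
  | .pause, .answer => s.Over
  | .pause, .bounce => s.PauseBounce n
  | .walk, .bounce => s.WalkBounce n
  | _, _ => False

/-- The residue is taken between 1 and n, so that agents that are together count as being n apart.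
-/
theorem exists_dist {n : ℤ} (hn : 3 ≤ n) (g : ℤ) : ∃ δ, 1 ≤ δ ∧ δ ≤ n ∧ n ∣ g - δ := by
  refine ⟨(g - 1) % n + 1, ?_, ?_, ?_⟩
  · have := Int.emod_nonneg (g - 1) (by omega : n ≠ 0)
    omega
  · have := Int.emod_lt_of_pos (g - 1) (by omega : 0 < n)
    omega
  · have := Int.dvd_self_sub_emod (x := g - 1) (m := n)
    rwa [show g - ((g - 1) % n + 1) = g - 1 - (g - 1) % n by ring]

/-! ### Transitions between the stages, as integer arithmetic. -/

variable {n : ℤ} {s s' : JointState}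

/-- A positive gap at a meeting is at least n, which implies exploration. -/
theorem Valid.gap_eq_zero (h : s.Valid n) (hg : 0 ≤ s.posW - s.posB) (ht : s.together)
    (hX : ¬ s.explored) : s.posW - s.posB = 0 := by
  have h1 := h.together.1 ht
  by_contra h2
  have := Int.le_of_dvd (by omega) h1
  exact hX (h.explored (by omega))

theorem Valid.gap_pos (h : s.Valid n) (hg : 0 ≤ s.posW - s.posB) (ht : ¬ s.together) :
    1 ≤ s.posW - s.posB := by
  by_contra h2
  refine ht (h.together.2 ?_)
  rw [show s.posW - s.posB = 0 by omega]
  exact dvd_zero n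

/-- Both agents try to move forward. -/
theorem walkBack_of_moves (hn : 3 ≤ n) (h : s.Valid n) (h' : s'.Valid n) (hs : Next s s')
    {credit steps blocked : ℤ} (hW : WalkerMoves s s')
    (hB : BouncerMoves 1 credit steps blocked s s')
    (hWB : ¬ (s'.portW ∧ s'.portB)) (hT : ¬ s.together)
    (gap : 0 ≤ s.posW - s.posB) (hc : ¬ s.explored → credit ≤ s.posW - s.posB)
    (credit_nonneg : 0 ≤ credit) (credit_le : credit ≤ 8 * n + 6)
    (time : ¬ s.knownW → s.time ≤ s.posW + 4 * s.posB + 3 * credit + 10 * n)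
    (time' : ¬ s.knownW → ¬ s.knownB → s.time ≤ s.posW + 4 * s.posB + 3 * credit)
    (late : s.knownW → ¬ s.knownB → ∃ δ, 1 ≤ δ ∧ δ ≤ n ∧ n ∣ s.posW - s.posB - δ ∧
      s.time ≤ 80 * n + 2 * s.posB + δ) : s'.WalkBack n := by
  have hg := h.gap_pos gap hT
  have ht := hs.time
  -- In the potential a move of the walker is worth 1 and a move of the bouncer at least 4 - 3; both
  -- cannot be blocked.
  have key : s'.credit ≤ 8 * n + 6 ∧ 0 ≤ s'.posW - s'.posB ∧
      (credit ≤ s.posW - s.posB → s'.credit ≤ s'.posW - s'.posB) ∧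
      (s'.posW - s'.posB = 0 → s'.portW ∧ ¬ s'.portB) ∧
      s.posW + 4 * s.posB + 3 * credit + 1 ≤ s'.posW + 4 * s'.posB + 3 * s'.credit := by
    rcases hW with ⟨a1, a2⟩ | ⟨a1, a2⟩ <;> rcases hB with ⟨b1, b2, b3, -⟩ | ⟨b1, b2, b3, -⟩
    · refine ⟨by omega, by omega, by omega, by omega, by omega⟩
    · refine ⟨by omega, by omega, by omega, by omega, by omega⟩
    · refine ⟨by omega, by omega, by omega, fun _ => ⟨a2, b2⟩, by omega⟩
    · exact absurd ⟨a2, b2⟩ hWB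
  obtain ⟨k1, k2, k3, k4, k5⟩ := key
  refine ⟨k2, fun hX => k3 (hc fun hX' => hX (hs.explored hX')), fun _ => k4, k1, fun hw => ?_,
    fun hw hb => ?_, fun hw hb => ?_⟩
  · have := time fun hw' => hw (hs.knownW hw')
    omega
  · have := time' (fun hw' => hw (hs.knownW hw')) fun hb' => hb (hs.knownB hb')
    omega
  · have hb' : ¬ s.knownB := fun hb' => hb (hs.knownB hb')
    by_cases hw' : s.knownW
    · obtain ⟨δ, d1, d2, d3, d4⟩ := late hw' hb'
      have hδ : δ ≠ n := by
        rintro rfl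
        exact hT (h.together.2 ((dvd_sub_self_right).1 d3))
      rcases hW with ⟨a1, a2⟩ | ⟨a1, a2⟩ <;> rcases hB with ⟨b1, b2, b3, -⟩ | ⟨b1, b2, b3, -⟩
      · exact ⟨δ, d1, d2, by rw [a1, b1]; convert d3 using 1; ring, by omega⟩
      · exact ⟨δ + 1, by omega, by omega, by rw [a1, b1]; convert d3 using 1; ring, by omega⟩
      -- From distance 1 the bouncer reaches the walker, and the distance jumps to n.
      · by_cases hδ1 : δ = 1
        · refine ⟨n, by omega, le_rfl, ?_, by omega⟩
          rw [hδ1] at d3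
          rwa [dvd_sub_self_right, show s'.posW - s'.posB = s.posW - s.posB - 1 by omega]
        · exact ⟨δ - 1, by omega, by omega, by rw [a1, b1]; convert d3 using 1; ring, by omega⟩
      · exact absurd ⟨a2, b2⟩ hWB
    · obtain ⟨δ, d1, d2, d3⟩ := exists_dist hn (s'.posW - s'.posB)
      refine ⟨δ, d1, d2, d3, ?_⟩
      have h1 := time hw'
      have h2 := h.smallW hw'
      have h3 := h'.smallB hb
      have h4 := h.smallB hb'
      omega

/-- The agents try to move apart. -/
theorem walkBounce_of_moves (h : s.Valid n) (h' : s'.Valid n) (hs : Next s s')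
    {credit steps blocked : ℤ} (hW : WalkerMoves s s')
    (hB : BouncerMoves (-1) credit steps blocked s s')
    (hWB : s'.portW → s'.portB → n ∣ s'.posW - s'.posB + 1)
    (hT : s'.together → ¬ s'.portW ∧ ¬ s'.portB)
    (gap : 0 ≤ s.posW - s.posB)
    (hc : ¬ s.explored → steps + blocked ≤ s.posW - s.posB + 1)
    (hk : ¬ s.knownB) (h_steps : steps + s.posB ≤ 2 * n) (h_blocked : blocked < steps + 3)
    (time : ¬ s.knownW → s.time ≤ s.posW + 4 * s.posB + 5 * steps + blocked + 1)
    (late : s.knownW → s.time ≤ 60 * n + steps + blocked) : s'.WalkBounce n := by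
  have ht := hs.time
  have hsm := h.smallB hk
  -- Agents blocked on both sides are at the two ends of one edge. The gap is then -1 modulo n,
  -- hence at least n - 1.
  have hblock : ¬ s'.explored → 0 ≤ s'.posW - s'.posB → ¬ (s'.portW ∧ s'.portB) := by
    rintro hX hg ⟨h1, h2⟩
    have := Int.le_of_dvd (by omega) (hWB h1 h2)
    exact hX (h'.explored (by omega))
  have key : 0 ≤ s'.posW - s'.posB ∧ -2 * n ≤ s'.posB ∧ s'.steps + s'.posB ≤ 2 * n ∧
      s'.blocked ≤ s'.steps + 3 ∧ s'.steps + s'.blocked = steps + blocked + 1 ∧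
      s.posW + 4 * s.posB + 5 * steps + blocked + 1 ≤
        s'.posW + 4 * s'.posB + 5 * s'.steps + s'.blocked := by
    rcases hW with ⟨a1, a2⟩ | ⟨a1, a2⟩ <;>
      rcases hB with ⟨b1, b2, b3, b4, b5⟩ | ⟨b1, b2, b3, b4, b5, b6⟩ <;>
      refine ⟨by omega, by omega, by omega, by omega, by omega, by omega⟩
  have gap' : ¬ s'.explored → s.posW - s.posB + 1 ≤ s'.posW - s'.posB := by
    intro hX
    have hb := hblock hX key.1
    rcases hW with ⟨a1, a2⟩ | ⟨a1, a2⟩ <;>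
      rcases hB with ⟨b1, b2, b3, b4, b5⟩ | ⟨b1, b2, b3, b4, b5, b6⟩
    · omega
    · omega
    · omega
    · exact absurd ⟨a2, b2⟩ hb
  obtain ⟨k1, k2, k3, k4, k5, k6⟩ := key
  refine ⟨k1, fun hX => ?_, fun hX => ?_, k2, k3, k4, hT, fun hw => ?_, fun hw => ?_⟩
  · have := gap' hX
    omega
  · have := gap' hX
    have := hc fun hX' => hX (hs.explored hX')
    omega
  · have := time fun hw' => hw (hs.knownW hw')
    omega
  · by_cases hw' : s.knownW
    · have := late hw'
      omega
    · have := time hw'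
      have := h.smallW hw'
      omega

/-- The bouncer returns after a bounce. -/
theorem walkBack_of_bounce (hn : 3 ≤ n) (h : s.Valid n) (h' : s'.Valid n) (hs : Next s s')
    {steps blocked : ℤ} (hW : WalkerMoves s s')
    (hB : BouncerMoves 1 (max (s.steps + s.blocked - 1) 0) steps blocked s s')
    (hWB : ¬ (s'.portW ∧ s'.portB)) (hT : ¬ s.together)
    (gap : 0 ≤ s.posW - s.posB)
    (hc : ¬ s.explored → s.steps + s.blocked ≤ s.posW - s.posB + 1)
    (posB : -2 * n ≤ s.posB) (h_steps : s.steps + s.posB ≤ 2 * n)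
    (h_blocked : s.blocked ≤ s.steps + 3)
    (h_end : s.steps + 3 ≤ s.blocked ∨ s.knownB)
    (time : ¬ s.knownW → s.time ≤ s.posW + 4 * s.posB + 5 * s.steps + s.blocked + 1)
    (late : s.knownW → s.time ≤ 60 * n + s.steps + s.blocked) : s'.WalkBack n := by
  have v1 := h.steps
  have v2 := h.blocked
  have hg := h.gap_pos gap hT
  refine walkBack_of_moves hn h h' hs hW hB hWB hT gap (fun hX => ?_) (by omega) (by omega)
    (fun hw => ?_) (fun hw hb => ?_) (fun hw hb => ?_)
  · have := hc hX
    omega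
  -- A bounce that ends early because n is known leaves a deficit of at most 2 steps + 4, within 10n
  -- as steps ≤ 4n.
  · have := time hw
    omega
  -- If n is not known, the bounce ended by the threshold blocked ≥ steps + 3, and the credit pays
  -- for it entirely.
  · have := time hw
    have := h_end.resolve_right hb
    omega
  · obtain ⟨δ, d1, d2, d3⟩ := exists_dist hn (s.posW - s.posB)
    refine ⟨δ, d1, d2, d3, ?_⟩
    have := late hw
    omega

/-- The agents meet on the way. -/
theorem WalkBack.hearHold (h : s.Valid n) (hs : Next s s') (hS : s.WalkBack n)
    (hW : WalkerMoves s s')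
    (hk : ¬ s.knownW) (hB : s'.posB = s.posB ∧ ¬ s'.portB ∧ s'.credit = s.credit)
    (hT : s'.together ↔ s'.portW) : s'.HearHold n := by
  obtain ⟨b1, b2, b3⟩ := hB
  have ht := hs.time
  have := h.smallW hk
  have t1 := hS.time hk
  have t2 := hS.time' hk
  have g := hS.gap
  have c := hS.credit_le
  have key : s'.posW = s.posW + 1 ∧ ¬ s'.portW ∨ s'.posW = s.posW ∧ s'.portW := hW
  refine ⟨by omega, fun hX => ?_, by omega, by omega, hT, by omega, fun hb => ?_,
    fun hp => ?_⟩
  · have := hS.credit fun hX' => hX (hs.explored hX')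
    omega
  · have := t2 fun hb' => hb (hs.knownB hb')
    omega
  · have := key.resolve_right fun hp' => hp hp'.2
    refine ⟨by omega, fun hb => ?_⟩
    have := t2 fun hb' => hb (hs.knownB hb')
    omega

/-- The bouncer starts to bounce. -/
theorem HearHold.pauseBounce (hn : 3 ≤ n) (h : s.Valid n) (h' : s'.Valid n) (hs : Next s s')
    (hS : s.HearHold n) (hk : ¬ s.knownB) (hc : s.credit = 0) (hT : s.together)
    {credit : ℤ} (hB : BouncerMoves (-1) credit 0 0 s s')
    (hW : s'.posW = s.posW ∧ ¬ s'.portW) : s'.PauseBounce n := by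
  obtain ⟨w1, w2⟩ := hW
  have ht := hs.time
  have := h.smallB hk
  have t1 := hS.time_blocked hk
  have g := hS.gap
  have p := hS.posW
  have g0 : ¬ s'.explored → s.posW - s.posB = 0 := fun hX =>
    h.gap_eq_zero g hT fun hX' => hX (hs.explored hX')
  have hd := h.together.1 hT
  -- A step would make the gap 1 modulo n. So a bouncer still with the walker is on its port and has
  -- learned nothing.
  have key : s'.together → s'.portB ∧ ¬ s'.knownB := by
    intro hT'
    rcases hB with ⟨b1, b2, b3, b4, b5⟩ | ⟨b1, b2, b3, b4, b5, b6⟩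
    · exfalso
      have h1 := h'.together.1 hT'
      rw [w1, b1, show s.posW - (s.posB + -1) = s.posW - s.posB + 1 by ring] at h1
      have h3 := Int.le_of_dvd (by omega) ((Int.dvd_add_right hd).1 h1)
      omega
    · exact ⟨b2, fun hb => hk (b6 hb)⟩
  rcases hB with ⟨b1, b2, b3, b4, b5⟩ | ⟨b1, b2, b3, b4, b5, b6⟩ <;>
    exact ⟨by omega, fun hX => by have := g0 hX; omega, by omega, by omega, by omega, by omega,
      key, by omega⟩

end JointState

end DynamicRing

namespace DynamicRing

section Catch

variable {n : ℕ} {E : Environment n}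

local notation "Full" => startFromLandmarkNoChirality catchProtocol

/-! ### The execution of the procedure -/

variable (E) in
/-- The position of an agent, measured in the global direction `d`. -/
def coord (d : Side) (t : ℕ) (x : Agent) : ℤ := d.sign * (orient E x * (present E t x).pos)

variable (E) in
/-- The situation in round `t`, for the walker `f` and the positions `c` in the round in which the
agents caught each other. -/
def jointState (d : Side) (f : Agent) (c : Agent → ℤ) (t : ℕ) : JointState where
  together := nodeAt Full E t (!f) = nodeAt Full E t f
  explored := ExploredBy Full E t
  portW := portAt Full E t f ≠ none
  portB := portAt Full E t (!f) ≠ none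
  knownW := (present E t f).size ≠ none
  knownB := (present E t (!f)).size ≠ none
  posW := coord E d t f - c f
  posB := coord E d t (!f) - c (!f)
  time := (present E t f).time
  credit := (present E t (!f)).credit
  steps := (present E t (!f)).steps
  blocked := (present E t (!f)).blocked

variable (E) in
/-- Both agents follow the procedure in round `t`. -/
structure Joint (d : Side) (f : Agent) (c : Agent → ℤ) (t₀ t : ℕ) : Prop where
  caught : ∀ x, (mem catchProtocol E (t + 1) x).phase = .caught
  active : ∀ x, (execution Full E t x).terminated = false
  fwd : ∀ x, (present E t x).fwd.relabel (E.flipped x) = d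
  time : ∀ x, t₀ + (present E t x).time = t
  tracked : ∀ x, Tracked E d t x (c x) (coord E d t x) (present E t x).size
  anchor : (n : ℤ) ∣ c f - c (!f)

theorem view_isSome {t : ℕ} {x : Agent} :
    (view catchProtocol E t x).myPos.isSome = true ↔ portAt Full E t x ≠ none := by
  rw [Ne, ← view_myPos_eq_none, Option.isSome_iff_ne_none]

theorem view_otherOnPort {t : ℕ} {x : Agent} :
    (view catchProtocol E t x).otherOnPort = true ↔
      nodeAt Full E t (!x) = nodeAt Full E t x ∧ portAt Full E t (!x) ≠ none := by
  by_cases h : (execution Full E t (!x)).node = (execution Full E t x).node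
  · rcases h2 : (execution Full E t (!x)).port with _ | s' <;>
      simp [Snapshot.otherOnPort, view, look, h, h2]
  · simp [Snapshot.otherOnPort, view, look, h]

section Decide

variable {q : CatchMemory} {o : Snapshot}

theorem decide_of_expired (h : q.expired = true) : (q.decide o).act = .terminate := by
  simp [CatchMemory.decide, h, CatchMemory.finish]

theorem decide_walk (h : q.expired = false) (hm : q.mode = .walk) :
    q.decide o = if o.together then
      if o.myPos.isSome && !o.otherOnPort then
        if q.size.isSome then q.rest .pause else q.go .hear q.fwd
      else q.finish
    else q.go .walk q.fwd := by
  simp [CatchMemory.decide, h, hm]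

theorem decide_hear (h : q.expired = false) (hm : q.mode = .hear) :
    q.decide o = if o.myPos.isSome then q.rest .pause else q.go .walk q.fwd := by
  simp [CatchMemory.decide, h, hm]

theorem decide_pause (h : q.expired = false) (hm : q.mode = .pause) :
    q.decide o = if o.together && !o.otherOnPort then q.finish else q.go .walk q.fwd := by
  simp [CatchMemory.decide, h, hm]

theorem decide_bounce (h : q.expired = false) (hm : q.mode = .bounce) :
    q.decide o = if o.together && !o.myPos.isSome then q.finish
    else if q.steps + 3 ≤ q.blocked ∨ q.size.isSome = true then
      { q with credit := q.steps + q.blocked - 1 }.go .back q.fwd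
    else q.go .bounce q.fwd.opp := by
  simp [CatchMemory.decide, h, hm]

theorem decide_back (h : q.expired = false) (hm : q.mode = .back) :
    q.decide o = if o.together then
      if !o.myPos.isSome && o.otherOnPort then q.rest .hold else q.finish
    else q.go .back q.fwd := by
  simp [CatchMemory.decide, h, hm]

theorem decide_hold (h : q.expired = false) (hm : q.mode = .hold) :
    q.decide o = if o.together then
      if o.otherOnPort then
        if 0 < q.credit ∨ q.size.isSome = true then q.rest .answer
        else { q with steps := 0, blocked := 0 }.go .bounce q.fwd.opp
      else q.finish
    else q.go .back q.fwd := by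
  simp [CatchMemory.decide, h, hm]

theorem decide_answer (hm : q.mode = .answer) : (q.decide o).act = .terminate := by
  simp [CatchMemory.decide, hm, CatchMemory.finish]

theorem decide_done (hm : q.mode = .done) : (q.decide o).act = .terminate := by
  simp [CatchMemory.decide, hm, CatchMemory.finish]

end Decide

/-! ### The joint state of an execution, and the effect of single actions on it. -/

namespace Joint

variable {d : Side} {f : Agent} {c : Agent → ℤ} {t₀ t : ℕ}

/-- The integer coordinates of the two agents at the catch may differ by a multiple of n; `anchor`
lets this offset be dropped. -/
theorem node_iff (h : Joint E d f c t₀ t) (m : ℤ) :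
    nodeAt Full E t (!f) = nodeAt Full E t f + ((d.sign * m : ℤ) : ZMod n) ↔
      (n : ℤ) ∣ (jointState E d f c t).posW - (jointState E d f c t).posB + m := by
  rw [(h.tracked f).node, (h.tracked (!f)).node, add_assoc, add_right_inj, ← Int.cast_add,
    ← sub_eq_zero, ← Int.cast_sub, intCast_eq_zero_iff, ← mul_add, ← mul_sub]
  have h1 : (n : ℤ) ∣ d.sign * (coord E d t (!f) - (coord E d t f + m)) ↔
      (n : ℤ) ∣ coord E d t (!f) - (coord E d t f + m) := by
    refine ⟨fun hd => ?_, fun hd => hd.mul_left _⟩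
    have := hd.mul_left d.sign
    rwa [← mul_assoc, sign_sq, one_mul] at this
  rw [h1, ← dvd_neg]
  rw [show -(coord E d t (!f) - (coord E d t f + m)) =
    (jointState E d f c t).posW - (jointState E d f c t).posB + m + (c f - c (!f)) by
      simp only [jointState]; ring]
  exact (dvd_add_left h.anchor)

theorem together_iff (h : Joint E d f c t₀ t) : nodeAt Full E t (!f) = nodeAt Full E t f ↔
    (n : ℤ) ∣ (jointState E d f c t).posW - (jointState E d f c t).posB := by
  have := h.node_iff 0
  simpa using this

/-- The walker has covered the positions from its start forward, the bouncer those from its start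
backward. A shift by a multiple of n joins the two intervals into one with at least n nodes. -/
theorem explored_of_gap (hn : 3 ≤ n) (h : Joint E d f c t₀ t)
    (hg : (n : ℤ) - 1 ≤ (jointState E d f c t).posW - (jointState E d f c t).posB) :
    ExploredBy Full E t := by
  simp only [jointState] at hg
  refine explored_of_interval hn d (coord E d t (!f) + (c f - c (!f))) (coord E d t f)
    (by omega) fun k k1 k2 => ?_
  by_cases hk : c f ≤ k
  · obtain ⟨s, hs, hs'⟩ := (h.tracked f).reach k (Or.inl ⟨hk, k2⟩)
    exact ⟨s, hs, f, hs'⟩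
  · obtain ⟨s, hs, hs'⟩ := (h.tracked (!f)).reach (k - (c f - c (!f))) (Or.inr (by omega))
    refine ⟨s, hs, !f, ?_⟩
    rw [hs', add_right_inj, ← sub_eq_zero, ← Int.cast_sub, intCast_eq_zero_iff, ← mul_sub]
    refine Dvd.dvd.mul_left ?_ _
    rw [show k - (c f - c (!f)) - k = -(c f - c (!f)) by ring, dvd_neg]
    exact h.anchor

theorem valid (hn : 3 ≤ n) (h : Joint E d f c t₀ t) : (jointState E d f c t).Valid n where
  exploredW := fun hk => by
    obtain ⟨s, hs⟩ := Option.ne_none_iff_exists'.1 hk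
    exact ((h.tracked f).known s hs).2
  exploredB := fun hk => by
    obtain ⟨s, hs⟩ := Option.ne_none_iff_exists'.1 hk
    exact ((h.tracked (!f)).known s hs).2
  explored := h.explored_of_gap hn
  together := h.together_iff
  smallW := fun hk => by
    have := (h.tracked f).small (not_not.1 hk)
    rw [abs_lt, abs_lt] at this
    simp only [jointState]
    omega
  smallB := fun hk => by
    have := (h.tracked (!f)).small (not_not.1 hk)
    rw [abs_lt, abs_lt] at this
    simp only [jointState]
    omega
  credit := Int.natCast_nonneg _
  steps := Int.natCast_nonneg _
  blocked := Int.natCast_nonneg _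

theorem coord_succ (h : Joint E d f c t₀ t) (x : Agent) : coord E d (t + 1) x = coord E d t x +
    if movedAt Full E (t + 1) x then
      d.sign * (((present E t x).decide (view catchProtocol E t x)).dir.relabel (E.flipped x)).sign
    else 0 := by
  rw [coord, present_succ (h.caught x)]
  simp only [CatchMemory.track, decide_pos, view_moved, sign_relabel]
  unfold coord
  split <;> ring

theorem size_succ (h : Joint E d f c t₀ t) (x : Agent) : (present E (t + 1) x).size =
    if (present E t x).size = none ∧ nodeAt Full E (t + 1) x = E.landmark ∧
      coord E d (t + 1) x ≠ 0 then some (coord E d (t + 1) x).natAbs else (present E t x).size := by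
  have h1 : (coord E d (t + 1) x).natAbs = (present E (t + 1) x).pos.natAbs := by
    have h2 : ∀ s : Side, s.sign.natAbs = 1 := fun s => by cases s <;> rfl
    simp [coord, orient, Int.natAbs_mul, h2]
  have h3 : coord E d (t + 1) x ≠ 0 ↔ (present E (t + 1) x).pos ≠ 0 := by
    rw [← Int.natAbs_ne_zero, h1, Int.natAbs_ne_zero]
  simp only [h3, h1]
  rw [present_succ (h.caught x)]
  simp only [CatchMemory.track, decide_size, view_isLandmark]

/-- The attempt of an agent to move, if it is not denied access. -/
theorem attempt (h : Joint E d f c t₀ t) {x : Agent} {s g : Side}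
    (hact : ((present E t x).decide (view catchProtocol E t x)).act = .move s)
    (hs : s.relabel (E.flipped x) = g) (hg : gainsAccess Full E t (execution Full E t) x = true) :
    (movedAt Full E (t + 1) x = true ∧ portAt Full E (t + 1) x = none ∧
      coord E d (t + 1) x = coord E d t x + d.sign * g.sign ∧
      nodeAt Full E (t + 1) x = nodeAt Full E t x + (g.sign : ℤ) ∧
      E.missing t ≠ some (edgeAt (nodeAt Full E t x) g)) ∨
    (movedAt Full E (t + 1) x = false ∧ portAt Full E (t + 1) x = some g ∧
      coord E d (t + 1) x = coord E d t x ∧ nodeAt Full E (t + 1) x = nodeAt Full E t x ∧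
      E.missing t = some (edgeAt (nodeAt Full E t x) g) ∧
      (present E (t + 1) x).size = (present E t x).size) := by
  have hr := (request_go (h.caught x) (h.active x) hact).1
  have hc := h.coord_succ x
  rw [decide_act _ _ _ hact, hs] at hc
  rw [hs] at hr
  rcases step_some hr with h' | h' | h'
  · left
    refine ⟨h'.2.2.2.2, h'.2.2.2.1, ?_, h'.2.2.1, h'.2.1⟩
    rw [hc, if_pos h'.2.2.2.2]
  · right
    have hc' : coord E d (t + 1) x = coord E d t x := by
      rw [hc, h'.2.2.2.2]
      simp
    refine ⟨h'.2.2.2.2, h'.2.2.2.1, hc', h'.2.2.1, h'.2.1, ?_⟩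
    -- A blocked agent keeps its position; at the landmark a position of absolute value less than n
    -- is 0, so nothing is learned.
    rw [h.size_succ x, if_neg]
    rintro ⟨h1, h2, h3⟩
    rw [h'.2.2.1, Tracked.landmark_iff (h.tracked x).node] at h2
    rw [hc'] at h3
    have := Int.le_of_dvd (abs_pos.2 h3) ((dvd_abs _ _).2 h2)
    have := ((h.tracked x).small h1).1
    omega
  · rw [hg] at h'
    cases h'.1

/-- An agent that stays. -/
theorem stay (h : Joint E d f c t₀ t) {x : Agent}
    (hact : ((present E t x).decide (view catchProtocol E t x)).act = .stay) :
    movedAt Full E (t + 1) x = false ∧ portAt Full E (t + 1) x = none ∧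
      coord E d (t + 1) x = coord E d t x ∧ nodeAt Full E (t + 1) x = nodeAt Full E t x := by
  have hr := step_none (request_rest (h.caught x) (h.active x) hact).1
  refine ⟨hr.2.2, hr.2.1, ?_, hr.1⟩
  rw [h.coord_succ x, hr.2.2]
  simp

theorem succ (hn : 3 ≤ n) (h : Joint E d f c t₀ t)
    (hact : ∀ x, (∃ s, ((present E t x).decide (view catchProtocol E t x)).act = .move s) ∨
      ((present E t x).decide (view catchProtocol E t x)).act = .stay) :
    Joint E d f c t₀ (t + 1) where
  caught := fun x => phase_caught_succ (h.caught x)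
  active := fun x => by
    rcases hact x with ⟨s, hs⟩ | hs
    · exact (request_go (h.caught x) (h.active x) hs).2
    · exact (request_rest (h.caught x) (h.active x) hs).2
  fwd := fun x => by
    rw [present_succ (h.caught x)]
    simp only [CatchMemory.track, decide_fwd]
    exact h.fwd x
  time := fun x => by
    rw [present_succ (h.caught x)]
    simp only [CatchMemory.track, decide_time]
    have := h.time x
    omega
  tracked := fun x => by
    have hsq := fun s : Side => show d.sign * s.sign = 1 ∨ d.sign * s.sign = -1 by
      cases d <;> cases s <;> simp [Side.sign]
    have hc := h.coord_succ x
    refine (h.tracked x).succ hn ?_ ?_ (h.size_succ x)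
    · rcases hact x with ⟨s, hs⟩ | hs
      · have hr := (request_go (h.caught x) (h.active x) hs).1
        rw [decide_act _ _ _ hs] at hc
        rw [hc, mul_add]
        rcases step_some hr with h' | h' | h'
        · rw [h'.2.2.1, (h.tracked x).node, if_pos h'.2.2.2.2, ← mul_assoc, sign_sq]
          push_cast
          ring
        · rw [h'.2.2.1, (h.tracked x).node, h'.2.2.2.2]
          simp
        · rw [h'.2.1, (h.tracked x).node, h'.2.2.2]
          simp
      · have := h.stay hs
        rw [this.2.2.2, this.2.2.1]
        exact (h.tracked x).node
    · rw [hc]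
      split
      · rcases hsq (((present E t x).decide (view catchProtocol E t x)).dir.relabel
          (E.flipped x)) with h1 | h1 <;> rw [h1] <;> omega
      · omega
  anchor := h.anchor

theorem next (h : Joint E d f c t₀ t) (h' : Joint E d f c t₀ (t + 1)) :
    JointState.Next (jointState E d f c t) (jointState E d f c (t + 1)) where
  time := by
    have h1 := h.time f
    have h2 := h'.time f
    simp only [jointState]
    omega
  explored := fun hX => hX.mono (Nat.le_succ t)
  knownW := fun hk => by
    simp only [jointState] at hk ⊢
    rw [h.size_succ f, if_neg fun h1 => hk h1.1]
    exact hk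
  knownB := fun hk => by
    simp only [jointState] at hk ⊢
    rw [h.size_succ (!f), if_neg fun h1 => hk h1.1]
    exact hk

theorem expired_iff (h : Joint E d f c t₀ t) (x : Agent) : (present E t x).expired = true ↔
    (present E t x).size ≠ none ∧ 200 * n ≤ (present E t x).time := by
  unfold CatchMemory.expired
  rcases hs : (present E t x).size with _ | s
  · simp
  · have := ((h.tracked x).known s hs).1
    subst this
    simp

theorem walkerMoves (h : Joint E d f c t₀ t) {s : Side}
    (hact : ((present E t f).decide (view catchProtocol E t f)).act = .move s)
    (hs : s.relabel (E.flipped f) = d) (hg : gainsAccess Full E t (execution Full E t) f = true) :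
    JointState.WalkerMoves (jointState E d f c t) (jointState E d f c (t + 1)) := by
  have hA := h.attempt hact hs hg
  rw [sign_sq] at hA
  simp only [JointState.WalkerMoves, jointState]
  rcases hA with h' | h'
  · exact Or.inl ⟨by omega, by rw [h'.2.1]; simp⟩
  · exact Or.inr ⟨by omega, by rw [h'.2.1]; simp⟩

theorem bouncerMoves (h : Joint E d f c t₀ t) {s g : Side}
    (hact : ((present E t (!f)).decide (view catchProtocol E t (!f))).act = .move s)
    (hs : s.relabel (E.flipped (!f)) = g)
    (hg : gainsAccess Full E t (execution Full E t) (!f) = true) :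
    JointState.BouncerMoves (d.sign * g.sign)
      ((present E t (!f)).decide (view catchProtocol E t (!f))).credit
      ((present E t (!f)).decide (view catchProtocol E t (!f))).steps
      ((present E t (!f)).decide (view catchProtocol E t (!f))).blocked
      (jointState E d f c t) (jointState E d f c (t + 1)) := by
  have hA := h.attempt hact hs hg
  have hp := present_succ (h.caught (!f))
  simp only [JointState.BouncerMoves, jointState]
  rcases hA with h' | h'
  · have hv : (view catchProtocol E (t + 1) (!f)).myPos = none := view_myPos_eq_none.2 h'.2.1
    refine Or.inl ⟨by omega, by rw [h'.2.1]; simp, ?_, ?_, ?_⟩ <;>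
      · rw [hp]
        simp only [CatchMemory.track, view_moved, h'.1, hv]
        simp
        try omega
  · have hv : (view catchProtocol E (t + 1) (!f)).myPos.isSome = true :=
      view_isSome.2 (by rw [h'.2.1]; simp)
    refine Or.inr ⟨by omega, by rw [h'.2.1]; simp, ?_, ?_, ?_, by rw [h'.2.2.2.2.2]; exact id⟩ <;>
      · rw [hp]
        simp only [CatchMemory.track, view_moved, h'.1, hv]
        simp

theorem bouncerStays (h : Joint E d f c t₀ t)
    (hact : ((present E t (!f)).decide (view catchProtocol E t (!f))).act = .stay)
    (hc : ((present E t (!f)).decide (view catchProtocol E t (!f))).credit =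
      (present E t (!f)).credit) :
    (jointState E d f c (t + 1)).posB = (jointState E d f c t).posB ∧
      ¬ (jointState E d f c (t + 1)).portB ∧
      (jointState E d f c (t + 1)).credit = (jointState E d f c t).credit := by
  have hA := h.stay hact
  simp only [jointState]
  refine ⟨by omega, by rw [hA.2.1]; simp, ?_⟩
  rw [present_succ (h.caught (!f))]
  simp only [CatchMemory.track, view_moved, hA.1, hc]
  simp

end Joint

end Catch

end DynamicRing

namespace DynamicRing

section Catch

variable {n : ℕ} {E : Environment n}

local notation "Full" => startFromLandmarkNoChirality catchProtocol

theorem Side.relabel_opp (b : Bool) (s : Side) : s.opp.relabel b = (s.relabel b).opp := by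
  cases b <;> cases s <;> rfl

theorem JointState.Stage.cases {m : ℤ} {s : JointState} {p q : CatchMode} (h : s.Stage m p q) :
    (p = .walk ∧ q = .back ∧ s.WalkBack m) ∨ (p = .hear ∧ q = .hold ∧ s.HearHold m) ∨
    (p = .pause ∧ (q = .hold ∨ q = .answer) ∧ s.Over) ∨
    (p = .pause ∧ q = .bounce ∧ s.PauseBounce m) ∨
    (p = .walk ∧ q = .bounce ∧ s.WalkBounce m) := by
  cases p <;> cases q <;> simp_all [JointState.Stage]

variable (E) in
/-- The variables of the procedure after the choice of the action in round `t`. -/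
abbrev decision (t : ℕ) (x : Agent) : CatchMemory :=
  (present E t x).decide (view catchProtocol E t x)

/-! ### One round of the procedure: a stage persists or both agents terminate. -/

namespace Joint

variable {d : Side} {f : Agent} {c : Agent → ℤ} {t₀ t : ℕ}

theorem mode_succ (h : Joint E d f c t₀ t) (x : Agent) :
    (present E (t + 1) x).mode = (decision E t x).mode := by
  rw [present_succ (h.caught x)]
  rfl

theorem finish (h : Joint E d f c t₀ t)
    (hact : ∀ x, (decision E t x).act = .terminate) (x : Agent) :
    (execution Full E (t + 1) x).terminated = true :=
  terminated_finish (h.caught x) (hact x)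

/-- Both agents try to move forward. -/
theorem both_forward (h : Joint E d f c t₀ t) {s s' : Side}
    (hf : (decision E t f).act = .move s) (hs : s.relabel (E.flipped f) = d)
    (hb : (decision E t (!f)).act = .move s') (hs' : s'.relabel (E.flipped (!f)) = d)
    (hT : ¬ (jointState E d f c t).together) :
    JointState.WalkerMoves (jointState E d f c t) (jointState E d f c (t + 1)) ∧
    JointState.BouncerMoves 1 (decision E t (!f)).credit (decision E t (!f)).steps
      (decision E t (!f)).blocked (jointState E d f c t) (jointState E d f c (t + 1)) ∧
    ¬ ((jointState E d f c (t + 1)).portW ∧ (jointState E d f c (t + 1)).portB) := by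
  have gf : gainsAccess Full E t (execution Full E t) f = true :=
    gainsAccess_of_not fun h' => hT h'.1
  have gb : gainsAccess Full E t (execution Full E t) (!f) = true :=
    gainsAccess_of_not fun h' => hT (by have := h'.1.symm; rwa [Bool.not_not] at this)
  refine ⟨h.walkerMoves hf hs gf, ?_, ?_⟩
  · have := h.bouncerMoves hb hs' gb
    rwa [sign_sq] at this
  · rintro ⟨hp, hp'⟩
    simp only [jointState] at hp hp'
    rcases h.attempt hf hs gf with h1 | h1
    · exact hp h1.2.1
    · rcases h.attempt hb hs' gb with h2 | h2
      · exact hp' h2.2.1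
      · exact d.opp_ne (of_both_on_port h1.2.1 h2.2.1).1.symm

/-- The agents try to move apart. -/
theorem both_apart (hn : 3 ≤ n) (h : Joint E d f c t₀ t) (h' : Joint E d f c t₀ (t + 1))
    {s s' : Side} (hf : (decision E t f).act = .move s) (hs : s.relabel (E.flipped f) = d)
    (hb : (decision E t (!f)).act = .move s') (hs' : s'.relabel (E.flipped (!f)) = d.opp) :
    JointState.WalkerMoves (jointState E d f c t) (jointState E d f c (t + 1)) ∧
    JointState.BouncerMoves (-1) (decision E t (!f)).credit (decision E t (!f)).steps
      (decision E t (!f)).blocked (jointState E d f c t) (jointState E d f c (t + 1)) ∧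
    ((jointState E d f c (t + 1)).portW → (jointState E d f c (t + 1)).portB →
      (n : ℤ) ∣ (jointState E d f c (t + 1)).posW - (jointState E d f c (t + 1)).posB + 1) ∧
    ((jointState E d f c (t + 1)).together →
      ¬ (jointState E d f c (t + 1)).portW ∧ ¬ (jointState E d f c (t + 1)).portB) := by
  have rf := (request_go (h.caught f) (h.active f) hf).1
  have rb := (request_go (h.caught (!f)) (h.active (!f)) hb).1
  rw [hs] at rf
  rw [hs'] at rb
  have gf : gainsAccess Full E t (execution Full E t) f = true :=
    gainsAccess_of_not fun h' => by
      rw [rf, rb] at h'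
      exact d.opp_ne (Option.some.inj h'.2)
  have gb : gainsAccess Full E t (execution Full E t) (!f) = true :=
    gainsAccess_of_not fun h' => by
      rw [Bool.not_not, rf, rb] at h'
      exact d.opp_ne (Option.some.inj h'.2).symm
  have af := h.attempt hf hs gf
  have ab := h.attempt hb hs' gb
  refine ⟨h.walkerMoves hf hs gf, ?_, fun hp hp' => ?_, fun hT => ?_⟩
  · have := h.bouncerMoves hb hs' gb
    rwa [Side.sign_opp, mul_neg, sign_sq] at this
  · simp only [jointState] at hp hp'
    rcases af with h1 | h1
    · exact absurd h1.2.1 hp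
    · rcases ab with h2 | h2
      · exact absurd h2.2.1 hp'
      · rw [← h'.node_iff, mul_one]
        exact (of_both_on_port h1.2.1 h2.2.1).2
  · simp only [jointState] at hT ⊢
    rw [not_not, not_not]
    -- If exactly one agent moved and they are now together, it crossed the edge for which the other
    -- one waits, which is absent.
    rcases af with h1 | h1 <;> rcases ab with h2 | h2
    · exact ⟨h1.2.1, h2.2.1⟩
    · exfalso
      refine h1.2.2.2.2 (h2.2.2.2.2.1.trans (congrArg some (edgeAt_opp_iff.2 ?_).symm))
      rw [← h2.2.2.2.1, hT, h1.2.2.2.1]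
    · exfalso
      refine h2.2.2.2.2 (h1.2.2.2.2.1.trans (congrArg some (edgeAt_opp_iff.2 ?_)))
      rw [← h1.2.2.2.1, ← hT, h2.2.2.2.1, Side.sign_opp]
      push_cast
      ring
    · exfalso
      rcases not_both_on_port hn hT with h3 | h3
      · rw [h1.2.1] at h3; cases h3
      · rw [h2.2.1] at h3; cases h3

theorem of_forall (f : Agent) {p : Agent → Prop} (h₁ : p f) (h₂ : p (!f)) (x : Agent) : p x := by
  by_cases hx : x = f
  · rw [hx]; exact h₁
  · obtain rfl : x = !f := by cases f <;> cases x <;> simp_all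
    exact h₂

/-- An agent that has to decide before the time limit knows what to expect. -/
theorem known_of_expired (hn : 3 ≤ n) (h : Joint E d f c t₀ t)
    (hS : (jointState E d f c t).Stage n (present E t f).mode (present E t (!f)).mode)
    (hO : ¬ ((present E t f).mode = .pause ∧
      ((present E t (!f)).mode = .hold ∨ (present E t (!f)).mode = .answer) ∧
      (jointState E d f c t).Over)) (ht : (200 * n : ℤ) ≤ (jointState E d f c t).time) :
    (jointState E d f c t).knownW ∧ (jointState E d f c t).knownB := by
  have hv := h.valid hn
  have v1 := hv.steps
  have v2 := hv.blocked
  have hw := hv.smallW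
  have hb := hv.smallB
  generalize jointState E d f c t = s at *
  -- An agent that does not know n is within 2n of its start, and gap ≥ 0 bounds posB by posW. The
  -- time bounds of the stages then stay below 200n.
  rcases hS.cases with ⟨-, -, h1⟩ | ⟨-, -, h1⟩ | h1 | ⟨-, -, h1⟩ | ⟨-, -, h1⟩
  · have g := h1.gap
    have cl := h1.credit_le
    have kw : s.knownW := by
      by_contra hk
      have := h1.time hk
      have := hw hk
      omega
    refine ⟨kw, ?_⟩
    by_contra hk
    obtain ⟨δ, -, d2, -, d4⟩ := h1.late kw hk
    have := hb hk
    omega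
  · have := h1.gap
    have := h1.credit_le
    have := h1.posW
    have := h1.time
    omega
  · exact absurd h1 hO
  · have := h1.gap
    have := h1.posW
    have := h1.posB
    have := h1.steps
    have := h1.blocked
    have := h1.time
    omega
  · have := h1.gap
    have := h1.posB
    have := h1.steps
    have := h1.blocked
    by_cases hk : s.knownW
    · have := h1.late hk
      omega
    · have := h1.time hk
      have := hw hk
      omega

/-- The joint state determines every test that the agents make, so each stage is followed through
the tests of `CatchMemory.decide`. The agents always terminate in the same round, and only in an
explored ring. -/
theorem step (hn : 3 ≤ n) (h : Joint E d f c t₀ t)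
    (hS : (jointState E d f c t).Stage n (present E t f).mode (present E t (!f)).mode) :
    (Joint E d f c t₀ (t + 1) ∧ (jointState E d f c (t + 1)).Stage n
      (present E (t + 1) f).mode (present E (t + 1) (!f)).mode ∧
      (present E t f).time < 200 * n) ∨
    ((∀ x, (execution Full E (t + 1) x).terminated = true) ∧ ExploredBy Full E t) := by
  have hn' : (3 : ℤ) ≤ n := by exact_mod_cast hn
  have hv := h.valid hn
  have tW : (view catchProtocol E t f).together = true ↔ (jointState E d f c t).together :=
    view_together
  have tB : (view catchProtocol E t (!f)).together = true ↔ (jointState E d f c t).together := by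
    rw [view_together, Bool.not_not]
    exact eq_comm
  have pW : (view catchProtocol E t f).myPos.isSome = true ↔ (jointState E d f c t).portW :=
    view_isSome
  have pB : (view catchProtocol E t (!f)).myPos.isSome = true ↔ (jointState E d f c t).portB :=
    view_isSome
  have oW : (view catchProtocol E t f).otherOnPort = true ↔
      (jointState E d f c t).together ∧ (jointState E d f c t).portB := view_otherOnPort
  have oB : (view catchProtocol E t (!f)).otherOnPort = true ↔
      (jointState E d f c t).together ∧ (jointState E d f c t).portW := by
    rw [view_otherOnPort, Bool.not_not]
    simp only [jointState, eq_comm]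
  have kW : (present E t f).size.isSome = true ↔ (jointState E d f c t).knownW :=
    Option.isSome_iff_ne_none
  have kB : (present E t (!f)).size.isSome = true ↔ (jointState E d f c t).knownB :=
    Option.isSome_iff_ne_none
  have TW : (jointState E d f c t).together → (view catchProtocol E t f).together = true := tW.2
  have TW' : ¬ (jointState E d f c t).together → (view catchProtocol E t f).together = false :=
    fun h1 => Bool.eq_false_iff.2 (mt tW.1 h1)
  have TB : (jointState E d f c t).together → (view catchProtocol E t (!f)).together = true := tB.2
  have TB' : ¬ (jointState E d f c t).together → (view catchProtocol E t (!f)).together = false :=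
    fun h1 => Bool.eq_false_iff.2 (mt tB.1 h1)
  have PW' : ¬ (jointState E d f c t).portW → (view catchProtocol E t f).myPos.isSome = false :=
    fun h1 => Bool.eq_false_iff.2 (mt pW.1 h1)
  have PB' : ¬ (jointState E d f c t).portB → (view catchProtocol E t (!f)).myPos.isSome = false :=
    fun h1 => Bool.eq_false_iff.2 (mt pB.1 h1)
  have OW' : ¬ (jointState E d f c t).portB → (view catchProtocol E t f).otherOnPort = false :=
    fun h1 => Bool.eq_false_iff.2 fun h2 => h1 (oW.1 h2).2
  have OB' : ¬ (jointState E d f c t).portW → (view catchProtocol E t (!f)).otherOnPort = false :=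
    fun h1 => Bool.eq_false_iff.2 fun h2 => h1 (oB.1 h2).2
  have KW' : ¬ (jointState E d f c t).knownW → (present E t f).size.isSome = false :=
    fun h1 => Bool.eq_false_iff.2 (mt kW.1 h1)
  have KB' : ¬ (jointState E d f c t).knownB → (present E t (!f)).size.isSome = false :=
    fun h1 => Bool.eq_false_iff.2 (mt kB.1 h1)
  -- The pausing walker sees its companion off the ports and stops; the companion sees that the
  -- walker has left its port, or has already answered.
  by_cases hO : (present E t f).mode = .pause ∧
      ((present E t (!f)).mode = .hold ∨ (present E t (!f)).mode = .answer) ∧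
      (jointState E d f c t).Over
  · obtain ⟨m1, m2, hO⟩ := hO
    right
    refine ⟨h.finish (of_forall f ?_ ?_), hO.explored⟩
    · rcases he : (present E t f).expired with _ | _
      · rw [decision, decide_pause he m1, TW hO.together, OW' hO.portB]
        rfl
      · exact decide_of_expired he
    · rcases he : (present E t (!f)).expired with _ | _
      · rcases m2 with m2 | m2
        · rw [decision, decide_hold he m2, TB hO.together, OB' hO.portW]
          rfl
        · exact decide_answer m2
      · exact decide_of_expired he
  -- Both clocks started in the round of the catch, so the limit is reached by both agents at once.
  by_cases ht : 200 * n ≤ (present E t f).time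
  · right
    have hk := h.known_of_expired hn hS hO (by simp only [jointState]; exact_mod_cast ht)
    refine ⟨h.finish (of_forall f ?_ ?_), hv.exploredW hk.1⟩
    · exact decide_of_expired ((h.expired_iff f).2 ⟨hk.1, ht⟩)
    · have h1 := h.time f
      have h2 := h.time (!f)
      exact decide_of_expired ((h.expired_iff (!f)).2 ⟨hk.2, by omega⟩)
  have eW : (present E t f).expired = false := by
    rw [← Bool.not_eq_true, h.expired_iff]
    exact fun h1 => ht h1.2
  have eB : (present E t (!f)).expired = false := by
    rw [← Bool.not_eq_true, h.expired_iff]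
    have h1 := h.time f
    have h2 := h.time (!f)
    rintro ⟨-, h3⟩
    omega
  have ht' : (present E t f).time < 200 * n := by omega
  have mW := h.mode_succ f
  have mB := h.mode_succ (!f)
  have fW := h.fwd f
  have fB := h.fwd (!f)
  have fB' := (Side.relabel_opp (E.flipped (!f)) (present E t (!f)).fwd).trans
    (congrArg Side.opp (h.fwd (!f)))
  -- both agents move forward
  have forward : ∀ q : CatchMemory, ¬ (jointState E d f c t).together →
      decision E t f = (present E t f).go .walk (present E t f).fwd →
      decision E t (!f) = q.go .back (present E t (!f)).fwd →
      (Joint E d f c t₀ (t + 1) ∧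
        JointState.WalkerMoves (jointState E d f c t) (jointState E d f c (t + 1)) ∧
        JointState.BouncerMoves 1 q.credit q.steps q.blocked
          (jointState E d f c t) (jointState E d f c (t + 1)) ∧
        ¬ ((jointState E d f c (t + 1)).portW ∧ (jointState E d f c (t + 1)).portB)) ∧
      ((jointState E d f c (t + 1)).WalkBack n → (jointState E d f c (t + 1)).Stage n
        (present E (t + 1) f).mode (present E (t + 1) (!f)).mode) := by
    intro q hT dW dB
    have aW : (decision E t f).act = .move (present E t f).fwd := by rw [dW]; rfl
    have aB : (decision E t (!f)).act = .move (present E t (!f)).fwd := by rw [dB]; rfl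
    have J := h.both_forward aW fW aB fB hT
    have e : (decision E t (!f)).credit = q.credit ∧ (decision E t (!f)).steps = q.steps ∧
        (decision E t (!f)).blocked = q.blocked := by rw [dB]; exact ⟨rfl, rfl, rfl⟩
    rw [e.1, e.2.1, e.2.2] at J
    refine ⟨⟨h.succ hn (of_forall f (Or.inl ⟨_, aW⟩) (Or.inl ⟨_, aB⟩)), J⟩, fun hw => ?_⟩
    rw [mW, mB, dW, dB]
    exact hw
  -- the agents move apart
  have apart : ∀ q : CatchMemory,
      decision E t f = (present E t f).go .walk (present E t f).fwd →
      decision E t (!f) = q.go .bounce (present E t (!f)).fwd.opp →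
      (Joint E d f c t₀ (t + 1) ∧
        JointState.WalkerMoves (jointState E d f c t) (jointState E d f c (t + 1)) ∧
        JointState.BouncerMoves (-1) q.credit q.steps q.blocked
          (jointState E d f c t) (jointState E d f c (t + 1)) ∧
        ((jointState E d f c (t + 1)).portW → (jointState E d f c (t + 1)).portB →
          (n : ℤ) ∣ (jointState E d f c (t + 1)).posW - (jointState E d f c (t + 1)).posB + 1) ∧
        ((jointState E d f c (t + 1)).together →
          ¬ (jointState E d f c (t + 1)).portW ∧ ¬ (jointState E d f c (t + 1)).portB)) ∧
      ((jointState E d f c (t + 1)).WalkBounce n → (jointState E d f c (t + 1)).Stage n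
        (present E (t + 1) f).mode (present E (t + 1) (!f)).mode) := by
    intro q dW dB
    have aW : (decision E t f).act = .move (present E t f).fwd := by rw [dW]; rfl
    have aB : (decision E t (!f)).act = .move (present E t (!f)).fwd.opp := by rw [dB]; rfl
    have h' := h.succ hn (of_forall f (Or.inl ⟨_, aW⟩) (Or.inl ⟨_, aB⟩))
    have J := h.both_apart hn h' aW fW aB fB'
    have e : (decision E t (!f)).credit = q.credit ∧ (decision E t (!f)).steps = q.steps ∧
        (decision E t (!f)).blocked = q.blocked := by rw [dB]; exact ⟨rfl, rfl, rfl⟩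
    rw [e.1, e.2.1, e.2.2] at J
    refine ⟨⟨h', J⟩, fun hw => ?_⟩
    rw [mW, mB, dW, dB]
    exact hw
  rcases hS.cases with ⟨m1, m2, h1⟩ | ⟨m1, m2, h1⟩ | ⟨m1, m2, h1⟩ | ⟨m1, m2, h1⟩ | ⟨m1, m2, h1⟩
  · by_cases hT : (jointState E d f c t).together
    · by_cases hp : (jointState E d f c t).portW ∧ ¬ (jointState E d f c t).portB
      · left
        have dB : decision E t (!f) = (present E t (!f)).rest .hold := by
          rw [decision, decide_back eB m2, TB hT, PB' hp.2, oB.2 ⟨hT, hp.1⟩]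
          rfl
        have aB : (decision E t (!f)).act = .stay := by rw [dB]; rfl
        have sB := h.stay aB
        have sB' := h.bouncerStays aB (by rw [show (present E t (!f)).decide
          (view catchProtocol E t (!f)) = decision E t (!f) from rfl, dB]; rfl)
        by_cases hk : (jointState E d f c t).knownW
        · have dW : decision E t f = (present E t f).rest .pause := by
            rw [decision, decide_walk eW m1, TW hT, pW.2 hp.1, OW' hp.2, kW.2 hk]
            rfl
          have aW : (decision E t f).act = .stay := by rw [dW]; rfl
          have sW := h.stay aW
          refine ⟨h.succ hn (of_forall f (Or.inr aW) (Or.inr aB)), ?_, ht'⟩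
          rw [mW, mB, dW, dB]
          refine ⟨(hv.exploredW hk).mono (Nat.le_succ t), ?_, fun h2 => h2 sW.2.1,
            fun h2 => h2 sB.2.1⟩
          change nodeAt Full E (t + 1) (!f) = nodeAt Full E (t + 1) f
          rw [sW.2.2.2, sB.2.2.2]
          exact hT
        · have dW : decision E t f = (present E t f).go .hear (present E t f).fwd := by
            rw [decision, decide_walk eW m1, TW hT, pW.2 hp.1, OW' hp.2, KW' hk]
            rfl
          have aW : (decision E t f).act = .move (present E t f).fwd := by rw [dW]; rfl
          have h' := h.succ hn (of_forall f (Or.inl ⟨_, aW⟩) (Or.inr aB))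
          have gW : gainsAccess Full E t (execution Full E t) f = true := by
            refine gainsAccess_of_not fun h2 => ?_
            rw [(request_go (h.caught f) (h.active f) aW).1,
              (request_rest (h.caught (!f)) (h.active (!f)) aB).1] at h2
            cases h2.2
          refine ⟨h', ?_, ht'⟩
          rw [mW, mB, dW, dB]
          refine h1.hearHold hv (h.next h') (h.walkerMoves aW fW gW) hk sB' ?_
          have hT' : nodeAt Full E t (!f) = nodeAt Full E t f := hT
          simp only [jointState]
          rw [sB.2.2.2]
          rcases h.attempt aW fW gW with h2 | h2
          · rw [h2.2.1, h2.2.2.2.1, hT']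
            simp [sign_ne_zero hn d]
          · rw [h2.2.1, h2.2.2.2.1, hT']
            simp
      · right
        refine ⟨h.finish (of_forall f ?_ ?_), ?_⟩
        · rw [decision, decide_walk eW m1, TW hT, if_pos rfl, if_neg]
          · rfl
          · rw [Bool.and_eq_true, Bool.not_eq_true', pW, Bool.eq_false_iff, Ne, oW]
            exact fun h2 => hp ⟨h2.1, fun h3 => h2.2 ⟨hT, h3⟩⟩
        · rw [decision, decide_back eB m2, TB hT, if_pos rfl, if_neg]
          · rfl
          · rw [Bool.and_eq_true, Bool.not_eq_true', Bool.eq_false_iff, Ne, pB, oB]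
            exact fun h2 => hp ⟨h2.2.2, h2.1⟩
        -- In an unexplored ring the returning bouncer meets the walker only while the latter is
        -- blocked.
        · by_contra hX
          exact hp (h1.meet hX (hv.gap_eq_zero h1.gap hT hX))
    · left
      obtain ⟨⟨h', J1, J2, J3⟩, hw⟩ := forward (present E t (!f)) hT
        (by rw [decision, decide_walk eW m1, TW' hT]; rfl)
        (by rw [decision, decide_back eB m2, TB' hT]; rfl)
      refine ⟨h', hw ?_, ht'⟩
      exact JointState.walkBack_of_moves hn' hv (h'.valid hn) (h.next h') J1 J2 J3 hT h1.gap
        h1.credit hv.credit h1.credit_le h1.time h1.time' h1.late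
  · left
    by_cases hT : (jointState E d f c t).together
    · have hp := h1.port.1 hT
      have dW : decision E t f = (present E t f).rest .pause := by
        rw [decision, decide_hear eW m1, pW.2 hp]
        rfl
      have aW : (decision E t f).act = .stay := by rw [dW]; rfl
      have sW := h.stay aW
      by_cases hk : 0 < (present E t (!f)).credit ∨ (present E t (!f)).size.isSome = true
      · have dB : decision E t (!f) = (present E t (!f)).rest .answer := by
          rw [decision, decide_hold eB m2, TB hT, oB.2 ⟨hT, hp⟩, if_pos rfl, if_pos rfl, if_pos hk]
        have aB : (decision E t (!f)).act = .stay := by rw [dB]; rfl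
        have sB := h.stay aB
        -- Without exploration the gap at a meeting is 0, which leaves no positive credit.
        have hX : ExploredBy Full E t := by
          by_contra hX
          rcases hk with hk | hk
          · have g1 := hv.gap_eq_zero h1.gap hT hX
            have g2 := h1.credit hX
            rw [g1] at g2
            simp only [jointState] at g2
            omega
          · exact hX (hv.exploredB (kB.1 hk))
        refine ⟨h.succ hn (of_forall f (Or.inr aW) (Or.inr aB)), ?_, ht'⟩
        rw [mW, mB, dW, dB]
        refine ⟨hX.mono (Nat.le_succ t), ?_, fun h2 => h2 sW.2.1, fun h2 => h2 sB.2.1⟩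
        change nodeAt Full E (t + 1) (!f) = nodeAt Full E (t + 1) f
        rw [sW.2.2.2, sB.2.2.2]
        exact hT
      · have dB : decision E t (!f) = CatchMemory.go
            { present E t (!f) with steps := 0, blocked := 0 } .bounce
            (present E t (!f)).fwd.opp := by
          rw [decision, decide_hold eB m2, TB hT, oB.2 ⟨hT, hp⟩, if_pos rfl, if_pos rfl, if_neg hk]
        have aB : (decision E t (!f)).act = .move (present E t (!f)).fwd.opp := by rw [dB]; rfl
        have h' := h.succ hn (of_forall f (Or.inr aW) (Or.inl ⟨_, aB⟩))
        have gB : gainsAccess Full E t (execution Full E t) (!f) = true := by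
          refine gainsAccess_of_not fun h2 => ?_
          rw [Bool.not_not, (request_go (h.caught (!f)) (h.active (!f)) aB).1,
            (request_rest (h.caught f) (h.active f) aW).1] at h2
          cases h2.2
        have J := h.bouncerMoves aB fB' gB
        rw [Side.sign_opp, mul_neg, sign_sq, show (present E t (!f)).decide
          (view catchProtocol E t (!f)) = decision E t (!f) from rfl, dB] at J
        refine ⟨h', ?_, ht'⟩
        rw [mW, mB, dW, dB]
        refine h1.pauseBounce hn' hv (h'.valid hn) (h.next h') (fun h2 => hk (Or.inr (kB.2 h2)))
          ?_ hT J ⟨?_, fun h2 => h2 sW.2.1⟩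
        · simp only [jointState]
          omega
        · simp only [jointState]
          rw [sW.2.2.1]
    · have hp : ¬ (jointState E d f c t).portW := fun hp => hT (h1.port.2 hp)
      obtain ⟨⟨h', J1, J2, J3⟩, hw⟩ := forward (present E t (!f)) hT
        (by rw [decision, decide_hear eW m1, PW' hp]; rfl)
        (by rw [decision, decide_hold eB m2, TB' hT]; rfl)
      refine ⟨h', hw ?_, ht'⟩
      have g := h1.gap
      have cl := h1.credit_le
      have pw := h1.posW
      obtain ⟨t1, t2⟩ := h1.time_moved hp
      refine JointState.walkBack_of_moves hn' hv (h'.valid hn) (h.next h') J1 J2 J3 hT h1.gap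
        h1.credit hv.credit h1.credit_le (fun _ => t1) (fun _ => t2) fun _ hb => ?_
      obtain ⟨δ, d1, d2, d3⟩ := JointState.exists_dist hn'
        ((jointState E d f c t).posW - (jointState E d f c t).posB)
      have := hv.smallB hb
      exact ⟨δ, d1, d2, d3, by omega⟩
  · exact absurd ⟨m1, m2, h1⟩ hO
  · left
    -- A bouncer that is still at the node is on its port, so the walker does not mistake it for an
    -- answer.
    have dW : decision E t f = (present E t f).go .walk (present E t f).fwd := by
      rw [decision, decide_pause eW m1, if_neg]
      rw [Bool.and_eq_true, Bool.not_eq_true', Bool.eq_false_iff, Ne, tW, oW]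
      rintro ⟨h2, h3⟩
      exact h3 ⟨h2, (h1.port h2).1⟩
    have h3 : ¬ ((view catchProtocol E t (!f)).together &&
        !(view catchProtocol E t (!f)).myPos.isSome) = true := by
      rw [Bool.and_eq_true, Bool.not_eq_true', Bool.eq_false_iff, Ne, tB, pB]
      rintro ⟨h2, h3⟩
      exact h3 (h1.port h2).1
    have b := h1.blocked
    simp only [jointState] at b
    have g := h1.gap
    have pw := h1.posW
    have pb := h1.posB
    have st := h1.steps
    have v1 := hv.steps
    have v2 := hv.blocked
    by_cases hk : (jointState E d f c t).knownB
    · have hT : ¬ (jointState E d f c t).together := fun hT => (h1.port hT).2 hk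
      obtain ⟨⟨h', J1, J2, J3⟩, hw⟩ := forward { present E t (!f) with
          credit := (present E t (!f)).steps + (present E t (!f)).blocked - 1 } hT dW
        (by rw [decision, decide_bounce eB m2, if_neg h3, if_pos (Or.inr (kB.2 hk))])
      refine ⟨h', hw ?_, ht'⟩
      refine JointState.walkBack_of_bounce (steps := (present E t (!f)).steps)
        (blocked := (present E t (!f)).blocked) hn' hv (h'.valid hn) (h.next h') J1 ?_ J3 hT
        h1.gap h1.credit h1.posB h1.steps h1.blocked.le (Or.inr hk) (fun _ => h1.time) fun _ => ?_
      · convert J2 using 1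
        simp only [jointState]
        omega
      · have := h1.time
        omega
    · obtain ⟨⟨h', J1, J2, J3, J4⟩, hw⟩ := apart (present E t (!f)) dW
        (by
          rw [decision, decide_bounce eB m2, if_neg h3, if_neg]
          rw [kB]
          rintro (h2 | h2)
          · omega
          · exact hk h2)
      refine ⟨h', hw ?_, ht'⟩
      refine JointState.walkBounce_of_moves hv (h'.valid hn) (h.next h') J1 J2 J3 J4 h1.gap
        h1.credit hk h1.steps h1.blocked (fun _ => h1.time) fun _ => ?_
      have := h1.time
      simp only [jointState] at *
      omega
  · by_cases hT : (jointState E d f c t).together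
    · right
      obtain ⟨hp, hp'⟩ := h1.port hT
      refine ⟨h.finish (of_forall f ?_ ?_), ?_⟩
      · rw [decision, decide_walk eW m1, TW hT, PW' hp]
        rfl
      · rw [decision, decide_bounce eB m2, TB hT, PB' hp']
        rfl
      -- During a bounce the gap in an unexplored ring is at least 1, whereas a meeting would make
      -- it 0.
      · by_contra hX
        have := h1.gap_pos hX
        have := hv.gap_eq_zero h1.gap hT hX
        omega
    · left
      have dW : decision E t f = (present E t f).go .walk (present E t f).fwd := by
        rw [decision, decide_walk eW m1, TW' hT]
        rfl
      have h3 : ¬ ((view catchProtocol E t (!f)).together &&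
          !(view catchProtocol E t (!f)).myPos.isSome) = true := by
        rw [TB' hT]
        simp
      by_cases hk : (present E t (!f)).steps + 3 ≤ (present E t (!f)).blocked ∨
          (present E t (!f)).size.isSome = true
      · obtain ⟨⟨h', J1, J2, J3⟩, hw⟩ := forward { present E t (!f) with
            credit := (present E t (!f)).steps + (present E t (!f)).blocked - 1 } hT dW
          (by rw [decision, decide_bounce eB m2, if_neg h3, if_pos hk])
        refine ⟨h', hw ?_, ht'⟩
        refine JointState.walkBack_of_bounce (steps := (present E t (!f)).steps)
          (blocked := (present E t (!f)).blocked) hn' hv (h'.valid hn) (h.next h') J1 ?_ J3 hT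
          h1.gap h1.credit h1.posB h1.steps h1.blocked ?_ h1.time h1.late
        · convert J2 using 1
          simp only [jointState]
          omega
        · rcases hk with hk | hk
          · left
            simp only [jointState]
            omega
          · exact Or.inr (kB.1 hk)
      · obtain ⟨⟨h', J1, J2, J3, J4⟩, hw⟩ := apart (present E t (!f)) dW
          (by rw [decision, decide_bounce eB m2, if_neg h3, if_neg hk])
        refine ⟨h', hw ?_, ht'⟩
        refine JointState.walkBounce_of_moves hv (h'.valid hn) (h.next h') J1 J2 J3 J4 h1.gap
          h1.credit (fun h2 => hk (Or.inr (kB.2 h2))) h1.steps ?_ h1.time h1.late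
        have : ¬ (present E t (!f)).steps + 3 ≤ (present E t (!f)).blocked :=
          fun h2 => hk (Or.inl h2)
        omega

end Joint

end Catch

end DynamicRing

namespace DynamicRing

section Catch

variable {n : ℕ} {E : Environment n}

local notation "Full" => startFromLandmarkNoChirality catchProtocol

/-! ### From the round in which the agents catch each other -/

theorem present_start {t : ℕ} (hU : Uncaught catchProtocol E t) (x : Agent) : present E t x =
    CatchMemory.start ((mem catchProtocol E t x).compute (view catchProtocol E t x))
      (view catchProtocol E t x) := by
  rw [present, catchMem_eq_none (hU x)]

theorem present_start_pos {t : ℕ} (hU : Uncaught catchProtocol E t) (x : Agent) :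
    (present E t x).pos = disp catchProtocol E t x := by
  rw [present_start hU]
  exact Memory.track_compute_pos

theorem present_start_size {t : ℕ} (hU : Uncaught catchProtocol E t) (x : Agent) :
    (present E t x).size = (mem catchProtocol E (t + 1) x).size := by
  rw [present_start hU, mem_succ]
  rfl

theorem present_start_mode {t : ℕ} (hU : Uncaught catchProtocol E t) (x : Agent) :
    (present E t x).mode = if (∃ s, (mem catchProtocol E (t + 1) x).size = some s ∧ timeout s ≤ t)
      then .done else if portAt Full E t x ≠ none then .walk else .back := by
  rw [present_start hU, mem_succ]
  simp only [CatchMemory.start, Memory.compute_tTime, mem_tTime, Memory.tick_size]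
  congr 1
  · rcases ((mem catchProtocol E t x).compute (view catchProtocol E t x)).size with _ | s <;> simp
  · simp only [view_isSome]

theorem coord_node {t : ℕ} (hU : Uncaught catchProtocol E t) (d : Side) (x : Agent) :
    nodeAt Full E t x = E.landmark + ((d.sign * coord E d t x : ℤ) : ZMod n) := by
  rw [node_eq (hU x), coord, ← mul_assoc, sign_sq, one_mul, present_start_pos hU]

theorem tracked_start (hn : 3 ≤ n) {t : ℕ} (hU : Uncaught catchProtocol E t) (d : Side)
    (x : Agent) :
    Tracked E d t x (coord E d t x) (coord E d t x) (present E t x).size := by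
  have hsq : ∀ k : ℤ, d.sign * (d.sign * k) = k := fun k => by
    rw [← mul_assoc, sign_sq, one_mul]
  have habs : |coord E d t x| = |disp catchProtocol E t x| := by
    rw [coord, present_start_pos hU]
    unfold orient
    cases d <;> cases E.flipped x <;> simp [Side.sign, Side.relabel, Side.opp]
  have hdir : coord E d t x = disp catchProtocol E t x ∧ orient E x = d.sign ∨
      coord E d t x = -disp catchProtocol E t x ∧ orient E x = -d.sign := by
    rw [coord, present_start_pos hU]
    unfold orient
    cases d <;> cases E.flipped x <;> simp [Side.sign, Side.relabel, Side.opp]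
  refine ⟨coord_node hU d x, fun k hk => ?_, fun k hk => ⟨t, le_rfl, ?_⟩, fun hz => ?_,
    fun s hs => ?_⟩
  · rcases hdir with ⟨h1, h2⟩ | ⟨h1, h2⟩
    · obtain ⟨s, hs, hs'⟩ := disp_visited (hU x) k (by omega)
      exact ⟨s, hs, by rw [hs', h2]⟩
    · obtain ⟨s, hs, hs'⟩ := disp_visited (hU x) (-k) (by omega)
      exact ⟨s, hs, by rw [hs', h2, neg_mul_neg]⟩
  · rw [coord_node hU d x, show k = coord E d t x by omega]
  · rw [present_start_size hU] at hz
    rw [habs]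
    exact ⟨abs_disp_lt hn (hU x) hz, abs_disp_lt hn (hU x) hz⟩
  · rw [present_start_size hU] at hs
    exact size_eq hn (hU x) hs

theorem joint_start (hn : 3 ≤ n) {t : ℕ} (hU : Uncaught catchProtocol E t) (ht : t < timeout n)
    (hc : ∀ x, (mem catchProtocol E (t + 1) x).phase = .caught)
    (hact : ∀ x, (execution Full E t x).terminated = false) {f : Agent} {d : Side}
    (hnode : nodeAt Full E t (!f) = nodeAt Full E t f) (hp : portAt Full E t f = some d)
    (hp' : portAt Full E t (!f) = none) :
    Joint E d f (coord E d t) t t ∧ (jointState E d f (coord E d t) t).Stage n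
      (present E t f).mode (present E t (!f)).mode := by
  have htime : ∀ x, (present E t x).time = 0 := fun x => by rw [present_start hU]; rfl
  have hcredit : (present E t (!f)).credit = 0 := by rw [present_start hU]; rfl
  have hguard : ∀ x, ¬ ∃ s, (mem catchProtocol E (t + 1) x).size = some s ∧ timeout s ≤ t := by
    rintro x ⟨s, hs, hs'⟩
    rw [(size_eq hn (hU x) hs).1] at hs'
    omega
  have hnode' : (execution Full E t (!f)).node = (execution Full E t f).node := hnode
  have hpf : (execution Full E t f).port = some d := hp
  have hpb : (execution Full E t (!f)).port = none := hp'
  refine ⟨⟨hc, hact, Joint.of_forall f ?_ ?_, fun x => by rw [htime]; rfl,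
    tracked_start hn hU d, ?_⟩, ?_⟩
  · rw [present_start hU]
    simp only [CatchMemory.start, view, look, hpf, Option.map_some, Side.relabel_relabel]
  · rw [present_start hU]
    simp only [CatchMemory.start, view, look, hpf, hpb, Option.map_some, Option.map_none,
      Bool.not_not, hnode', if_true, Side.relabel_relabel]
  · rw [coord_node hU d, coord_node hU d, add_right_inj, ← sub_eq_zero, ← Int.cast_sub,
      intCast_eq_zero_iff, ← mul_sub] at hnode
    have := hnode.mul_left d.sign
    rwa [← mul_assoc, sign_sq, one_mul, ← dvd_neg, neg_sub] at this
  · rw [present_start_mode hU, present_start_mode hU, if_neg (hguard _), if_neg (hguard _), hp, hp',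
      if_pos (by simp), if_neg (by simp)]
    -- All counters and relative positions are 0; the gap 0 is represented by δ = n.
    refine ⟨?_, ?_, ?_, ?_, ?_, ?_, ?_⟩ <;> simp only [jointState, htime, hcredit, sub_self]
    · exact le_rfl
    · simp
    · exact fun _ _ => ⟨by rw [hp]; simp, by rw [hp']; simp⟩
    · push_cast; omega
    · intro _; push_cast; omega
    · simp
    · exact fun _ _ => ⟨n, by omega, le_rfl, by simp, by push_cast; omega⟩

/-- The procedure ends in linear time, and then the ring has been explored. -/
theorem Joint.ends (hn : 3 ≤ n) {d : Side} {f : Agent} {c : Agent → ℤ} {t₀ : ℕ}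
    (h : Joint E d f c t₀ t₀) (hS : (jointState E d f c t₀).Stage n
      (present E t₀ f).mode (present E t₀ (!f)).mode) :
    ∃ T, t₀ ≤ T ∧ T ≤ t₀ + 200 * n ∧ (∀ x, (execution Full E T x).terminated = false) ∧
      (∀ x, (execution Full E (T + 1) x).terminated = true) ∧ ExploredBy Full E T := by
  have key : ∀ m, (∃ T, t₀ ≤ T ∧ T < t₀ + m ∧ (∀ x, (execution Full E T x).terminated = false) ∧
      (∀ x, (execution Full E (T + 1) x).terminated = true) ∧ ExploredBy Full E T) ∨
      (Joint E d f c t₀ (t₀ + m) ∧ (jointState E d f c (t₀ + m)).Stage n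
        (present E (t₀ + m) f).mode (present E (t₀ + m) (!f)).mode ∧ m ≤ 200 * n) := by
    intro m
    induction m with
    | zero => exact Or.inr ⟨h, hS, Nat.zero_le _⟩
    | succ m ih =>
      rcases ih with ⟨T, h1, h2, h3⟩ | ⟨hJ, hJS, -⟩
      · exact Or.inl ⟨T, h1, by omega, h3⟩
      · rcases hJ.step hn hJS with ⟨h1, h2, h3⟩ | ⟨h1, h2⟩
        · have := hJ.time f
          exact Or.inr ⟨h1, h2, by omega⟩
        · exact Or.inl ⟨t₀ + m, by omega, by omega, hJ.active, h1, h2⟩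
  rcases key (200 * n + 1) with ⟨T, h1, h2, h3⟩ | ⟨-, -, h3⟩
  · exact ⟨T, h1, by omega, h3⟩
  · omega

theorem explored_of_terminated (hn : 3 ≤ n) {t : ℕ} (hU : Uncaught catchProtocol E t) {a : Agent}
    (h : (execution Full E t a).terminated = true) : ExploredBy Full E t := by
  have hp := (terminated_iff (hU a)).1 h
  rcases terminated_before_timeout hn hp with h1 | h1
  · exact h1.2
  · have h2 : (mem catchProtocol E (t + 1) a).size ≠ none := fun h2 => by
      have := h1.2
      rw [size_mono (Nat.le_succ t) h2] at this
      cases this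
    obtain ⟨s, hs⟩ := Option.ne_none_iff_exists'.1 h2
    exact (size_eq hn (hU a) hs).2

/-- Once the agents have caught each other, they terminate in linear time, and the ring has been
explored when an agent has terminated. -/
theorem ends_of_catch (hn : 3 ≤ n) {t : ℕ} (hU : Uncaught catchProtocol E t)
    (hc : ¬ Uncaught catchProtocol E (t + 1)) :
    ∃ T ≤ t + 1 + 200 * n, (∀ x, (execution Full E T x).terminated = true) ∧
      ∀ s x, (execution Full E s x).terminated = true → ExploredBy Full E s := by
  simp only [Uncaught, not_forall, not_not] at hc
  obtain ⟨a, ha⟩ := hc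
  obtain ⟨ha', hcatch⟩ := isCatch_of_phase_caught ha (hU a)
  -- From the timeout on every active agent knows n and stops at the catch. Before it neither agent
  -- has terminated, since an early termination is always joint.
  by_cases ht : timeout n ≤ t
  · have hall : ∀ x, (execution Full E (t + 1) x).terminated = true := by
      intro x
      have hcatch' : (view catchProtocol E t x).isCatch = true := by
        by_cases hx : x = a
        · rw [hx]; exact hcatch
        · obtain rfl : x = !a := by cases a <;> cases x <;> simp_all
          exact view_isCatch_not.2 hcatch
      by_cases hx : (mem catchProtocol E t x).phase = .terminated
      · exact terminated_mono_succ ((terminated_iff (hU x)).2 hx)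
      · refine terminated_finish (phase_caught_of_isCatch hx hcatch') (decide_done ?_)
        rw [present_start_mode hU, if_pos]
        have h2 : (mem catchProtocol E (t + 1) x).size ≠ none := fun h2 =>
          size_known_after_timeout hn ht hU x hx (size_mono (Nat.le_succ t) h2)
        obtain ⟨s, hs⟩ := Option.ne_none_iff_exists'.1 h2
        refine ⟨s, hs, ?_⟩
        rwa [(size_eq hn (hU x) hs).1]
    refine ⟨t + 1, by omega, hall, fun s x hs => ?_⟩
    by_cases hst : s ≤ t
    · exact explored_of_terminated hn (hU.of_le hst) hs
    · have h2 : (mem catchProtocol E (t + 1) a).size ≠ none := fun h2 =>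
        size_known_after_timeout hn ht hU a ha' (size_mono (Nat.le_succ t) h2)
      obtain ⟨r, hr⟩ := Option.ne_none_iff_exists'.1 h2
      exact (size_eq hn (hU a) hr).2.mono (by omega)
  · have hx : ∀ x, (mem catchProtocol E t x).phase ≠ .terminated := by
      intro x hx
      rcases terminated_before_timeout hn hx with h1 | h1
      · exact ha' (h1.1 a)
      · omega
    have hact : ∀ x, (execution Full E t x).terminated = false := fun x =>
      Bool.eq_false_iff.2 fun h => hx x ((terminated_iff (hU x)).1 h)
    have hcatch' : ∀ x, (view catchProtocol E t x).isCatch = true :=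
      Joint.of_forall a hcatch (view_isCatch_not.2 hcatch)
    obtain ⟨f, hnode, hp, hp'⟩ : ∃ f, nodeAt Full E t (!f) = nodeAt Full E t f ∧
        portAt Full E t f ≠ none ∧ portAt Full E t (!f) = none := by
      obtain ⟨h1, h2 | h2⟩ := view_isCatch.1 hcatch
      · exact ⟨!a, by rw [Bool.not_not]; exact h1.symm, h2.2, by rw [Bool.not_not]; exact h2.1⟩
      · exact ⟨a, h1, h2⟩
    obtain ⟨d, hd⟩ := Option.ne_none_iff_exists'.1 hp
    obtain ⟨hJ, hS⟩ := joint_start hn hU (not_le.1 ht)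
      (fun x => phase_caught_of_isCatch (hx x) (hcatch' x)) hact hnode hd hp'
    obtain ⟨T, -, h2, h3, h4, h5⟩ := hJ.ends hn hS
    refine ⟨T + 1, by omega, h4, fun s x hs => h5.mono ?_⟩
    by_contra hlt
    have := terminated_mono (not_le.1 hlt).le hs
    rw [h3 x] at this
    cases this

theorem exists_catch {t : ℕ} (h : ¬ Uncaught catchProtocol E t) :
    ∃ s < t, Uncaught catchProtocol E s ∧ ¬ Uncaught catchProtocol E (s + 1) := by
  induction t with
  | zero => exact absurd uncaught_zero h
  | succ t ih =>
    by_cases ht : Uncaught catchProtocol E t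
    · exact ⟨t, Nat.lt_succ_self t, ht, h⟩
    · obtain ⟨s, hs, hs'⟩ := ih ht
      exact ⟨s, by omega, hs'⟩

/-- The complete algorithm terminates, and then the ring has been explored. -/
theorem ends (hn : 3 ≤ n) : ∃ T ≤ 5 * timeout n + 200 * n,
    (∀ x, (execution Full E T x).terminated = true) ∧
    ∀ s x, (execution Full E s x).terminated = true → ExploredBy Full E s := by
  by_cases hU : Uncaught catchProtocol E (5 * timeout n)
  · have hT := terminated_of_uncaught hn hU
    refine ⟨5 * timeout n, by omega, fun x => (terminated_iff (hU x)).2 (hT x), fun s x hs => ?_⟩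
    refine explored_of_terminated hn (a := x) ?_ hs
    rcases le_total s (5 * timeout n) with h | h
    · exact hU.of_le h
    · intro y
      rw [phase_terminated_of_le h (hT y)]
      simp
  · obtain ⟨t, ht, h1, h2⟩ := exists_catch hU
    obtain ⟨T, hT, h3, h4⟩ := ends_of_catch hn h1 h2
    exact ⟨T, by omega, h3, h4⟩

/-! ### The bounds -/

theorem one_le_log (hn : 3 ≤ n) : (1 : ℝ) ≤ Real.log n := by
  rw [Real.le_log_iff_exp_le (by positivity)]
  have h1 := Real.exp_one_lt_d9
  have h2 : (3 : ℝ) ≤ n := by exact_mod_cast hn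
  linarith

/-- The rounding up costs less than 1 ≤ log n, and 1 / log 2 + 1 < 3. -/
theorem clog_le_log (hn : 3 ≤ n) : (Nat.clog 2 n : ℝ) ≤ 3 * Real.log n := by
  have h0 : 0 < Nat.clog 2 n := Nat.clog_pos (by norm_num) (by omega)
  have h1 : 2 ^ (Nat.clog 2 n - 1) < n := Nat.pow_pred_clog_lt_self (by norm_num) (by omega)
  have h2 : ((2 : ℝ) ^ (Nat.clog 2 n - 1)) ≤ n := by exact_mod_cast h1.le
  have h3 := Real.log_le_log (by positivity) h2
  rw [Real.log_pow, Nat.cast_sub h0, Nat.cast_one] at h3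
  have h4 := Real.log_two_gt_d9
  have h5 := one_le_log hn
  have h6 : (0 : ℝ) ≤ (Nat.clog 2 n : ℝ) - 1 := by
    have : (1 : ℝ) ≤ Nat.clog 2 n := by exact_mod_cast h0
    linarith
  nlinarith

theorem timeout_le_log (hn : 3 ≤ n) : (timeout n : ℝ) ≤ 1920 * (n * Real.log n) := by
  have h1 := clog_le_log hn
  have h2 := one_le_log hn
  have h3 : (0 : ℝ) ≤ n := Nat.cast_nonneg n
  have h4 : (timeout n : ℝ) = 480 * (n * ((Nat.clog 2 n : ℝ) + 1)) := by
    unfold timeout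
    push_cast
    ring
  rw [h4]
  have := mul_le_mul_of_nonneg_left (by linarith : (Nat.clog 2 n : ℝ) + 1 ≤ 4 * Real.log n) h3
  linarith

end Catch

end DynamicRing

/-! ### Assembly of the theorem. -/

open DynamicRing in
theorem mainTheorem2 :
    ∃ (afterCatch : Protocol) (C : ℝ), ∀ (n : ℕ), 3 ≤ n → ∀ (E : Environment n),
      -- both agents terminate in time `O(n log n)`
      (∃ t : ℕ, (t : ℝ) ≤ C * (n * Real.log n) ∧
        ∀ a : Agent, (execution (startFromLandmarkNoChirality afterCatch) E t a).terminated = true) ∧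
      -- when an agent has terminated, the ring has been explored
      (∀ (t : ℕ) (a : Agent),
        (execution (startFromLandmarkNoChirality afterCatch) E t a).terminated = true →
        ExploredBy (startFromLandmarkNoChirality afterCatch) E t) ∧
      -- once the agents have caught each other, both terminate within `O(n)` further rounds
      (∀ (t : ℕ) (a : Agent),
        (memoryAt (startFromLandmarkNoChirality afterCatch) E t a).phase = Phase.caught →
        ∃ t' : ℕ, (t' : ℝ) ≤ t + C * n ∧ ∀ b : Agent,
          (execution (startFromLandmarkNoChirality afterCatch) E t' b).terminated = true) ∧
      -- the identifiers have `O(log n)` bits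
      (∀ (t : ℕ) (a : Agent) (i : ℕ),
        (memoryAt (startFromLandmarkNoChirality afterCatch) E t a).ID = some i →
        (Nat.size i : ℝ) ≤ C * Real.log n) ∧
      -- the identifiers of the two agents are distinct, and the two schedules then agree on the
      -- direction during `5 n` consecutive rounds, after both identifiers have been computed
      (∀ (t i i' : ℕ),
        (memoryAt (startFromLandmarkNoChirality afterCatch) E t false).ID = some i →
        (memoryAt (startFromLandmarkNoChirality afterCatch) E t true).ID = some i' →
        i ≠ i' ∧
        ∃ s : ℕ, s + 5 * n ≤ timeout n ∧
          (∀ a : Agent,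
            (memoryAt (startFromLandmarkNoChirality afterCatch) E s a).ID.isSome = true) ∧
          ∀ r : ℕ, s ≤ r → r < s + 5 * n →
            globalDirection E false i r = globalDirection E true i' r) := by
  -- The running time needs 5 · 1920 + 200 = 9800; the other bounds need much less.
  refine ⟨catchProtocol, 10000, fun n hn E => ?_⟩
  have hlog := one_le_log hn
  have hclog := clog_le_log hn
  have htimeout := timeout_le_log hn
  have hn0 : (0 : ℝ) ≤ n := Nat.cast_nonneg n
  obtain ⟨T, hT, h1, h2⟩ := ends (E := E) hn
  refine ⟨⟨T, ?_, h1⟩, h2, fun t a h => ?_, fun t a i h => ?_, fun t i i' h h' => ?_⟩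
  · have h3 : (T : ℝ) ≤ 5 * timeout n + 200 * n := by exact_mod_cast hT
    have h4 := mul_le_mul_of_nonneg_left hlog hn0
    linarith
  · obtain ⟨s, hs, h3, h4⟩ := exists_catch (E := E) (t := t) fun hU => hU a h
    obtain ⟨T', hT', h5, -⟩ := ends_of_catch hn h3 h4
    refine ⟨T', ?_, h5⟩
    have h6 : (T' : ℝ) ≤ s + 1 + 200 * n := by exact_mod_cast hT'
    have h7 : (s : ℝ) + 1 ≤ t := by exact_mod_cast hs
    linarith
  · have h3 : (Nat.size i : ℝ) ≤ 3 * (Nat.clog 2 n + 3) := by exact_mod_cast (ID_bound hn h).2.1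
    linarith
  · have hne := ID_ne hn (a := false) h h'
    obtain ⟨p1, b1, c1⟩ := ID_bound hn h
    obtain ⟨p2, b2, c2⟩ := ID_bound hn h'
    obtain ⟨j, j1, j2, ⟨u, s, u1, u2, u3⟩, -⟩ :=
      exists_agreement hn hne b1 b2 p1 p2 (E.flipped false) (E.flipped true)
    -- Both identifiers exist by round 6n + 3, while the phase of agreement starts at 20n or later.
    have hu : 6 * n + 3 ≤ u := by omega
    refine ⟨hne, u, ?_, fun a => ?_, fun r r1 r2 => ?_⟩
    · have := Nat.pow_le_pow_right (by norm_num : 0 < 2) (Nat.le_succ (j + 1))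
      exact u2.trans (this.trans j2)
    · cases a
      · exact Option.isSome_iff_exists.2 ⟨i, ID_of_le hu c1⟩
      · exact Option.isSome_iff_exists.2 ⟨i', ID_of_le hu c2⟩
    · exact (u3 r r1 r2).1.trans (u3 r r1 r2).2.symm
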